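/- For $n\ge 1$ and $x\in\mathbb R^n$ put $\Delta(x)=\prod_{0\le j<k<n}(x_k-x_j)$. For $w:\mathbb R\to\mathbb R$ let $\mathrm{OE}_n(w)$ and $\mathrm{UE}_n(w)$ be the random $n$-point configurations on $\mathbb R$ with joint density on $\mathbb R^n$ proportional to $\prod_j w(x_j)\,|\Delta(x)|$ and $\prod_j w(x_j)\,\Delta(x)^2$ respectively; each is said to exist if this function is nonnegative almost everywhere and its integral over $\mathbb R^n$ is finite and positive. Let $M\cup M'$ denote the superposition of independent copies of $M$ and $M'$. For a random configuration $M$ of $2n$ points let $\mathrm{even}(M)$ consist of the 2nd, 4th, ..., $2n$-th largest points, let $\mathrm{odd}(M)$ consist of the 1st, 3rd, ..., $(2n-1)$-st largest points, and let $\mathrm{alt}(M)$ be $\mathrm{even}(M)$ with probability $1/2$ and $\mathrm{odd}(M)$ with probability $1/2$. Equality of random configurations means equality in law. **Theorem.** Fix an integer $n\ge 2$. Let $f:\mathbb R\to\mathbb R$ be differentiable on a possibly unbounded open interval $I\subset\mathbb R$ and $0$ outside $I$, and let $g:\mathbb R\to\mathbb R$ be a function. Then $\mathrm{OE}_n(f)$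 and $\mathrm{UE}_n(g)$ exist and satisfy $$\mathrm{alt}(\mathrm{OE}_n(f)\cup \mathrm{OE}_n(f))=\mathrm{UE}_n(g)$$ if and only if, up to a linear (affine) change of variables and constant factors, $f=(1+x^2)^{-(n+1)/2}$ and $g=(1+x^2)^{-n}$. That is, if and only if there are real numbers $a,b,c,d$ with $a\neq 0$, $c^n>0$ and $d^n>0$ such that $$f(x)=c\,\bigl(1+(ax+b)^2\bigr)^{-(n+1)/2}\ \text{ for all } x\in\mathbb R,\qquad g(x)=d\,\bigl(1+(ax+b)^2\bigr)^{-n}\ \text{ for almost every } x\in\mathbb R.$$ -/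

import Mathlib

open MeasureTheory

noncomputable section

namespace EigenvalueEnsemble

/-- The Vandermonde product `Δ(x) = ∏_{j < k} (x_k - x_j)`. -/
def vandermonde {n : ℕ} (x : Fin n → ℝ) : ℝ :=
  ∏ j : Fin n, ∏ k ∈ Finset.Ioi j, (x k - x j)

/-- The unnormalised joint density `∏_j w(x_j) * |Δ(x)| ^ β` on `ℝⁿ`. -/
def jointDensity (β n : ℕ) (w : ℝ → ℝ) (x : Fin n → ℝ) : ℝ :=
  (∏ j : Fin n, w (x j)) * |vandermonde x| ^ β

/-- The ensemble of `n` points with parameter `β` and weight `w` exists: its joint density is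
nonnegative (almost everywhere) and has a finite, nonzero integral, so it can be normalised to a
probability density. -/
structure IsWeight (β n : ℕ) (w : ℝ → ℝ) : Prop where
  nonneg : ∀ᵐ x : Fin n → ℝ, 0 ≤ jointDensity β n w x
  integrable : Integrable (jointDensity β n w)
  integral_pos : 0 < ∫ x, jointDensity β n w x

/-- The law on `ℝⁿ` with density proportional to `∏_j w(x_j) * |Δ(x)| ^ β`. -/
def ensemble (β n : ℕ) (w : ℝ → ℝ) : Measure (Fin n → ℝ) :=
  (∫⁻ x, ENNReal.ofReal (jointDensity β n w x))⁻¹ •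
    (volume : Measure (Fin n → ℝ)).withDensity (fun x => ENNReal.ofReal (jointDensity β n w x))

/-- The orthogonal ensemble `OE_n(w)`. -/
def OE (n : ℕ) (w : ℝ → ℝ) : Measure (Fin n → ℝ) := ensemble 1 n w

/-- The unitary ensemble `UE_n(w)`. -/
def UE (n : ℕ) (w : ℝ → ℝ) : Measure (Fin n → ℝ) := ensemble 2 n w

/-- The increasing rearrangement of a tuple of reals (repetitions are kept). -/
def sorted {m : ℕ} (x : Fin m → ℝ) : Fin m → ℝ := x ∘ Tuple.sort x

/-- The law of the increasingly ordered points of an ensemble. Ensembles are random unordered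
configurations of points, and are compared through this law. -/
def orderedLaw {m : ℕ} (M : Measure (Fin m → ℝ)) : Measure (Fin m → ℝ) := M.map sorted

/-- The random union `M ∪ M'`: a spectrum from `M` and an independent spectrum from `M'` are
superimposed. -/
def superpose {m n : ℕ} (M : Measure (Fin m → ℝ)) (M' : Measure (Fin n → ℝ)) :
    Measure (Fin (m + n) → ℝ) :=
  (M.prod M').map (fun p => Fin.append p.1 p.2)

/-- The 2nd, 4th, ..., `2n`-th largest of `2n` reals, listed increasingly. If
`y_0 ≤ y_1 ≤ ... ≤ y_{2n-1}` are the reals in increasing order, then `y_{2n-k}` is the `k`-th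
largest, so these are `y_0, y_2, ..., y_{2n-2}`. -/
def evenPoints {n : ℕ} (x : Fin (n + n) → ℝ) (i : Fin n) : ℝ :=
  sorted x ⟨2 * i.val, by omega⟩

/-- The 1st, 3rd, ..., `(2n-1)`-st largest of `2n` reals, listed increasingly. In increasing
order these are `y_1, y_3, ..., y_{2n-1}`. -/
def oddPoints {n : ℕ} (x : Fin (n + n) → ℝ) (i : Fin n) : ℝ :=
  sorted x ⟨2 * i.val + 1, by omega⟩

/-- The (ordered) law of `even(M)`, for an ensemble `M` of `2n` points. -/
def evenLaw {n : ℕ} (M : Measure (Fin (n + n) → ℝ)) : Measure (Fin n → ℝ) := M.map evenPoints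

/-- The (ordered) law of `odd(M)`, for an ensemble `M` of `2n` points. -/
def oddLaw {n : ℕ} (M : Measure (Fin (n + n) → ℝ)) : Measure (Fin n → ℝ) := M.map oddPoints

/-- The (ordered) law of `alt(M)`: `even(M)` with probability `1/2` and `odd(M)` with
probability `1/2`. -/
def altLaw {n : ℕ} (M : Measure (Fin (n + n) → ℝ)) : Measure (Fin n → ℝ) :=
  (2⁻¹ : ENNReal) • evenLaw M + (2⁻¹ : ENNReal) • oddLaw M

/-- Sorting is measurable, so that the image measures above are genuine images. -/
theorem measurable_sorted {m : ℕ} : Measurable (sorted : (Fin m → ℝ) → Fin m → ℝ) := by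
  have hs : ∀ σ : Equiv.Perm (Fin m), MeasurableSet {x : Fin m → ℝ | Monotone (x ∘ σ)} := by
    intro σ
    have : {x : Fin m → ℝ | Monotone (x ∘ σ)} =
        ⋂ i : Fin m, ⋂ j : Fin m, ⋂ _ : i ≤ j, {x | x (σ i) ≤ x (σ j)} := by
      ext x
      simp [Monotone]
    rw [this]
    exact MeasurableSet.iInter fun i => MeasurableSet.iInter fun j => MeasurableSet.iInter fun _ =>
      measurableSet_le (measurable_pi_apply _) (measurable_pi_apply _)
  intro s hms
  have : sorted ⁻¹' s = ⋃ σ : Equiv.Perm (Fin m),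
      ({x : Fin m → ℝ | Monotone (x ∘ σ)} ∩ (fun x : Fin m → ℝ => x ∘ σ) ⁻¹' s) := by
    ext x
    simp only [Set.mem_preimage, Set.mem_iUnion, Set.mem_inter_iff, Set.mem_ofPred_eq]
    constructor
    · intro h
      exact ⟨Tuple.sort x, Tuple.monotone_sort x, h⟩
    · rintro ⟨σ, h1, h2⟩
      have : sorted x = x ∘ σ := (Tuple.comp_sort_eq_comp_iff_monotone.mpr h1).symm
      rwa [this]
  rw [this]
  refine MeasurableSet.iUnion fun σ => (hs σ).inter ?_
  exact (measurable_pi_lambda _ fun i => measurable_pi_apply (σ i)) hms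

end EigenvalueEnsemble

end

/-!
Let `F_j(x) = ∫_{-∞}^x f(y) y ^ j dy` and `T_j = ∫ f(y) y ^ j dy`. The proof compares two densities
on increasing `n`-tuples.

*The density of the alternate points.* Superposing two copies of `OE_n(f)` and ordering the `2n`
points sums the product of two Vandermonde factors over all ways of splitting the points. By a
Laplace expansion of a single determinant this sum is a multiple of `Δ(even) * Δ(odd)`
(`sum_perm_abs_vandermonde`): the even and the odd points interact only through the interlacing.
Integrating out the points of one parity over the interlacing box gives a determinant of moments,
so the density of the alternate points is `∏ f(x_i) * Δ(x) * D(x)` with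
`D(x) = det (F_j(x_i)) + det (T_j - F_j(x_i))` (`altDet`, `altLaw_superpose`). Equality with
`UE_n(g)` therefore means `∏ f(x_i) * Δ(x) * D(x) = C * ∏ g(x_i) * Δ(x) ^ 2` almost everywhere
(`altLaw_eq_orderedLaw_iff`), that is, `D(x)` is a multiple of `∏ h(x_i) * Δ(x)` with `h = g / f`.

*The determinant as a boundary problem.* Up to sign, `D(x)` is a determinant of size `n + 1`, with
rows `(F_j(x_i))_j, 1` and the last row `(T_j)_j, 1 + (-1) ^ n`. As a function of one point it is
thus an antiderivative of `f` times a polynomial of degree less than `n`, and its limits at `±∞`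
agree up to the sign `(-1) ^ (n + 1)`; call such a function a twisted primitive
(`IsTwistedPrimitive`). Conversely, `n` twisted primitives `φ_k` satisfy
`det (φ_k(x_i)) = const * D(x)`. So `D(x)` is a multiple of `∏ h(x_i) * Δ(x)` when the functions
`h * p`, with `p` a polynomial of degree less than `n`, are twisted primitives.

*The Cauchy weights* satisfy this with `h = (1 + t ^ 2) ^ (-(n - 1) / 2)`, where `t = a x + b`
(`exists_cauchyRoot_eq_sum_lowerMoment`): in the derivative of `h * t ^ (n - 1)` the leading
coefficient cancels, and the limits of `h * t ^ (n - 1)` at `±∞` are `1` and `(-1) ^ (n - 1)`.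

*Uniqueness.* Freezing all points but one in the identity of densities shows that on the support of
`f` all products `h * p` are twisted primitives (`exists_multiplier`). The twisted primitives have
no common zero, as `D` does not vanish when all points but one lie in the support. On the other
hand `h' / f` and `(h * x)' / f` are polynomials, hence `h` is `f` times a polynomial `v`; so
`h * p` would vanish at a zero of `f` in the interval, and the boundary condition makes it vanish
at any finite end of the interval. Hence `f` has no zero and the interval is the whole line
(`support_eq_of_multiplier`, `eq_univ_of_multiplier`). By comparing degrees, `v` has degree at most
two; it has no roots, and the linear equation for `h` has the solution
`(1 + t ^ 2) ^ (-(n - 1) / 2) * exp (μ * arctan t)`, or an exponential if `v` is constant. The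
boundary condition excludes the exponential and forces `μ = 0` (`eq_cauchyRoot_of_multiplier`),
which determines `f`, and then the density determines `g` up to a constant and a null set. A weight
`f` which takes negative values reduces to `|f|`, which has the same joint density almost
everywhere.
-/

open MeasureTheory

noncomputable section

namespace EigenvalueEnsemble

/-! ### Vandermonde products -/

theorem vandermonde_eq_det {n : ℕ} (x : Fin n → ℝ) :
    vandermonde x = (Matrix.vandermonde x).det := by
  rw [Matrix.det_vandermonde]; rfl

theorem vandermonde_comp_perm {n : ℕ} (x : Fin n → ℝ) (σ : Equiv.Perm (Fin n)) :
    vandermonde (x ∘ σ) = (Equiv.Perm.sign σ : ℤ) * vandermonde x := by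
  rw [vandermonde_eq_det, vandermonde_eq_det, ← Matrix.det_permute σ]
  rfl

theorem abs_vandermonde_comp_perm {n : ℕ} (x : Fin n → ℝ) (σ : Equiv.Perm (Fin n)) :
    |vandermonde (x ∘ σ)| = |vandermonde x| := by
  rw [vandermonde_comp_perm, abs_mul]
  rcases Int.units_eq_one_or (Equiv.Perm.sign σ) with h | h <;> simp [h]

theorem vandermonde_pos {n : ℕ} {x : Fin n → ℝ} (hx : StrictMono x) : 0 < vandermonde x := by
  refine Finset.prod_pos fun j _ => Finset.prod_pos fun k hk => ?_
  exact sub_pos.2 (hx (Finset.mem_Ioi.1 hk))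

theorem vandermonde_ne_zero_iff {n : ℕ} {x : Fin n → ℝ} :
    vandermonde x ≠ 0 ↔ Function.Injective x := by
  rw [vandermonde_eq_det, Matrix.det_vandermonde_ne_zero_iff]

theorem continuous_vandermonde {n : ℕ} : Continuous (vandermonde : (Fin n → ℝ) → ℝ) := by
  unfold vandermonde; fun_prop

theorem vandermonde_append {m n : ℕ} (w : Fin (m + n) → ℝ) :
    vandermonde w = vandermonde (fun i => w (Fin.castAdd n i)) *
      vandermonde (fun j => w (Fin.natAdd m j)) *
        ∏ j : Fin n, ∏ i : Fin m, (w (Fin.natAdd m j) - w (Fin.castAdd n i)) := by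
  have key : ∀ (l : ℕ) (v : Fin l → ℝ), vandermonde v =
      ∏ j : Fin l, ∏ k : Fin l, if j < k then v k - v j else 1 := by
    intro l v
    refine Finset.prod_congr rfl fun j _ => ?_
    rw [← Finset.prod_filter]
    refine Finset.prod_congr ?_ fun _ _ => rfl
    ext k; simp
  have h1 : ∀ i k : Fin m, Fin.castAdd n i < Fin.castAdd n k ↔ i < k := by
    intro i k; simp only [Fin.lt_def, Fin.val_castAdd]
  have h2 : ∀ (i : Fin m) (k : Fin n), Fin.castAdd n i < Fin.natAdd m k := by
    intro i k; simp only [Fin.lt_def, Fin.val_castAdd, Fin.val_natAdd]; omega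
  have h3 : ∀ (i : Fin m) (k : Fin n), ¬ Fin.natAdd m k < Fin.castAdd n i := by
    intro i k; simp only [Fin.lt_def, Fin.val_castAdd, Fin.val_natAdd]; omega
  have h4 : ∀ i k : Fin n, Fin.natAdd m i < Fin.natAdd m k ↔ i < k := by
    intro i k; simp only [Fin.lt_def, Fin.val_natAdd]; omega
  have h5 := Finset.prod_comm (s := (Finset.univ : Finset (Fin n)))
    (t := (Finset.univ : Finset (Fin m))) (f := fun j i => w (Fin.natAdd m j) - w (Fin.castAdd n i))
  rw [h5, key, key, key, Fin.prod_univ_add]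
  simp only [Fin.prod_univ_add, h1, h2, h3, h4, if_true, if_false, Finset.prod_const_one, one_mul,
    Finset.prod_mul_distrib]
  ring

/-- The product of all ordered differences is the discriminant, up to a sign depending only on `n`. -/
theorem prod_prod_erase_sub {n : ℕ} :
    ∃ κ : ℝ, |κ| = 1 ∧ ∀ y : Fin n → ℝ,
      ∏ j : Fin n, ∏ k ∈ Finset.univ.erase j, (y j - y k) = κ * vandermonde y ^ 2 := by
  refine ⟨∏ j : Fin n, (-1) ^ (Finset.Ioi j).card, ?_, fun y => ?_⟩
  · rw [Finset.abs_prod]; simp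
  have h1 : ∀ j : Fin n, ∏ k ∈ Finset.univ.erase j, (y j - y k) =
      (∏ k ∈ Finset.Ioi j, (y j - y k)) * ∏ k ∈ Finset.Iio j, (y j - y k) := by
    intro j
    rw [← Finset.prod_union]
    · refine Finset.prod_congr ?_ fun _ _ => rfl
      ext k
      simp only [Finset.mem_erase, Finset.mem_univ, and_true, Finset.mem_union, Finset.mem_Ioi,
        Finset.mem_Iio]
      exact ⟨fun h => (lt_or_gt_of_ne h).symm.imp id id,
        fun h => h.elim (fun h => h.ne') fun h => h.ne⟩
    · rw [Finset.disjoint_left]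
      intro k hk hk'
      exact lt_asymm (Finset.mem_Ioi.1 hk) (Finset.mem_Iio.1 hk')
  have h2 : ∏ j : Fin n, ∏ k ∈ Finset.Ioi j, (y j - y k) =
      (∏ j : Fin n, (-1) ^ (Finset.Ioi j).card) * vandermonde y := by
    rw [vandermonde, ← Finset.prod_mul_distrib]
    refine Finset.prod_congr rfl fun j _ => ?_
    rw [← Finset.prod_const, ← Finset.prod_mul_distrib]
    exact Finset.prod_congr rfl fun k _ => by ring
  have h3 : ∏ j : Fin n, ∏ k ∈ Finset.Iio j, (y j - y k) = vandermonde y := by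
    rw [vandermonde]
    refine Finset.prod_comm' ?_
    intro j k; simp
  simp only [h1, Finset.prod_mul_distrib, h2, h3]
  ring

/-- For increasing `z`, the factors `z r - z k` with `k > r` are the negative ones, `m - 1 - r` in
number. -/
theorem prod_erase_sub_of_strictMono {m : ℕ} {z : Fin m → ℝ} (hz : StrictMono z) (r : Fin m) :
    ∏ k ∈ Finset.univ.erase r, (z r - z k) =
      (-1) ^ (m - 1 - (r : ℕ)) * |∏ k ∈ Finset.univ.erase r, (z r - z k)| := by
  have h1 : Finset.univ.erase r = (Finset.Ioi r).disjUnion (Finset.Iio r) (by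
      rw [Finset.disjoint_left]
      intro k hk hk'
      exact lt_asymm (Finset.mem_Ioi.1 hk) (Finset.mem_Iio.1 hk')) := by
    ext k
    simp only [Finset.mem_erase, Finset.mem_univ, and_true, Finset.mem_disjUnion, Finset.mem_Ioi,
      Finset.mem_Iio]
    exact ⟨fun h => (lt_or_gt_of_ne h).symm.imp id id,
      fun h => h.elim (fun h => h.ne') fun h => h.ne⟩
  rw [h1, Finset.prod_disjUnion, abs_mul, Finset.abs_prod, Finset.abs_prod, ← mul_assoc]
  congr 1
  · rw [← Fin.card_Ioi, ← Finset.prod_const, ← Finset.prod_mul_distrib]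
    refine Finset.prod_congr rfl fun k hk => ?_
    rw [abs_of_neg (sub_neg.2 (hz (Finset.mem_Ioi.1 hk)))]
    ring
  · refine Finset.prod_congr rfl fun k hk => ?_
    rw [abs_of_pos (sub_pos.2 (hz (Finset.mem_Iio.1 hk)))]

/-- For increasing `z`, the sign of a term of the Laplace expansion of a determinant along its first
`n` columns, the alternating signs `(-1) ^ r` of the rows feeding the last `n` columns included, is
the sign of the product of the two Vandermonde factors, up to one global sign. -/
theorem exists_sign_mul_vandermonde (n : ℕ) :
    ∃ κ : ℝ, |κ| = 1 ∧ ∀ z : Fin (n + n) → ℝ, StrictMono z → ∀ σ : Equiv.Perm (Fin (n + n)),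
      ((Equiv.Perm.sign σ : ℤ) : ℝ) *
        (∏ j : Fin n, (-1) ^ ((σ (Fin.natAdd n j) : Fin (n + n)) : ℕ)) *
        (vandermonde (fun i => z (σ (Fin.castAdd n i))) *
          vandermonde (fun j => z (σ (Fin.natAdd n j)))) =
      κ * |vandermonde (fun i => z (σ (Fin.castAdd n i))) *
          vandermonde (fun j => z (σ (Fin.natAdd n j)))| := by
  obtain ⟨κ, hκ, hκy⟩ := prod_prod_erase_sub (n := n)
  refine ⟨(-1) ^ n * κ, by simp [abs_mul, hκ], fun z hz σ => ?_⟩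
  have hκ2 : κ * κ = 1 := by rw [← abs_mul_abs_self, hκ, one_mul]
  set w : Fin (n + n) → ℝ := z ∘ σ with hw
  set A := vandermonde (fun i => w (Fin.castAdd n i)) with hA
  set B := vandermonde (fun j => w (Fin.natAdd n j)) with hB
  set R := ∏ j : Fin n, ∏ i : Fin n, (w (Fin.natAdd n j) - w (Fin.castAdd n i)) with hR
  have hz0 := vandermonde_pos hz
  -- `A * B * R` is the Vandermonde product of the permuted points; this determines the sign of `σ`
  -- in terms of the signs of `A * B` and of the mixed product `R`
  have h1 : A * B * R = (Equiv.Perm.sign σ : ℤ) * vandermonde z := by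
    rw [← vandermonde_comp_perm, ← hw, vandermonde_append w]
  have hP : ∀ j : Fin n, ∏ k ∈ Finset.univ.erase (σ (Fin.natAdd n j)),
      (z (σ (Fin.natAdd n j)) - z k) =
      (∏ i : Fin n, (w (Fin.natAdd n j) - w (Fin.castAdd n i))) *
        ∏ k ∈ Finset.univ.erase j, (w (Fin.natAdd n j) - w (Fin.natAdd n k)) := by
    intro j
    have e1 : ∏ k ∈ Finset.univ.erase (σ (Fin.natAdd n j)), (z (σ (Fin.natAdd n j)) - z k) =
        ∏ k : Fin (n + n), if k = Fin.natAdd n j then 1 else w (Fin.natAdd n j) - w k := by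
      rw [← Equiv.prod_comp σ.symm]
      simp only [hw, Function.comp, Equiv.apply_symm_apply, Equiv.symm_apply_eq]
      rw [Finset.prod_ite]
      simp only [Finset.prod_const_one, one_mul]
      refine Finset.prod_congr ?_ fun _ _ => rfl
      ext k; simp
    have hne : ∀ i : Fin n, Fin.castAdd n i ≠ Fin.natAdd n j := by
      intro i h
      have := congrArg Fin.val h
      simp only [Fin.val_castAdd, Fin.val_natAdd] at this
      omega
    have hinj : ∀ k : Fin n, Fin.natAdd n k = Fin.natAdd n j ↔ k = j := by
      intro k; simp
    rw [e1, Fin.prod_univ_add]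
    simp only [hne, if_false, hinj]
    congr 1
    rw [Finset.prod_ite]
    simp only [Finset.prod_const_one, one_mul]
    refine Finset.prod_congr ?_ fun _ _ => rfl
    ext k; simp
  -- the sign of `R` is found by computing the product of all `z (σ (n + j)) - z k` twice, once by
  -- blocks and once by counting negative factors
  have hprod : ∏ j : Fin n, ∏ k ∈ Finset.univ.erase (σ (Fin.natAdd n j)),
      (z (σ (Fin.natAdd n j)) - z k) = R * (κ * B ^ 2) := by
    simp only [hP, Finset.prod_mul_distrib]
    rw [hκy (fun j => w (Fin.natAdd n j))]
  have hε : ∏ j : Fin n, ∏ k ∈ Finset.univ.erase (σ (Fin.natAdd n j)),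
      (z (σ (Fin.natAdd n j)) - z k) = ((-1) ^ n *
        ∏ j : Fin n, (-1) ^ ((σ (Fin.natAdd n j) : Fin (n + n)) : ℕ)) * |R * (κ * B ^ 2)| := by
    rw [← hprod, Finset.abs_prod]
    have hc : ((-1 : ℝ) ^ n) = ∏ _j : Fin n, (-1 : ℝ) := by simp
    rw [hc, ← Finset.prod_mul_distrib, ← Finset.prod_mul_distrib]
    refine Finset.prod_congr rfl fun j _ => ?_
    rw [prod_erase_sub_of_strictMono hz]
    rw [abs_mul, abs_pow, abs_neg, abs_one, one_pow, one_mul, abs_abs]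
    congr 1
    have hlt := (σ (Fin.natAdd n j)).isLt
    set r : ℕ := ((σ (Fin.natAdd n j) : Fin (n + n)) : ℕ)
    have : n + n - 1 - r + (r + 1) = n + n := by omega
    have h2 : (-1 : ℝ) ^ (n + n - 1 - r) * (-1) ^ (r + 1) = 1 := by
      rw [← pow_add, this, ← two_mul, pow_mul]; simp
    have h3 : (-1 : ℝ) ^ (r + 1) * (-1) ^ (r + 1) = 1 := by
      rw [← pow_add, ← two_mul, pow_mul]; simp
    calc (-1 : ℝ) ^ (n + n - 1 - r)
        = (-1 : ℝ) ^ (n + n - 1 - r) * ((-1 : ℝ) ^ (r + 1) * (-1) ^ (r + 1)) := by rw [h3, mul_one]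
      _ = (-1) ^ (r + 1) := by rw [← mul_assoc, h2, one_mul]
      _ = -1 * (-1) ^ r := by ring
  set E := ∏ j : Fin n, (-1 : ℝ) ^ ((σ (Fin.natAdd n j) : Fin (n + n)) : ℕ) with hE
  set s : ℝ := ((Equiv.Perm.sign σ : ℤ) : ℝ) with hs
  have hs2 : |s| = 1 := by
    rcases Int.units_eq_one_or (Equiv.Perm.sign σ) with h | h <;> simp [hs, h]
  have hABR : |A * B| * |R| = vandermonde z := by
    rw [← abs_mul, h1, abs_mul, hs2, one_mul, abs_of_pos hz0]
  have hRpos : 0 < |R| := by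
    refine (abs_nonneg R).lt_of_ne' fun h => ?_
    rw [h, mul_zero] at hABR; exact hz0.ne hABR
  have hABpos : 0 < |A * B| := by
    refine (abs_nonneg _).lt_of_ne' fun h => ?_
    rw [h, zero_mul] at hABR; exact hz0.ne hABR
  have hAB0 : A * B ≠ 0 := abs_pos.1 hABpos
  have hB0 : B ≠ 0 := right_ne_zero_of_mul hAB0
  have hn2 : ((-1 : ℝ) ^ n) * (-1) ^ n = 1 := by rw [← pow_add, ← two_mul, pow_mul]; simp
  have h5 : R * κ = (-1) ^ n * E * |R| := by
    have h := hprod.symm.trans hε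
    rw [abs_mul, abs_mul, hκ, one_mul, abs_of_nonneg (sq_nonneg B)] at h
    have hB2 : B ^ 2 ≠ 0 := pow_ne_zero 2 hB0
    apply mul_right_cancel₀ hB2
    linarith
  have h6 : E * |R| = (-1) ^ n * κ * R := by
    calc E * |R| = ((-1 : ℝ) ^ n * (-1) ^ n) * (E * |R|) := by rw [hn2, one_mul]
      _ = (-1) ^ n * ((-1) ^ n * E * |R|) := by ring
      _ = _ := by rw [← h5]; ring
  have hABR' : A * B * R = s * (|A * B| * |R|) := by rw [h1, hABR]
  have hss : s * s = 1 := by rw [← abs_mul_abs_self, hs2, one_mul]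
  change s * E * (A * B) = (-1) ^ n * κ * |A * B|
  apply mul_right_cancel₀ hRpos.ne'
  calc s * E * (A * B) * |R| = s * (A * B) * (E * |R|) := by ring
    _ = s * ((-1) ^ n * κ) * (A * B * R) := by rw [h6]; ring
    _ = (s * s) * ((-1) ^ n * κ * |A * B| * |R|) := by rw [hABR']; ring
    _ = _ := by rw [hss, one_mul]

/-- The bijection of two copies of `Fin n` with `Fin (n + n)` which sends the first copy to the even
and the second copy to the odd numbers. -/
def interleaveEquiv (n : ℕ) : Fin n ⊕ Fin n ≃ Fin (n + n) where
  toFun := Sum.elim (fun i => ⟨2 * i.val, by omega⟩) (fun i => ⟨2 * i.val + 1, by omega⟩)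
  invFun r := if r.val % 2 = 0 then Sum.inl ⟨r.val / 2, by omega⟩ else Sum.inr ⟨r.val / 2, by omega⟩
  left_inv := by
    rintro (i | i)
    · simp
    · have : (2 * i.val + 1) / 2 = i.val := by omega
      simp [Nat.add_mod, this]
  right_inv := by
    intro r
    by_cases h : r.val % 2 = 0
    · simp only [h, if_true, Sum.elim_inl]; ext; simp only; omega
    · simp only [h, if_false, Sum.elim_inr]; ext; simp only; omega

/-- Summed over all ways of splitting `2n` increasing reals into two labelled `n`-tuples, the
products of the two Vandermonde factors add up to a multiple of the single product in which the
points alternate between the two factors. Both sides are, up to sign, the determinant of the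
`2n × 2n` matrix with rows `(z_r ^ j)_j, ((-1) ^ r * z_r ^ j)_j`: Laplace expansion along the first
`n` columns gives the sum, and column operations separate the even from the odd rows. -/
theorem sum_perm_abs_vandermonde (n : ℕ) {z : Fin (n + n) → ℝ} (hz : StrictMono z) :
    ∑ σ : Equiv.Perm (Fin (n + n)), |vandermonde (fun i => z (σ (Fin.castAdd n i)))| *
        |vandermonde (fun j => z (σ (Fin.natAdd n j)))| =
      (n.factorial : ℝ) ^ 2 * 2 ^ n * (vandermonde (fun i => z (interleaveEquiv n (Sum.inl i))) *
        vandermonde (fun i => z (interleaveEquiv n (Sum.inr i)))) := by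
  obtain ⟨κ, hκ, hκz⟩ := exists_sign_mul_vandermonde n
  set ε : Fin (n + n) → ℝ := fun r => (-1) ^ (r : ℕ) with hε
  let M : Matrix (Fin (n + n)) (Fin n ⊕ Fin n) ℝ := Matrix.of fun r =>
    Sum.elim (fun j => z r ^ (j : ℕ)) (fun j => ε r * z r ^ (j : ℕ))
  -- the evaluation of the determinant by column operations
  have hblock : M.submatrix (interleaveEquiv n) id =
      Matrix.fromBlocks (Matrix.vandermonde fun i => z (interleaveEquiv n (Sum.inl i)))
        0 0 (Matrix.vandermonde fun i => z (interleaveEquiv n (Sum.inr i))) *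
      Matrix.fromBlocks 1 1 1 (-1) := by
    rw [Matrix.fromBlocks_multiply]
    ext (i | i) (j | j) <;> simp [M, Matrix.vandermonde_apply, interleaveEquiv, hε, pow_add, pow_mul]
  have hdet1 : |(M.submatrix (interleaveEquiv n) id).det| = 2 ^ n *
      (vandermonde (fun i => z (interleaveEquiv n (Sum.inl i))) *
        vandermonde (fun i => z (interleaveEquiv n (Sum.inr i)))) := by
    have hneg : (-1 - 1 : Matrix (Fin n) (Fin n) ℝ) = (-2 : ℝ) • 1 := by
      ext i j; simp only [Matrix.sub_apply, Matrix.neg_apply, Matrix.smul_apply, smul_eq_mul]; ring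
    have he : StrictMono fun i => z (interleaveEquiv n (Sum.inl i)) := by
      intro i j hij; apply hz
      simp only [interleaveEquiv, Equiv.coe_fn_mk, Sum.elim_inl, Fin.lt_def] at *; omega
    have ho : StrictMono fun i => z (interleaveEquiv n (Sum.inr i)) := by
      intro i j hij; apply hz
      simp only [interleaveEquiv, Equiv.coe_fn_mk, Sum.elim_inr, Fin.lt_def] at *; omega
    rw [hblock, Matrix.det_mul, Matrix.det_fromBlocks_zero₂₁, Matrix.det_fromBlocks_one₁₁,
      Matrix.mul_one, hneg, Matrix.det_smul, Matrix.det_one, ← vandermonde_eq_det,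
      ← vandermonde_eq_det, abs_mul, abs_mul, abs_of_pos (vandermonde_pos he),
      abs_of_pos (vandermonde_pos ho)]
    simp only [Fintype.card_fin, mul_one, abs_pow, abs_neg, Nat.abs_ofNat]
    ring
  have hdet2 : |(M.submatrix (finSumFinEquiv : Fin n ⊕ Fin n ≃ Fin (n + n)) id).det| =
      |(M.submatrix (interleaveEquiv n) id).det| := by
    have : M.submatrix (interleaveEquiv n) id =
        (M.submatrix (finSumFinEquiv : Fin n ⊕ Fin n ≃ Fin (n + n)) id).submatrix
          ((interleaveEquiv n).trans finSumFinEquiv.symm) id := by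
      ext i j; simp
    rw [this, Matrix.det_permute, abs_mul]
    rcases Int.units_eq_one_or (Equiv.Perm.sign ((interleaveEquiv n).trans finSumFinEquiv.symm))
      with h | h <;> rw [h] <;> simp
  -- the Laplace expansion, obtained by averaging over permutations within the two column blocks
  have hτ : ∀ ρ : Equiv.Perm (Fin n) × Equiv.Perm (Fin n),
      (M.submatrix (finSumFinEquiv : Fin n ⊕ Fin n ≃ Fin (n + n)) id).det =
      ∑ τ : Equiv.Perm (Fin n ⊕ Fin n), ((Equiv.Perm.sign τ : ℤ) : ℝ) *
        ((((Equiv.Perm.sign ρ.1 : ℤ) : ℝ) *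
          ∏ j, z (finSumFinEquiv (τ (Sum.inl (ρ.1 j)))) ^ (j : ℕ)) *
        (((Equiv.Perm.sign ρ.2 : ℤ) : ℝ) * ∏ j, ε (finSumFinEquiv (τ (Sum.inr (ρ.2 j)))) *
          z (finSumFinEquiv (τ (Sum.inr (ρ.2 j)))) ^ (j : ℕ))) := by
    intro ρ
    rw [Matrix.det_apply, ← Equiv.sum_comp (Equiv.mulRight (Equiv.Perm.sumCongr ρ.1 ρ.2))]
    refine Finset.sum_congr rfl fun τ _ => ?_
    simp only [Equiv.coe_mulRight, Equiv.Perm.sign_mul, Equiv.Perm.sign_sumCongr,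
      Fintype.prod_sum_type, Matrix.submatrix_apply, id, Equiv.Perm.mul_apply,
      Equiv.Perm.sumCongr_apply, Sum.map_inl, Sum.map_inr, M, Matrix.of_apply, Sum.elim_inl,
      Sum.elim_inr, Units.smul_def, zsmul_eq_mul, Units.val_mul, Int.cast_mul]
    ring
  have hlap : (n.factorial : ℝ) ^ 2 *
      (M.submatrix (finSumFinEquiv : Fin n ⊕ Fin n ≃ Fin (n + n)) id).det =
      ∑ τ : Equiv.Perm (Fin n ⊕ Fin n), ((Equiv.Perm.sign τ : ℤ) : ℝ) *
        (∏ j, ε (finSumFinEquiv (τ (Sum.inr j)))) *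
        (vandermonde (fun j => z (finSumFinEquiv (τ (Sum.inl j)))) *
          vandermonde (fun j => z (finSumFinEquiv (τ (Sum.inr j))))) := by
    have hcard : ((n.factorial : ℝ) ^ 2) =
        (Finset.univ : Finset (Equiv.Perm (Fin n) × Equiv.Perm (Fin n))).card := by
      simp [Fintype.card_perm, sq]
    rw [hcard, ← nsmul_eq_mul, ← Finset.sum_const, Finset.sum_congr rfl fun ρ _ => hτ ρ,
      Finset.sum_comm]
    refine Finset.sum_congr rfl fun τ _ => ?_
    rw [← Finset.mul_sum]
    simp only [Fintype.sum_prod_type]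
    rw [← Finset.sum_mul_sum, mul_assoc]
    congr 1
    rw [vandermonde_eq_det, vandermonde_eq_det, Matrix.det_apply', Matrix.det_apply']
    simp only [Matrix.vandermonde_apply]
    rw [mul_left_comm (∏ j, ε _)]
    congr 1
    rw [Finset.mul_sum]
    refine Finset.sum_congr rfl fun ρ _ => ?_
    rw [Finset.prod_mul_distrib, Equiv.prod_comp ρ (fun j => ε (finSumFinEquiv (τ (Sum.inr j))))]
    ring
  have hsum : ∑ σ : Equiv.Perm (Fin (n + n)), |vandermonde (fun i => z (σ (Fin.castAdd n i)))| *
        |vandermonde (fun j => z (σ (Fin.natAdd n j)))| = κ * ((n.factorial : ℝ) ^ 2 *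
      (M.submatrix (finSumFinEquiv : Fin n ⊕ Fin n ≃ Fin (n + n)) id).det) := by
    have hκ2 : κ * κ = 1 := by rw [← abs_mul_abs_self, hκ, one_mul]
    rw [hlap, ← Equiv.sum_comp (Equiv.permCongr (finSumFinEquiv : Fin n ⊕ Fin n ≃ Fin (n + n))),
      Finset.mul_sum]
    refine Finset.sum_congr rfl fun τ _ => ?_
    have h := hκz z hz (Equiv.permCongr finSumFinEquiv τ)
    simp only [Equiv.Perm.sign_permCongr, Equiv.permCongr_apply, finSumFinEquiv_symm_apply_castAdd,
      finSumFinEquiv_symm_apply_natAdd] at h ⊢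
    rw [h, ← mul_assoc, hκ2, one_mul, abs_mul]
  have hnn : 0 ≤ ∑ σ : Equiv.Perm (Fin (n + n)), |vandermonde (fun i => z (σ (Fin.castAdd n i)))| *
        |vandermonde (fun j => z (σ (Fin.natAdd n j)))| :=
    Finset.sum_nonneg fun σ _ => by positivity
  rw [← abs_of_nonneg hnn, hsum, abs_mul, hκ, one_mul, abs_mul, hdet2, hdet1,
    abs_of_nonneg (by positivity)]
  ring

/-! ### Ordering the points -/

theorem measurePreserving_comp_perm {m : ℕ} (σ : Equiv.Perm (Fin m)) :
    MeasurePreserving (fun z : Fin m → ℝ => z ∘ σ) :=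
  (volume_measurePreserving_piCongrLeft (fun _ : Fin m => ℝ) σ).symm

theorem measurableEmbedding_comp_perm {m : ℕ} (σ : Equiv.Perm (Fin m)) :
    MeasurableEmbedding (fun z : Fin m → ℝ => z ∘ σ) :=
  (MeasurableEquiv.piCongrLeft (fun _ : Fin m => ℝ) σ).symm.measurableEmbedding

theorem measurableSet_strictMono {m : ℕ} : MeasurableSet {z : Fin m → ℝ | StrictMono z} := by
  have : {z : Fin m → ℝ | StrictMono z} =
      ⋂ i : Fin m, ⋂ j : Fin m, ⋂ _ : i < j, {z | z i < z j} := by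
    ext z
    simp [StrictMono]
  rw [this]
  exact MeasurableSet.iInter fun i => MeasurableSet.iInter fun j => MeasurableSet.iInter fun _ =>
    measurableSet_lt (measurable_pi_apply _) (measurable_pi_apply _)

theorem ae_injective {m : ℕ} : ∀ᵐ z : Fin m → ℝ, Function.Injective z := by
  have h : ∀ i j : Fin m, i ≠ j → ∀ᵐ z : Fin m → ℝ, z i ≠ z j := by
    intro i j hij
    let L : (Fin m → ℝ) →ₗ[ℝ] ℝ :=
      LinearMap.proj (R := ℝ) (φ := fun _ : Fin m => ℝ) i - LinearMap.proj j
    have hL : LinearMap.ker L ≠ ⊤ := by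
      intro h
      have : (Pi.single i 1 : Fin m → ℝ) ∈ LinearMap.ker L := by rw [h]; trivial
      simp [L, hij.symm] at this
    have h0 := Measure.addHaar_submodule (volume : Measure (Fin m → ℝ)) (LinearMap.ker L) hL
    filter_upwards [compl_mem_ae_iff.2 h0] with z hz hzz
    exact hz (by simp [L, hzz])
  have h' : ∀ᵐ z : Fin m → ℝ, ∀ i j, i ≠ j → z i ≠ z j :=
    ae_all_iff.2 fun i => ae_all_iff.2 fun j => by
      by_cases hij : i = j
      · simp [hij]
      · filter_upwards [h i j hij] with z hz _ using hz
  filter_upwards [h'] with z hz i j hij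
  by_contra hne
  exact hz i j hne hij

theorem sorted_eq_of_monotone {m : ℕ} {z : Fin m → ℝ} {σ : Equiv.Perm (Fin m)}
    (h : Monotone (z ∘ σ)) : sorted z = z ∘ σ :=
  (Tuple.comp_sort_eq_comp_iff_monotone.mpr h).symm

theorem strictMono_comp_sort {m : ℕ} {z : Fin m → ℝ} (hz : Function.Injective z) :
    StrictMono (z ∘ Tuple.sort z) :=
  (Tuple.monotone_sort z).strictMono_of_injective (hz.comp (Tuple.sort z).injective)

/-- The law of the ordered points of a configuration with density `W`: its density on the increasing
tuples is the sum of `W` over all labellings of the points. -/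
theorem map_sorted_withDensity {m : ℕ} {W : (Fin m → ℝ) → ENNReal} (hW : AEMeasurable W) :
    (volume.withDensity W).map sorted =
      (volume.restrict {z : Fin m → ℝ | StrictMono z}).withDensity
        fun z => ∑ σ : Equiv.Perm (Fin m), W (z ∘ σ) := by
  have hWσ : ∀ σ : Equiv.Perm (Fin m), AEMeasurable fun z : Fin m → ℝ => W (z ∘ σ) := fun σ =>
    hW.comp_quasiMeasurePreserving (measurePreserving_comp_perm σ).quasiMeasurePreserving
  ext A hA
  set O : Set (Fin m → ℝ) := {z | StrictMono z} with hO
  have hOm : MeasurableSet O := measurableSet_strictMono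
  rw [Measure.map_apply measurable_sorted hA, withDensity_apply _ (measurable_sorted hA),
    withDensity_apply _ hA, Measure.restrict_restrict hA,
    ← lintegral_indicator (measurable_sorted hA), ← lintegral_indicator (hA.inter hOm)]
  -- the permutation which sorts `z` is the only one that makes it increasing
  have h1 : ∀ᵐ z : Fin m → ℝ, (sorted ⁻¹' A).indicator W z =
      ∑ σ : Equiv.Perm (Fin m), (A ∩ O).indicator (fun y => W (y ∘ σ.symm)) (z ∘ σ) := by
    filter_upwards [ae_injective] with z hz
    rw [Finset.sum_eq_single (Tuple.sort z)]
    · by_cases h : sorted z ∈ A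
      · rw [Set.indicator_of_mem (by exact h), Set.indicator_of_mem
          (show z ∘ Tuple.sort z ∈ A ∩ O from ⟨h, strictMono_comp_sort hz⟩)]
        congr 1; ext i; simp
      · rw [Set.indicator_of_notMem (by exact h), Set.indicator_of_notMem fun h' => h h'.1]
    · intro σ _ hσ
      refine Set.indicator_of_notMem (fun h => hσ ?_) _
      have := sorted_eq_of_monotone (StrictMono.monotone h.2)
      ext i
      have h2 := congrFun this i
      exact congrArg Fin.val (hz h2).symm
    · intro h; exact absurd (Finset.mem_univ _) h
  have h2 : ∀ σ : Equiv.Perm (Fin m), AEMeasurable ((A ∩ O).indicator (fun y => W (y ∘ σ))) :=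
    fun σ => (hWσ σ).indicator (hA.inter hOm)
  rw [lintegral_congr_ae h1, lintegral_finsetSum']
  · have h3 : ∀ σ : Equiv.Perm (Fin m),
        ∫⁻ z : Fin m → ℝ, (A ∩ O).indicator (fun y => W (y ∘ σ.symm)) (z ∘ σ) =
        ∫⁻ z : Fin m → ℝ, (A ∩ O).indicator (fun y => W (y ∘ σ.symm)) z := fun σ =>
      (measurePreserving_comp_perm σ).lintegral_comp_emb (measurableEmbedding_comp_perm σ) _
    simp only [h3]
    rw [← Equiv.sum_comp (Equiv.inv (Equiv.Perm (Fin m)))]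
    simp only [Equiv.inv_apply, ← Equiv.Perm.inv_def, inv_inv]
    rw [← lintegral_finsetSum' _ fun σ _ => h2 σ]
    refine lintegral_congr fun z => ?_
    by_cases hz : z ∈ A ∩ O
    · simp only [Set.indicator_of_mem hz]
    · simp only [Set.indicator_of_notMem hz, Finset.sum_const_zero]
  · intro σ _
    exact (h2 σ.symm).comp_quasiMeasurePreserving
      (measurePreserving_comp_perm σ).quasiMeasurePreserving

/-- Splitting the coordinates of a tuple into two groups. -/
def splitEquiv {ι ι' κ : Type*} (e : ι ⊕ ι' ≃ κ) : (κ → ℝ) ≃ᵐ (ι → ℝ) × (ι' → ℝ) :=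
  (MeasurableEquiv.piCongrLeft (fun _ : κ => ℝ) e).symm.trans
    (MeasurableEquiv.sumPiEquivProdPi fun _ => ℝ)

theorem splitEquiv_apply {ι ι' κ : Type*} (e : ι ⊕ ι' ≃ κ) (z : κ → ℝ) :
    splitEquiv e z = (fun i => z (e (Sum.inl i)), fun i => z (e (Sum.inr i))) := rfl

theorem splitEquiv_symm_inl {ι ι' κ : Type*} (e : ι ⊕ ι' ≃ κ) (p : (ι → ℝ) × (ι' → ℝ)) (i : ι) :
    (splitEquiv e).symm p (e (Sum.inl i)) = p.1 i := by
  conv_rhs => rw [← (splitEquiv e).apply_symm_apply p]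
  rfl

theorem splitEquiv_symm_inr {ι ι' κ : Type*} (e : ι ⊕ ι' ≃ κ) (p : (ι → ℝ) × (ι' → ℝ)) (i : ι') :
    (splitEquiv e).symm p (e (Sum.inr i)) = p.2 i := by
  conv_rhs => rw [← (splitEquiv e).apply_symm_apply p]
  rfl

theorem measurePreserving_splitEquiv {ι ι' κ : Type*} [Fintype ι] [Fintype ι'] [Fintype κ]
    (e : ι ⊕ ι' ≃ κ) : MeasurePreserving (splitEquiv e) :=
  (volume_measurePreserving_sumPiEquivProdPi fun _ => ℝ).comp
    (volume_measurePreserving_piCongrLeft (fun _ : κ => ℝ) e).symm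

theorem map_withDensity_equiv {α β : Type*} [MeasurableSpace α] [MeasurableSpace β] {μ : Measure α}
    {ν : Measure β} (e : α ≃ᵐ β) (he : MeasurePreserving e μ ν) (W : β → ENNReal) :
    (μ.withDensity fun a => W (e a)).map e = ν.withDensity W := by
  ext A hA
  rw [Measure.map_apply e.measurable hA, withDensity_apply _ (e.measurable hA),
    withDensity_apply _ hA, he.setLIntegral_comp_preimage_emb e.measurableEmbedding]

theorem aemeasurable_ofReal_jointDensity {β n : ℕ} {w : ℝ → ℝ} (hw : IsWeight β n w) :
    AEMeasurable fun x : Fin n → ℝ => ENNReal.ofReal (jointDensity β n w x) :=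
  hw.integrable.aestronglyMeasurable.aemeasurable.ennreal_ofReal

theorem lintegral_jointDensity {β n : ℕ} {w : ℝ → ℝ} (hw : IsWeight β n w) :
    ∫⁻ x, ENNReal.ofReal (jointDensity β n w x) = ENNReal.ofReal (∫ x, jointDensity β n w x) :=
  (ofReal_integral_eq_lintegral_ofReal hw.integrable hw.nonneg).symm

theorem lintegral_jointDensity_ne_zero {β n : ℕ} {w : ℝ → ℝ} (hw : IsWeight β n w) :
    ∫⁻ x, ENNReal.ofReal (jointDensity β n w x) ≠ 0 := by
  rw [lintegral_jointDensity hw]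
  simpa using hw.integral_pos

theorem lintegral_jointDensity_ne_top {β n : ℕ} {w : ℝ → ℝ} (hw : IsWeight β n w) :
    ∫⁻ x, ENNReal.ofReal (jointDensity β n w x) ≠ ⊤ := by
  rw [lintegral_jointDensity hw]
  exact ENNReal.ofReal_ne_top

theorem isProbabilityMeasure_ensemble {β n : ℕ} {w : ℝ → ℝ} (hw : IsWeight β n w) :
    IsProbabilityMeasure (ensemble β n w) := by
  constructor
  rw [ensemble, Measure.smul_apply, withDensity_apply _ MeasurableSet.univ, Measure.restrict_univ,
    smul_eq_mul]
  exact ENNReal.inv_mul_cancel (lintegral_jointDensity_ne_zero hw) (lintegral_jointDensity_ne_top hw)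

theorem jointDensity_comp_perm {β n : ℕ} (w : ℝ → ℝ) (x : Fin n → ℝ) (σ : Equiv.Perm (Fin n)) :
    jointDensity β n w (x ∘ σ) = jointDensity β n w x := by
  unfold jointDensity
  rw [abs_vandermonde_comp_perm]
  congr 1
  exact Equiv.prod_comp σ fun i => w (x i)

/-- The joint density is symmetric, so ordering the points only restricts it to increasing tuples. -/
theorem orderedLaw_ensemble {β n : ℕ} {w : ℝ → ℝ} (hw : IsWeight β n w) :
    ∃ c : ENNReal, c ≠ 0 ∧ c ≠ ⊤ ∧ orderedLaw (ensemble β n w) =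
      c • (volume.restrict {z : Fin n → ℝ | StrictMono z}).withDensity
        fun z => ENNReal.ofReal (jointDensity β n w z) := by
  refine ⟨(∫⁻ x, ENNReal.ofReal (jointDensity β n w x))⁻¹ * n.factorial, ?_, ?_, ?_⟩
  · simpa [lintegral_jointDensity_ne_top hw] using n.factorial_ne_zero
  · exact ENNReal.mul_ne_top (ENNReal.inv_ne_top.2 (lintegral_jointDensity_ne_zero hw))
      (ENNReal.natCast_ne_top _)
  · rw [orderedLaw, ensemble, Measure.map_smul,
      map_sorted_withDensity (aemeasurable_ofReal_jointDensity hw), mul_smul]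
    congr 1
    rw [← withDensity_smul' _ _ (ENNReal.natCast_ne_top _)]
    congr 1
    ext z
    simp only [jointDensity_comp_perm, Finset.sum_const, Finset.card_univ, Fintype.card_perm,
      Fintype.card_fin, nsmul_eq_mul, Pi.smul_apply, smul_eq_mul]

/-- The ordered points of two superimposed copies of an orthogonal ensemble have a density in which
the points of even and of odd rank interact only among themselves. -/
theorem map_sorted_superpose {n : ℕ} {f : ℝ → ℝ} (hf : IsWeight 1 n f) (hf0 : ∀ x, 0 ≤ f x) :
    ∃ c : ENNReal, c ≠ 0 ∧ c ≠ ⊤ ∧ (superpose (OE n f) (OE n f)).map sorted =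
      c • (volume.restrict {z : Fin (n + n) → ℝ | StrictMono z}).withDensity
        fun z => ENNReal.ofReal ((∏ r, f (z r)) *
          (vandermonde (fun i => z (interleaveEquiv n (Sum.inl i))) *
            vandermonde (fun i => z (interleaveEquiv n (Sum.inr i))))) := by
  set Z := (∫⁻ x, ENNReal.ofReal (jointDensity 1 n f x)) with hZ
  have hZ0 : Z ≠ 0 := lintegral_jointDensity_ne_zero hf
  have hZt : Z ≠ ⊤ := lintegral_jointDensity_ne_top hf
  have hm := aemeasurable_ofReal_jointDensity hf
  set d : (Fin n → ℝ) → ENNReal := fun x => ENNReal.ofReal (jointDensity 1 n f x) with hd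
  have hfin : SFinite ((volume : Measure (Fin n → ℝ)).withDensity d) := inferInstance
  set W : (Fin (n + n) → ℝ) → ENNReal := fun z =>
    d (fun i => z (Fin.castAdd n i)) * d (fun i => z (Fin.natAdd n i)) with hW
  have hWe : W = fun z => (fun p : (Fin n → ℝ) × (Fin n → ℝ) => d p.1 * d p.2)
      (splitEquiv finSumFinEquiv z) := by
    ext z; rw [splitEquiv_apply]; simp [hW]
  have hWm : AEMeasurable W := by
    rw [hWe]
    refine AEMeasurable.comp_quasiMeasurePreserving (ν := volume) (f := splitEquiv finSumFinEquiv)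
      (g := fun p : (Fin n → ℝ) × (Fin n → ℝ) => d p.1 * d p.2) ?_
      (measurePreserving_splitEquiv finSumFinEquiv).quasiMeasurePreserving
    exact (hm.comp_quasiMeasurePreserving Measure.quasiMeasurePreserving_fst).mul
      (hm.comp_quasiMeasurePreserving Measure.quasiMeasurePreserving_snd)
  have happ : (fun p : (Fin n → ℝ) × (Fin n → ℝ) => Fin.append p.1 p.2) =
      (splitEquiv (finSumFinEquiv : Fin n ⊕ Fin n ≃ Fin (n + n))).symm := by
    ext p : 1
    rw [eq_comm, MeasurableEquiv.symm_apply_eq, splitEquiv_apply]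
    simp only [finSumFinEquiv_apply_left, finSumFinEquiv_apply_right, Fin.append_left,
      Fin.append_right]
  -- the superposition, before ordering, has the product density
  have hsup : superpose (OE n f) (OE n f) = (Z⁻¹ * Z⁻¹) • volume.withDensity W := by
    rw [superpose, OE, ensemble, Measure.prod_smul_left, Measure.prod_smul_right, smul_smul,
      Measure.map_smul, prod_withDensity₀ hm hm, happ]
    congr 1
    have h := map_withDensity_equiv (splitEquiv finSumFinEquiv)
      (measurePreserving_splitEquiv finSumFinEquiv)
      (fun p : (Fin n → ℝ) × (Fin n → ℝ) => d p.1 * d p.2)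
    rw [← hWe] at h
    rw [← Measure.volume_eq_prod, ← h, MeasurableEquiv.map_symm_map]
  set K : ENNReal := ENNReal.ofReal ((n.factorial : ℝ) ^ 2 * 2 ^ n) with hK
  refine ⟨Z⁻¹ * Z⁻¹ * K, ?_, ?_, ?_⟩
  · refine mul_ne_zero (mul_ne_zero ?_ ?_) ?_
    · exact ENNReal.inv_ne_zero.2 hZt
    · exact ENNReal.inv_ne_zero.2 hZt
    · have : (0 : ℝ) < (n.factorial : ℝ) ^ 2 * 2 ^ n := by positivity
      exact (ENNReal.ofReal_pos.2 this).ne'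
  · exact ENNReal.mul_ne_top (ENNReal.mul_ne_top (ENNReal.inv_ne_top.2 hZ0)
      (ENNReal.inv_ne_top.2 hZ0)) ENNReal.ofReal_ne_top
  · rw [hsup, Measure.map_smul, map_sorted_withDensity hWm, mul_smul _ K]
    congr 1
    rw [← withDensity_smul' _ _ ENNReal.ofReal_ne_top]
    refine withDensity_congr_ae ?_
    filter_upwards [ae_restrict_mem measurableSet_strictMono] with z hz
    have hjd : ∀ x : Fin n → ℝ, 0 ≤ jointDensity 1 n f x := fun x =>
      mul_nonneg (Finset.prod_nonneg fun i _ => hf0 _) (by positivity)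
    have hprod : ∀ σ : Equiv.Perm (Fin (n + n)),
        (∏ i, f (z (σ (Fin.castAdd n i)))) * ∏ i, f (z (σ (Fin.natAdd n i))) = ∏ r, f (z r) := by
      intro σ
      rw [← Fin.prod_univ_add (fun r => f (z (σ r))), Equiv.prod_comp σ fun r => f (z r)]
    simp only [hW, hd, Function.comp, ← ENNReal.ofReal_mul (hjd _), Pi.smul_apply, smul_eq_mul]
    rw [← ENNReal.ofReal_sum_of_nonneg fun σ _ => mul_nonneg (hjd _) (hjd _),
      ← ENNReal.ofReal_mul (by positivity)]
    congr 1
    have h := sum_perm_abs_vandermonde n hz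
    calc _ = ∑ σ : Equiv.Perm (Fin (n + n)), (∏ r, f (z r)) *
          (|vandermonde (fun i => z (σ (Fin.castAdd n i)))| *
            |vandermonde (fun j => z (σ (Fin.natAdd n j)))|) := by
          refine Finset.sum_congr rfl fun σ _ => ?_
          rw [← hprod σ]; simp only [jointDensity, pow_one]; ring
      _ = _ := by rw [← Finset.mul_sum, h]; ring

/-! ### Integrals over interlacing boxes -/

/-- A nonnegative measurable weight with finite moments of the orders `0, ..., n - 1`. -/
structure HasMoments (n : ℕ) (f : ℝ → ℝ) : Prop where
  measurable : Measurable f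
  nonneg : ∀ x, 0 ≤ f x
  integrable : ∀ j < n, Integrable fun y => f y * y ^ j

/-- The incomplete moment `∫_{-∞}^x f(y) y ^ j dy`. -/
def lowerMoment (f : ℝ → ℝ) (j : ℕ) (x : ℝ) : ℝ := ∫ y in Set.Iic x, f y * y ^ j

/-- The moment `∫ f(y) y ^ j dy` over the whole line. -/
def totalMoment (f : ℝ → ℝ) (j : ℕ) : ℝ := ∫ y, f y * y ^ j

/-- The determinant of the moments of `f` on the half-lines below the points. -/
def lowerDet {n : ℕ} (f : ℝ → ℝ) (x : Fin n → ℝ) : ℝ :=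
  (Matrix.of fun i j : Fin n => lowerMoment f j (x i)).det

/-- The determinant of the moments of `f` on the half-lines above the points. -/
def upperDet {n : ℕ} (f : ℝ → ℝ) (x : Fin n → ℝ) : ℝ :=
  (Matrix.of fun i j : Fin n => totalMoment f j - lowerMoment f j (x i)).det

/-- For increasing `x`, this is the integral of `∏ f(y_j) * Δ(y)` over all `n`-tuples `y` which
interlace with `x`, whether from above or from below. -/
def altDet {n : ℕ} (f : ℝ → ℝ) (x : Fin n → ℝ) : ℝ := upperDet f x + lowerDet f x

/-- The tuples interlacing with `x` from above are those with `y i ∈ upperBox x i` for all `i`. -/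
def upperBox {n : ℕ} (x : Fin n → ℝ) (i : Fin n) : Set ℝ := {y | x i < y ∧ ∀ k, i < k → y < x k}

/-- The tuples interlacing with `x` from below are those with `y i ∈ lowerBox x i` for all `i`. -/
def lowerBox {n : ℕ} (x : Fin n → ℝ) (i : Fin n) : Set ℝ := {y | y < x i ∧ ∀ k, k < i → x k < y}

theorem measurableSet_upperBox {n : ℕ} (x : Fin n → ℝ) (i : Fin n) :
    MeasurableSet (upperBox x i) := by
  have : upperBox x i = Set.Ioi (x i) ∩ ⋂ k : Fin n, ⋂ _ : i < k, Set.Iio (x k) := by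
    ext y; simp [upperBox]
  rw [this]
  exact measurableSet_Ioi.inter
    (MeasurableSet.iInter fun _ => MeasurableSet.iInter fun _ => measurableSet_Iio)

theorem measurableSet_lowerBox {n : ℕ} (x : Fin n → ℝ) (i : Fin n) :
    MeasurableSet (lowerBox x i) := by
  have : lowerBox x i = Set.Iio (x i) ∩ ⋂ k : Fin n, ⋂ _ : k < i, Set.Ioi (x k) := by
    ext y; simp [lowerBox]
  rw [this]
  exact measurableSet_Iio.inter
    (MeasurableSet.iInter fun _ => MeasurableSet.iInter fun _ => measurableSet_Ioi)

theorem strictMono_of_mem_upperBox {n : ℕ} {x y : Fin n → ℝ} (h : ∀ i, y i ∈ upperBox x i) :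
    StrictMono y := fun i k hik => ((h i).2 k hik).trans (h k).1

theorem strictMono_of_mem_lowerBox {n : ℕ} {x y : Fin n → ℝ} (h : ∀ i, y i ∈ lowerBox x i) :
    StrictMono y := fun i k hik => (h i).1.trans ((h k).2 i hik)

/-- The Vandermonde product expanded as a determinant, so that the variables separate. -/
theorem prod_mul_vandermonde_eq {n : ℕ} (f : ℝ → ℝ) (y : Fin n → ℝ) :
    (∏ i, f (y i)) * vandermonde y = ∑ σ : Equiv.Perm (Fin n), ((Equiv.Perm.sign σ : ℤ) : ℝ) *
      ∏ i, f (y i) * y i ^ (σ i : ℕ) := by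
  rw [vandermonde_eq_det, ← Matrix.det_transpose, Matrix.det_apply', Finset.mul_sum]
  refine Finset.sum_congr rfl fun σ _ => ?_
  simp only [Matrix.transpose_apply, Matrix.vandermonde_apply, Finset.prod_mul_distrib]
  ring

theorem volume_restrict_pi {n : ℕ} (J : Fin n → Set ℝ) :
    (volume : Measure (Fin n → ℝ)).restrict (Set.univ.pi J) =
      Measure.pi fun i => volume.restrict (J i) := by
  rw [volume_pi, Measure.restrict_pi_pi]

theorem integrableOn_pi_prod_mul_vandermonde {n : ℕ} {f : ℝ → ℝ} (hf : HasMoments n f)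
    (J : Fin n → Set ℝ) :
    IntegrableOn (fun y => (∏ i, f (y i)) * vandermonde y) (Set.univ.pi J) := by
  unfold IntegrableOn
  rw [volume_restrict_pi]
  simp only [prod_mul_vandermonde_eq]
  refine integrable_finsetSum _ fun σ _ => Integrable.const_mul ?_ _
  exact Integrable.fintype_prod_dep (f := fun i y => f y * y ^ (σ i : ℕ)) fun i =>
    (hf.integrable _ (σ i).isLt).restrict

theorem setIntegral_pi_prod_mul_vandermonde {n : ℕ} {f : ℝ → ℝ} (hf : HasMoments n f)
    (J : Fin n → Set ℝ) :
    ∫ y in Set.univ.pi J, (∏ i, f (y i)) * vandermonde y =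
      (Matrix.of fun i j : Fin n => ∫ y in J i, f y * y ^ (j : ℕ)).det := by
  rw [volume_restrict_pi]
  simp only [prod_mul_vandermonde_eq]
  rw [integral_finsetSum, ← Matrix.det_transpose, Matrix.det_apply']
  · refine Finset.sum_congr rfl fun σ _ => ?_
    rw [integral_const_mul, integral_fintype_prod_eq_prod (f := fun i y => f y * y ^ (σ i : ℕ))]
    rfl
  · refine fun σ _ => Integrable.const_mul ?_ _
    exact Integrable.fintype_prod_dep (f := fun i y => f y * y ^ (σ i : ℕ)) fun i =>
      (hf.integrable _ (σ i).isLt).restrict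

theorem setIntegral_Ioi_eq {n : ℕ} {f : ℝ → ℝ} (hf : HasMoments n f) {j : ℕ} (hj : j < n) (x : ℝ) :
    ∫ y in Set.Ioi x, f y * y ^ j = totalMoment f j - lowerMoment f j x := by
  have h := integral_add_compl (s := Set.Iic x) measurableSet_Iic (hf.integrable j hj)
  rw [Set.compl_Iic] at h
  rw [totalMoment, lowerMoment, ← h]; ring

theorem setIntegral_Ioo_eq {n : ℕ} {f : ℝ → ℝ} (hf : HasMoments n f) {j : ℕ} (hj : j < n)
    {a b : ℝ} (hab : a ≤ b) :
    ∫ y in Set.Ioo a b, f y * y ^ j = lowerMoment f j b - lowerMoment f j a := by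
  have h := setIntegral_union (Set.Iic_disjoint_Ioc (le_refl a) :
    Disjoint (Set.Iic a) (Set.Ioc a b))
    measurableSet_Ioc (hf.integrable j hj).integrableOn (hf.integrable j hj).integrableOn
  rw [Set.Iic_union_Ioc_eq_Iic hab, integral_Ioc_eq_integral_Ioo] at h
  rw [lowerMoment, lowerMoment, h]; ring

theorem continuous_lowerMoment {n : ℕ} {f : ℝ → ℝ} (hf : HasMoments n f) {j : ℕ} (hj : j < n) :
    Continuous (lowerMoment f j) := by
  have hint := hf.integrable j hj
  have h : lowerMoment f j = fun x => lowerMoment f j 0 + ∫ y in (0 : ℝ)..x, f y * y ^ j := by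
    ext x
    rw [lowerMoment, lowerMoment, ← intervalIntegral.integral_Iic_sub_Iic hint.integrableOn
      hint.integrableOn]
    ring
  rw [h]
  exact continuous_const.add (intervalIntegral.continuous_primitive
    (fun a b => hint.intervalIntegrable) 0)

theorem continuous_lowerDet {n : ℕ} {f : ℝ → ℝ} (hf : HasMoments n f) :
    Continuous (lowerDet f : (Fin n → ℝ) → ℝ) :=
  Continuous.matrix_det (continuous_matrix fun i j =>
    (continuous_lowerMoment hf j.isLt).comp (continuous_apply i))

theorem continuous_upperDet {n : ℕ} {f : ℝ → ℝ} (hf : HasMoments n f) :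
    Continuous (upperDet f : (Fin n → ℝ) → ℝ) :=
  Continuous.matrix_det (continuous_matrix fun i j =>
    continuous_const.sub ((continuous_lowerMoment hf j.isLt).comp (continuous_apply i)))

theorem continuous_altDet {n : ℕ} {f : ℝ → ℝ} (hf : HasMoments n f) :
    Continuous (altDet f : (Fin n → ℝ) → ℝ) :=
  (continuous_upperDet hf).add (continuous_lowerDet hf)

/-- The box from below is a product of the intervals between consecutive points, starting at `-∞`;
adding up the rows of the determinant of the moments over these intervals gives those of the
half-lines. -/
theorem setIntegral_lowerBox {n : ℕ} {f : ℝ → ℝ} (hf : HasMoments n f) {x : Fin n → ℝ}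
    (hx : StrictMono x) :
    ∫ y in Set.univ.pi (lowerBox x), (∏ i, f (y i)) * vandermonde y = lowerDet f x := by
  rw [setIntegral_pi_prod_mul_vandermonde hf]
  obtain _ | m := n
  · simp [lowerDet]
  refine (Matrix.det_eq_of_forall_row_eq_smul_add_pred (fun _ => 1) ?_ ?_).symm
  · intro j
    have : lowerBox x 0 = Set.Iio (x 0) := by ext y; simp [lowerBox]
    simp only [Matrix.of_apply, this, lowerMoment]
    rw [integral_Iic_eq_integral_Iio]
  · intro i j
    have : lowerBox x i.succ = Set.Ioo (x i.castSucc) (x i.succ) := by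
      ext y
      simp only [lowerBox, Set.mem_ofPred_eq, Set.mem_Ioo]
      refine ⟨fun h => ⟨h.2 _ Fin.castSucc_lt_succ, h.1⟩, fun h => ⟨h.2, fun k hk => ?_⟩⟩
      exact (hx.monotone (Fin.le_castSucc_iff.2 hk)).trans_lt h.1
    simp only [Matrix.of_apply, this]
    rw [setIntegral_Ioo_eq hf j.isLt (hx.monotone Fin.castSucc_lt_succ.le)]
    ring

/-- As for `setIntegral_lowerBox`, the rows being added up from the last one. -/
theorem setIntegral_upperBox {n : ℕ} {f : ℝ → ℝ} (hf : HasMoments n f) {x : Fin n → ℝ}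
    (hx : StrictMono x) :
    ∫ y in Set.univ.pi (upperBox x), (∏ i, f (y i)) * vandermonde y = upperDet f x := by
  rw [setIntegral_pi_prod_mul_vandermonde hf]
  obtain _ | m := n
  · simp [upperDet]
  have hrev : ∀ A B : Matrix (Fin (m + 1)) (Fin (m + 1)) ℝ,
      (A.submatrix Fin.revPerm id).det = (B.submatrix Fin.revPerm id).det → A.det = B.det := by
    intro A B h
    rw [Matrix.det_permute, Matrix.det_permute] at h
    refine mul_left_cancel₀ ?_ h
    rcases Int.units_eq_one_or (Equiv.Perm.sign (Fin.revPerm (n := m + 1))) with h | h <;> simp [h]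
  refine hrev _ _ (Matrix.det_eq_of_forall_row_eq_smul_add_pred (fun _ => 1) ?_ ?_).symm
  · intro j
    have : upperBox x (Fin.last m) = Set.Ioi (x (Fin.last m)) := by
      ext y
      simp only [upperBox, Set.mem_ofPred_eq, Set.mem_Ioi, and_iff_left_iff_imp]
      exact fun _ k hk => absurd hk (not_lt_of_ge (Fin.le_last k))
    simp only [Matrix.of_apply, Matrix.submatrix_apply, Fin.revPerm_apply, Fin.rev_zero, id, this]
    rw [setIntegral_Ioi_eq hf j.isLt]
  · intro i j
    have : upperBox x i.rev.castSucc = Set.Ioo (x i.rev.castSucc) (x i.rev.succ) := by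
      ext y
      simp only [upperBox, Set.mem_ofPred_eq, Set.mem_Ioo]
      refine ⟨fun h => ⟨h.1, h.2 _ Fin.castSucc_lt_succ⟩, fun h => ⟨h.1, fun k hk => ?_⟩⟩
      exact h.2.trans_le (hx.monotone (Fin.castSucc_lt_iff_succ_le.1 hk))
    simp only [Matrix.of_apply, Matrix.submatrix_apply, Fin.revPerm_apply, Fin.rev_succ,
      Fin.rev_castSucc, id, this]
    rw [setIntegral_Ioo_eq hf j.isLt (hx.monotone Fin.castSucc_lt_succ.le)]
    ring

theorem setIntegral_pi_nonneg {n : ℕ} {f : ℝ → ℝ} (hf : HasMoments n f) {J : Fin n → Set ℝ}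
    (hJ : ∀ i, MeasurableSet (J i)) (hmono : ∀ y : Fin n → ℝ, (∀ i, y i ∈ J i) → StrictMono y) :
    0 ≤ ∫ y in Set.univ.pi J, (∏ i, f (y i)) * vandermonde y := by
  refine setIntegral_nonneg (MeasurableSet.univ_pi hJ) fun y hy => ?_
  exact mul_nonneg (Finset.prod_nonneg fun i _ => hf.nonneg _)
    (vandermonde_pos (hmono y fun i => hy i trivial)).le

theorem setIntegral_pi_pos {n : ℕ} {f : ℝ → ℝ} (hf : HasMoments n f) {J : Fin n → Set ℝ}
    (hJ : ∀ i, MeasurableSet (J i)) (hmono : ∀ y : Fin n → ℝ, (∀ i, y i ∈ J i) → StrictMono y)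
    (hpos : ∀ i, volume (J i ∩ Function.support f) ≠ 0) :
    0 < ∫ y in Set.univ.pi J, (∏ i, f (y i)) * vandermonde y := by
  rw [setIntegral_pos_iff_support_of_nonneg_ae]
  · refine lt_of_lt_of_le ?_ (measure_mono (s := Set.univ.pi fun i => J i ∩ Function.support f) ?_)
    · rw [volume_pi_pi]
      exact (Finset.prod_ne_zero_iff.2 fun i _ => hpos i).bot_lt
    · intro y hy
      refine ⟨mul_ne_zero (Finset.prod_ne_zero_iff.2 fun i _ => (hy i trivial).2) ?_,
        fun i _ => (hy i trivial).1⟩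
      exact (vandermonde_pos (hmono y fun i => (hy i trivial).1)).ne'
  · filter_upwards [ae_restrict_mem (MeasurableSet.univ_pi hJ)] with y hy
    exact mul_nonneg (Finset.prod_nonneg fun i _ => hf.nonneg _)
      (vandermonde_pos (hmono y fun i => hy i trivial)).le
  · exact integrableOn_pi_prod_mul_vandermonde hf J

theorem upperDet_nonneg {n : ℕ} {f : ℝ → ℝ} (hf : HasMoments n f) {x : Fin n → ℝ}
    (hx : StrictMono x) : 0 ≤ upperDet f x := by
  rw [← setIntegral_upperBox hf hx]
  exact setIntegral_pi_nonneg hf (measurableSet_upperBox x) fun y => strictMono_of_mem_upperBox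

theorem lowerDet_nonneg {n : ℕ} {f : ℝ → ℝ} (hf : HasMoments n f) {x : Fin n → ℝ}
    (hx : StrictMono x) : 0 ≤ lowerDet f x := by
  rw [← setIntegral_lowerBox hf hx]
  exact setIntegral_pi_nonneg hf (measurableSet_lowerBox x) fun y => strictMono_of_mem_lowerBox

theorem altDet_nonneg {n : ℕ} {f : ℝ → ℝ} (hf : HasMoments n f) {x : Fin n → ℝ}
    (hx : StrictMono x) : 0 ≤ altDet f x :=
  add_nonneg (upperDet_nonneg hf hx) (lowerDet_nonneg hf hx)

/-! ### The density of the alternate points -/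

theorem measurable_prod_weight {n : ℕ} {f : ℝ → ℝ} (hf : Measurable f) :
    Measurable fun x : Fin n → ℝ => ∏ i, f (x i) :=
  Finset.measurable_prod _ fun i _ => hf.comp (measurable_pi_apply i)

/-- Integrating out half of the points of an ordered configuration of `2n` points with density
`∏ f(z_r) * Δ(even) * Δ(odd)`. The bijection `e` names the `n` points that are kept (`Sum.inl`) and
the `n` points that are integrated over (`Sum.inr`), and `box` describes the interlacing. -/
theorem map_comp_inl_withDensity {n : ℕ} {f : ℝ → ℝ} (hf : HasMoments n f)
    (e : Fin n ⊕ Fin n ≃ Fin (n + n)) (hinl : StrictMono fun i => e (Sum.inl i))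
    (hinr : StrictMono fun i => e (Sum.inr i)) (box : (Fin n → ℝ) → Fin n → Set ℝ)
    (hboxm : ∀ x i, MeasurableSet (box x i))
    (hbox : ∀ z : Fin (n + n) → ℝ, StrictMono z ↔
      ∀ i, z (e (Sum.inr i)) ∈ box (fun i => z (e (Sum.inl i))) i) :
    ((volume.restrict {z : Fin (n + n) → ℝ | StrictMono z}).withDensity fun z =>
      ENNReal.ofReal ((∏ r, f (z r)) *
        (vandermonde (fun i => z (e (Sum.inl i))) * vandermonde (fun i => z (e (Sum.inr i)))))).map
      (fun z i => z (e (Sum.inl i))) =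
    (volume.restrict {x : Fin n → ℝ | StrictMono x}).withDensity fun x =>
      ENNReal.ofReal ((∏ i, f (x i)) * vandermonde x *
        ∫ y in Set.univ.pi (box x), (∏ i, f (y i)) * vandermonde y) := by
  ext A hA
  have hEm : Measurable fun (z : Fin (n + n) → ℝ) (i : Fin n) => z (e (Sum.inl i)) :=
    measurable_pi_lambda _ fun i => measurable_pi_apply _
  have hO := measurableSet_strictMono (m := n)
  have hO2 := measurableSet_strictMono (m := n + n)
  -- pairs of kept and removed points which interlace
  set S : Set ((Fin n → ℝ) × (Fin n → ℝ)) := {p | StrictMono ((splitEquiv e).symm p)} with hS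
  have hSm : MeasurableSet S := (splitEquiv e).symm.measurable hO2
  have hSiff : ∀ p, p ∈ S ↔ ∀ i, p.2 i ∈ box p.1 i := by
    intro p
    rw [hS, Set.mem_ofPred_eq, hbox]
    simp only [splitEquiv_symm_inl, splitEquiv_symm_inr]
  have hS1 : ∀ p ∈ S, StrictMono p.1 := by
    intro p hp
    have h : StrictMono fun i => (splitEquiv e).symm p (e (Sum.inl i)) := hp.comp hinl
    simpa only [splitEquiv_symm_inl] using h
  have hS2 : ∀ p ∈ S, StrictMono p.2 := by
    intro p hp
    have h : StrictMono fun i => (splitEquiv e).symm p (e (Sum.inr i)) := hp.comp hinr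
    simpa only [splitEquiv_symm_inr] using h
  set w : (Fin n → ℝ) → ℝ := fun x => (∏ i, f (x i)) * vandermonde x with hw
  have hwm : Measurable w :=
    (measurable_prod_weight hf.measurable).mul continuous_vandermonde.measurable
  have hw0 : ∀ x, StrictMono x → 0 ≤ w x := fun x hx =>
    mul_nonneg (Finset.prod_nonneg fun i _ => hf.nonneg _) (vandermonde_pos hx).le
  set H : (Fin n → ℝ) × (Fin n → ℝ) → ENNReal :=
    ((Prod.fst ⁻¹' A) ∩ S).indicator fun p => ENNReal.ofReal (w p.1) * ENNReal.ofReal (w p.2)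
    with hH
  have hHm : Measurable H := by
    refine Measurable.indicator ?_ ((measurable_fst hA).inter hSm)
    exact (hwm.comp measurable_fst).ennreal_ofReal.mul (hwm.comp measurable_snd).ennreal_ofReal
  rw [Measure.map_apply hEm hA, withDensity_apply _ (hEm hA), withDensity_apply _ hA,
    Measure.restrict_restrict (hEm hA), Measure.restrict_restrict hA,
    ← lintegral_indicator ((hEm hA).inter hO2), ← lintegral_indicator (hA.inter hO)]
  -- the integrand splits into a product; Tonelli's theorem then integrates over the removed points
  have h1 : ∀ z : Fin (n + n) → ℝ,
      (((fun (z : Fin (n + n) → ℝ) (i : Fin n) => z (e (Sum.inl i))) ⁻¹' A) ∩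
        {z | StrictMono z}).indicator (fun z => ENNReal.ofReal ((∏ r, f (z r)) *
        (vandermonde (fun i => z (e (Sum.inl i))) * vandermonde (fun i => z (e (Sum.inr i)))))) z =
      H (splitEquiv e z) := by
    intro z
    have hmem : splitEquiv e z ∈ (Prod.fst ⁻¹' A) ∩ S ↔
        z ∈ ((fun (z : Fin (n + n) → ℝ) (i : Fin n) => z (e (Sum.inl i))) ⁻¹' A) ∩
        {z | StrictMono z} := by
      rw [Set.mem_inter_iff, Set.mem_inter_iff, hS, Set.mem_ofPred_eq,
        MeasurableEquiv.symm_apply_apply]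
      rfl
    by_cases hz : splitEquiv e z ∈ (Prod.fst ⁻¹' A) ∩ S
    · rw [hH, Set.indicator_of_mem hz, Set.indicator_of_mem (hmem.1 hz),
        ← ENNReal.ofReal_mul (hw0 _ (hS1 _ hz.2))]
      congr 1
      rw [splitEquiv_apply, ← Equiv.prod_comp e, Fintype.prod_sum_type]
      simp only [hw]; ring
    · rw [hH, Set.indicator_of_notMem hz, Set.indicator_of_notMem fun h => hz (hmem.2 h)]
  rw [lintegral_congr h1, (measurePreserving_splitEquiv e).lintegral_comp_emb
    (splitEquiv e).measurableEmbedding, Measure.volume_eq_prod, lintegral_prod _ hHm.aemeasurable]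
  refine lintegral_congr fun x => ?_
  by_cases hx : x ∈ A ∩ {x | StrictMono x}
  · rw [Set.indicator_of_mem hx, ENNReal.ofReal_mul (hw0 x hx.2),
      ofReal_integral_eq_lintegral_ofReal (integrableOn_pi_prod_mul_vandermonde hf _),
      ← lintegral_const_mul' _ _ ENNReal.ofReal_ne_top,
      ← lintegral_indicator (MeasurableSet.univ_pi (hboxm x))]
    · refine lintegral_congr fun y => ?_
      have hmem : (x, y) ∈ (Prod.fst ⁻¹' A) ∩ S ↔ y ∈ Set.univ.pi (box x) := by
        rw [Set.mem_inter_iff, hSiff, Set.mem_univ_pi]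
        exact and_iff_right hx.1
      by_cases hy : y ∈ Set.univ.pi (box x)
      · rw [Set.indicator_of_mem hy, hH, Set.indicator_of_mem (hmem.2 hy)]
      · rw [Set.indicator_of_notMem hy, hH, Set.indicator_of_notMem fun h => hy (hmem.1 h)]
    · filter_upwards [ae_restrict_mem (MeasurableSet.univ_pi (hboxm x))] with y hy
      exact hw0 y (hS2 (x, y) ((hSiff _).2 fun i => hy i trivial))
  · rw [Set.indicator_of_notMem hx]
    refine (lintegral_congr fun y => ?_).trans lintegral_zero
    exact Set.indicator_of_notMem (fun h => hx ⟨h.1, show StrictMono x from hS1 (x, y) h.2⟩) _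

theorem strictMono_iff_mem_upperBox {n : ℕ} (z : Fin (n + n) → ℝ) : StrictMono z ↔
    ∀ i, z (interleaveEquiv n (Sum.inr i)) ∈
      upperBox (fun i => z (interleaveEquiv n (Sum.inl i))) i := by
  constructor
  · intro hz i
    refine ⟨hz ?_, fun k hk => hz ?_⟩ <;>
    simp only [interleaveEquiv, Equiv.coe_fn_mk, Sum.elim_inr, Sum.elim_inl, Fin.lt_def] at * <;>
    omega
  · intro h r s hrs
    obtain ⟨r, rfl⟩ := (interleaveEquiv n).surjective r
    obtain ⟨s, rfl⟩ := (interleaveEquiv n).surjective s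
    rcases r with i | i <;> rcases s with k | k <;>
      simp only [interleaveEquiv, Equiv.coe_fn_mk, Sum.elim_inr, Sum.elim_inl, Fin.lt_def] at hrs
    · exact (h i).1.trans ((h i).2 k (by rw [Fin.lt_def]; omega))
    · rcases eq_or_lt_of_le (show i ≤ k by rw [Fin.le_def]; omega) with rfl | hik
      · exact (h i).1
      · exact ((h i).1.trans ((h i).2 k hik)).trans (h k).1
    · exact (h i).2 k (by rw [Fin.lt_def]; omega)
    · exact ((h i).2 k (by rw [Fin.lt_def]; omega)).trans (h k).1

theorem strictMono_iff_mem_lowerBox {n : ℕ} (z : Fin (n + n) → ℝ) : StrictMono z ↔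
    ∀ i, z (interleaveEquiv n (Sum.inl i)) ∈
      lowerBox (fun i => z (interleaveEquiv n (Sum.inr i))) i := by
  constructor
  · intro hz i
    refine ⟨hz ?_, fun k hk => hz ?_⟩ <;>
    simp only [interleaveEquiv, Equiv.coe_fn_mk, Sum.elim_inr, Sum.elim_inl, Fin.lt_def] at * <;>
    omega
  · intro h r s hrs
    obtain ⟨r, rfl⟩ := (interleaveEquiv n).surjective r
    obtain ⟨s, rfl⟩ := (interleaveEquiv n).surjective s
    rcases r with i | i <;> rcases s with k | k <;>
      simp only [interleaveEquiv, Equiv.coe_fn_mk, Sum.elim_inr, Sum.elim_inl, Fin.lt_def] at hrs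
    · exact (h i).1.trans ((h k).2 i (by rw [Fin.lt_def]; omega))
    · rcases eq_or_lt_of_le (show i ≤ k by rw [Fin.le_def]; omega) with rfl | hik
      · exact (h i).1
      · exact ((h i).1.trans ((h k).2 i hik)).trans (h k).1
    · exact (h k).2 i (by rw [Fin.lt_def]; omega)
    · exact ((h k).2 i (by rw [Fin.lt_def]; omega)).trans (h k).1

theorem strictMono_interleaveEquiv_inl (n : ℕ) :
    StrictMono fun i => interleaveEquiv n (Sum.inl i) := by
  intro i j hij
  simp only [interleaveEquiv, Equiv.coe_fn_mk, Sum.elim_inl, Fin.lt_def] at *; omega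

theorem strictMono_interleaveEquiv_inr (n : ℕ) :
    StrictMono fun i => interleaveEquiv n (Sum.inr i) := by
  intro i j hij
  simp only [interleaveEquiv, Equiv.coe_fn_mk, Sum.elim_inr, Fin.lt_def] at *; omega

/-- The density of the alternate points. For `even` the removed points interlace with the kept ones
from above, for `odd` from below. -/
theorem altLaw_superpose {n : ℕ} {f : ℝ → ℝ} (hf : IsWeight 1 n f) (hm : HasMoments n f) :
    ∃ c : ENNReal, c ≠ 0 ∧ c ≠ ⊤ ∧ altLaw (superpose (OE n f) (OE n f)) =
      c • (volume.restrict {x : Fin n → ℝ | StrictMono x}).withDensity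
        fun x => ENNReal.ofReal ((∏ i, f (x i)) * vandermonde x * altDet f x) := by
  obtain ⟨c, hc0, hct, hc⟩ := map_sorted_superpose hf hm.nonneg
  have hIm : ∀ k : Fin n → Fin (n + n), Measurable
      fun (z : Fin (n + n) → ℝ) (i : Fin n) => z (k i) :=
    fun k => measurable_pi_lambda _ fun i => measurable_pi_apply _
  have heven : evenLaw (superpose (OE n f) (OE n f)) =
      c • (volume.restrict {x : Fin n → ℝ | StrictMono x}).withDensity
        fun x => ENNReal.ofReal ((∏ i, f (x i)) * vandermonde x *
          ∫ y in Set.univ.pi (upperBox x), (∏ i, f (y i)) * vandermonde y) := by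
    have h : (evenPoints : (Fin (n + n) → ℝ) → Fin n → ℝ) =
      (fun z i => z (interleaveEquiv n (Sum.inl i))) ∘ sorted := rfl
    rw [evenLaw, h, ← Measure.map_map (hIm _) measurable_sorted, hc, Measure.map_smul,
      map_comp_inl_withDensity hm (interleaveEquiv n) (strictMono_interleaveEquiv_inl n)
        (strictMono_interleaveEquiv_inr n) upperBox measurableSet_upperBox
        strictMono_iff_mem_upperBox]
  have hodd : oddLaw (superpose (OE n f) (OE n f)) =
      c • (volume.restrict {x : Fin n → ℝ | StrictMono x}).withDensity
        fun x => ENNReal.ofReal ((∏ i, f (x i)) * vandermonde x *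
          ∫ y in Set.univ.pi (lowerBox x), (∏ i, f (y i)) * vandermonde y) := by
    have h : (oddPoints : (Fin (n + n) → ℝ) → Fin n → ℝ) =
      (fun z i => z (((Equiv.sumComm _ _).trans (interleaveEquiv n)) (Sum.inl i))) ∘ sorted := rfl
    rw [oddLaw, h, ← Measure.map_map (hIm _) measurable_sorted, hc, Measure.map_smul,
      ← map_comp_inl_withDensity hm ((Equiv.sumComm _ _).trans (interleaveEquiv n))
        (strictMono_interleaveEquiv_inr n) (strictMono_interleaveEquiv_inl n)
        lowerBox measurableSet_lowerBox strictMono_iff_mem_lowerBox]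
    congr 3
    ext z
    rw [mul_comm (vandermonde _)]
    rfl
  have hw0 : ∀ x : Fin n → ℝ, StrictMono x → 0 ≤ (∏ i, f (x i)) * vandermonde x := fun x hx =>
    mul_nonneg (Finset.prod_nonneg fun i _ => hm.nonneg _) (vandermonde_pos hx).le
  refine ⟨2⁻¹ * c, mul_ne_zero (by simp) hc0, ENNReal.mul_ne_top (by simp) hct, ?_⟩
  have hup : (fun x => ENNReal.ofReal ((∏ i, f (x i)) * vandermonde x *
      ∫ y in Set.univ.pi (upperBox x), (∏ i, f (y i)) * vandermonde y))
      =ᵐ[volume.restrict {x : Fin n → ℝ | StrictMono x}]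
      fun x => ENNReal.ofReal ((∏ i, f (x i)) * vandermonde x * upperDet f x) := by
    filter_upwards [ae_restrict_mem measurableSet_strictMono] with x hx
    rw [setIntegral_upperBox hm hx]
  have hlow : (fun x => ENNReal.ofReal ((∏ i, f (x i)) * vandermonde x *
      ∫ y in Set.univ.pi (lowerBox x), (∏ i, f (y i)) * vandermonde y))
      =ᵐ[volume.restrict {x : Fin n → ℝ | StrictMono x}]
      fun x => ENNReal.ofReal ((∏ i, f (x i)) * vandermonde x * lowerDet f x) := by
    filter_upwards [ae_restrict_mem measurableSet_strictMono] with x hx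
    rw [setIntegral_lowerBox hm hx]
  rw [altLaw, heven, hodd, ← smul_add, ← smul_add, smul_smul, withDensity_congr_ae hup,
    withDensity_congr_ae hlow, ← withDensity_add_left]
  · congr 1
    refine withDensity_congr_ae ?_
    filter_upwards [ae_restrict_mem measurableSet_strictMono] with x hx
    rw [Pi.add_apply, altDet, mul_add, ENNReal.ofReal_add
      (mul_nonneg (hw0 x hx) (upperDet_nonneg hm hx))
      (mul_nonneg (hw0 x hx) (lowerDet_nonneg hm hx))]
  · exact (((measurable_prod_weight hm.measurable).mul continuous_vandermonde.measurable).mul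
      (continuous_upperDet hm).measurable).ennreal_ofReal

/-! ### Equality of laws as an identity of densities -/

theorem lowerDet_comp_perm {n : ℕ} (f : ℝ → ℝ) (x : Fin n → ℝ) (σ : Equiv.Perm (Fin n)) :
    lowerDet f (x ∘ σ) = (Equiv.Perm.sign σ : ℤ) * lowerDet f x := by
  rw [lowerDet, lowerDet, ← Matrix.det_permute σ]; rfl

theorem upperDet_comp_perm {n : ℕ} (f : ℝ → ℝ) (x : Fin n → ℝ) (σ : Equiv.Perm (Fin n)) :
    upperDet f (x ∘ σ) = (Equiv.Perm.sign σ : ℤ) * upperDet f x := by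
  rw [upperDet, upperDet, ← Matrix.det_permute σ]; rfl

theorem altDet_comp_perm {n : ℕ} (f : ℝ → ℝ) (x : Fin n → ℝ) (σ : Equiv.Perm (Fin n)) :
    altDet f (x ∘ σ) = (Equiv.Perm.sign σ : ℤ) * altDet f x := by
  rw [altDet, altDet, lowerDet_comp_perm, upperDet_comp_perm, mul_add]

/-- A property which holds for almost every increasing tuple and does not depend on the labelling of
the points holds almost everywhere. -/
theorem ae_of_ae_restrict_strictMono {m : ℕ} {P : (Fin m → ℝ) → Prop}
    (hP : ∀ x (σ : Equiv.Perm (Fin m)), P (x ∘ σ) → P x)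
    (h : ∀ᵐ x ∂(volume.restrict {x : Fin m → ℝ | StrictMono x}), P x) : ∀ᵐ x, P x := by
  rw [ae_restrict_iff' measurableSet_strictMono] at h
  have h' : ∀ᵐ x : Fin m → ℝ, ∀ σ : Equiv.Perm (Fin m), StrictMono (x ∘ σ) → P (x ∘ σ) :=
    ae_all_iff.2 fun σ => (measurePreserving_comp_perm σ).quasiMeasurePreserving.ae h
  filter_upwards [h', ae_injective] with x hx hinj
  exact hP x _ (hx _ (strictMono_comp_sort hinj))

theorem measurable_append {m n : ℕ} :
    Measurable fun p : (Fin m → ℝ) × (Fin n → ℝ) => Fin.append p.1 p.2 := by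
  refine measurable_pi_lambda _ fun i => ?_
  refine Fin.addCases (fun i => ?_) (fun i => ?_) i
  · simpa [Function.comp_def] using (measurable_pi_apply i).comp measurable_fst
  · simpa [Function.comp_def] using (measurable_pi_apply i).comp measurable_snd

theorem isProbabilityMeasure_altLaw {n : ℕ} {f : ℝ → ℝ} (hf : IsWeight 1 n f) :
    IsProbabilityMeasure (altLaw (superpose (OE n f) (OE n f))) := by
  have h1 : IsProbabilityMeasure (OE n f) := isProbabilityMeasure_ensemble hf
  have h2 : IsProbabilityMeasure (superpose (OE n f) (OE n f)) :=
    Measure.isProbabilityMeasure_map measurable_append.aemeasurable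
  have he : Measurable (evenPoints : (Fin (n + n) → ℝ) → Fin n → ℝ) :=
    measurable_pi_lambda _ fun i => (measurable_pi_apply _).comp measurable_sorted
  have ho : Measurable (oddPoints : (Fin (n + n) → ℝ) → Fin n → ℝ) :=
    measurable_pi_lambda _ fun i => (measurable_pi_apply _).comp measurable_sorted
  have h3 : IsProbabilityMeasure (evenLaw (superpose (OE n f) (OE n f))) :=
    Measure.isProbabilityMeasure_map he.aemeasurable
  have h4 : IsProbabilityMeasure (oddLaw (superpose (OE n f) (OE n f))) :=
    Measure.isProbabilityMeasure_map ho.aemeasurable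
  constructor
  rw [altLaw, Measure.add_apply, Measure.smul_apply, Measure.smul_apply, measure_univ, measure_univ]
  simp [ENNReal.inv_two_add_inv_two]

/-- The equality of laws is an identity of densities up to a constant. Both densities are
symmetric, so the identity extends from increasing tuples to almost all tuples. -/
theorem altLaw_eq_orderedLaw_iff {n : ℕ} {f g : ℝ → ℝ} (hf : IsWeight 1 n f)
    (hm : HasMoments n f) (hg : IsWeight 2 n g) :
    altLaw (superpose (OE n f) (OE n f)) = orderedLaw (UE n g) ↔
      ∃ C : ℝ, 0 < C ∧ ∀ᵐ x : Fin n → ℝ,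
        (∏ i, f (x i)) * vandermonde x * altDet f x = C * jointDensity 2 n g x := by
  obtain ⟨a, ha0, hat, ha⟩ := altLaw_superpose hf hm
  obtain ⟨b, hb0, hbt, hb⟩ := orderedLaw_ensemble hg
  have hA0 : ∀ x : Fin n → ℝ, StrictMono x →
      0 ≤ (∏ i, f (x i)) * vandermonde x * altDet f x := fun x hx =>
    mul_nonneg (mul_nonneg (Finset.prod_nonneg fun i _ => hm.nonneg _) (vandermonde_pos hx).le)
      (altDet_nonneg hm hx)
  have hAm : Measurable fun x : Fin n → ℝ => (∏ i, f (x i)) * vandermonde x * altDet f x :=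
    ((measurable_prod_weight hm.measurable).mul continuous_vandermonde.measurable).mul
      (continuous_altDet hm).measurable
  constructor
  · intro h
    rw [ha, UE, hb, ← withDensity_smul' _ _ hat, ← withDensity_smul' _ _ hbt,
      withDensity_eq_iff_of_sigmaFinite (hAm.ennreal_ofReal.aemeasurable.const_smul a)
        ((aemeasurable_ofReal_jointDensity hg).restrict.const_smul b)] at h
    refine ⟨b.toReal / a.toReal, div_pos (ENNReal.toReal_pos hb0 hbt) (ENNReal.toReal_pos ha0 hat),
      ae_of_ae_restrict_strictMono ?_ ?_⟩
    · intro x σ hx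
      rw [jointDensity_comp_perm, vandermonde_comp_perm, altDet_comp_perm] at hx
      rw [← hx, Function.comp_def, Equiv.prod_comp σ fun i => f (x i)]
      rcases Int.units_eq_one_or (Equiv.Perm.sign σ) with h | h <;> simp [h]
    · filter_upwards [h, ae_restrict_mem measurableSet_strictMono,
        ae_restrict_of_ae hg.nonneg] with x hx hxm hx0
      have := congrArg ENNReal.toReal hx
      simp only [Pi.smul_apply, smul_eq_mul, ENNReal.toReal_mul, ENNReal.toReal_ofReal hx0,
        ENNReal.toReal_ofReal (hA0 x hxm)] at this
      have ha' := (ENNReal.toReal_pos ha0 hat).ne'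
      field_simp
      linarith
  · rintro ⟨C, hC, h⟩
    have h1 : (fun x : Fin n → ℝ => ENNReal.ofReal ((∏ i, f (x i)) * vandermonde x * altDet f x))
        =ᵐ[volume.restrict {x : Fin n → ℝ | StrictMono x}]
        ENNReal.ofReal C • fun x => ENNReal.ofReal (jointDensity 2 n g x) := by
      filter_upwards [ae_restrict_of_ae h] with x hx
      rw [hx, ENNReal.ofReal_mul hC.le]; rfl
    rw [withDensity_congr_ae h1, withDensity_smul' _ _ ENNReal.ofReal_ne_top, smul_smul] at ha
    have hp := isProbabilityMeasure_altLaw hf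
    have hp2 : IsProbabilityMeasure (UE n g) := isProbabilityMeasure_ensemble hg
    have hp3 : IsProbabilityMeasure (orderedLaw (UE n g)) :=
      Measure.isProbabilityMeasure_map measurable_sorted.aemeasurable
    -- both sides are probability measures proportional to one measure, so the constants agree
    have e1 := hp.measure_univ
    have e2 := hp3.measure_univ
    set ν := (volume.restrict {x : Fin n → ℝ | StrictMono x}).withDensity
      fun x => ENNReal.ofReal (jointDensity 2 n g x) with hν
    rw [ha, Measure.smul_apply, smul_eq_mul] at e1
    rw [UE, hb, Measure.smul_apply, smul_eq_mul] at e2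
    rw [ha, UE, hb]
    congr 1
    rw [ENNReal.eq_inv_of_mul_eq_one_left e1, ENNReal.eq_inv_of_mul_eq_one_left e2]

/-! ### Changing one point -/

/-- A Vandermonde product as a function of one of its points. -/
theorem vandermonde_update {n : ℕ} {u : Fin n → ℝ} (hu : Function.Injective u) (k : Fin n) (x : ℝ) :
    vandermonde (Function.update u k x) =
      (Lagrange.basis Finset.univ u k).eval x * vandermonde u := by
  have hrow : Matrix.vandermonde (Function.update u k x) = (Matrix.vandermonde u).updateRow k
      (∑ l, (Lagrange.basis Finset.univ u l).eval x • (Matrix.vandermonde u) l) := by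
    ext i j
    by_cases hik : i = k
    · subst hik
      have h := Lagrange.eq_interpolate (s := Finset.univ) (v := u) (f := Polynomial.X ^ (j : ℕ))
        hu.injOn (by rw [Polynomial.degree_X_pow]; simp)
      have h2 := congrArg (Polynomial.eval x) h
      simp only [Lagrange.interpolate_apply, Polynomial.eval_pow, Polynomial.eval_X,
        Polynomial.eval_finsetSum, Polynomial.eval_mul, Polynomial.eval_C] at h2
      simp only [Matrix.vandermonde_apply, Function.update_self, Matrix.updateRow_self,
        Finset.sum_apply, Pi.smul_apply, smul_eq_mul]
      rw [h2]
      exact Finset.sum_congr rfl fun l _ => mul_comm _ _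
    · simp [Matrix.vandermonde_apply, Function.update_of_ne hik, Matrix.updateRow_ne hik]
  rw [vandermonde_eq_det, hrow, Matrix.det_updateRow_sum, smul_eq_mul, ← vandermonde_eq_det]

theorem measurePreserving_insertNth {n : ℕ} (k : Fin (n + 1)) :
    MeasurePreserving (fun p : ℝ × (Fin n → ℝ) => (k.insertNth p.1 p.2 : Fin (n + 1) → ℝ)) :=
  (volume_preserving_piFinSuccAbove (fun _ => ℝ) k).symm

/-- Almost every point satisfies an almost sure property after almost every change of a coordinate. -/
theorem ae_update {n : ℕ} {P : (Fin n → ℝ) → Prop} (h : ∀ᵐ u, P u) :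
    ∀ᵐ u : Fin n → ℝ, ∀ k, ∀ᵐ x : ℝ, P (Function.update u k x) := by
  refine ae_all_iff.2 fun k => ?_
  obtain _ | m := n
  · exact k.elim0
  have h1 := (measurePreserving_insertNth k).quasiMeasurePreserving.ae h
  have h2 : ∀ᵐ v : Fin m → ℝ, ∀ᵐ x : ℝ, P (k.insertNth x v) := by
    have := (Measure.measurePreserving_swap (μ := (volume : Measure (Fin m → ℝ)))
      (ν := (volume : Measure ℝ))).quasiMeasurePreserving.ae h1
    exact Measure.ae_ae_of_ae_prod this
  have h3 := (Measure.quasiMeasurePreserving_snd (μ := (volume : Measure ℝ))).ae h2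
  have h4 := (volume_preserving_piFinSuccAbove (fun _ => ℝ) k).quasiMeasurePreserving.ae h3
  filter_upwards [h4] with u hu
  filter_upwards [hu] with x hx
  rwa [← Fin.insertNth_removeNth]

theorem ae_integrable_update {n : ℕ} {F : (Fin n → ℝ) → ℝ} (h : Integrable F) (k : Fin n) :
    ∀ᵐ u : Fin n → ℝ, Integrable fun x : ℝ => F (Function.update u k x) := by
  obtain _ | m := n
  · exact k.elim0
  have h1 : Integrable (fun p : ℝ × (Fin m → ℝ) => F (k.insertNth p.1 p.2))
      ((volume : Measure ℝ).prod volume) :=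
    (measurePreserving_insertNth k).integrable_comp_of_integrable h
  have h3 := (Measure.quasiMeasurePreserving_snd (μ := (volume : Measure ℝ))).ae h1.prod_left_ae
  have h4 := (volume_preserving_piFinSuccAbove (fun _ => ℝ) k).quasiMeasurePreserving.ae h3
  filter_upwards [h4] with u hu
  refine hu.congr (Filter.Eventually.of_forall fun x => ?_)
  simp only [← Fin.insertNth_removeNth]
  rfl

/-! ### Moments of the weight of an ensemble -/

theorem jointDensity_update {β n : ℕ} (w : ℝ → ℝ) {u : Fin n → ℝ} (hu : Function.Injective u)
    (k : Fin n) (x : ℝ) : jointDensity β n w (Function.update u k x) =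
      w x * (∏ i ∈ Finset.univ.erase k, w (u i)) *
        (|(Lagrange.basis Finset.univ u k).eval x| * |vandermonde u|) ^ β := by
  rw [jointDensity, vandermonde_update hu, abs_mul]
  congr 1
  rw [← Finset.mul_prod_erase _ _ (Finset.mem_univ k), Function.update_self]
  congr 1
  refine Finset.prod_congr rfl fun i hi => ?_
  rw [Function.update_of_ne (Finset.ne_of_mem_erase hi)]

/-- If `f` times the modulus of a polynomial with roots `u i` is integrable and `f` is continuous at
these roots, then `f` has moments up to the degree of that polynomial. -/
theorem integrable_mul_pow_of_prod {ι : Type*} {f : ℝ → ℝ} (hf : Measurable f) (s : Finset ι)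
    (u : ι → ℝ) (hu : ∀ i ∈ s, ContinuousAt f (u i))
    (hint : Integrable fun x => f x * ∏ i ∈ s, |x - u i|) {j : ℕ} (hj : j ≤ s.card) :
    Integrable fun x => f x * x ^ j := by
  have hF : Measurable fun x => f x * x ^ j := hf.mul (measurable_id.pow_const j)
  have hloc : ∀ i ∈ s, ∃ δ > 0, IntegrableOn (fun x => f x * x ^ j) (Metric.ball (u i) δ) := by
    intro i hi
    have hc : ContinuousAt (fun x => f x * x ^ j) (u i) :=
      (hu i hi).mul (continuous_pow j).continuousAt
    obtain ⟨t, ht, hti⟩ := hc.tendsto.integrableAtFilter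
      hF.stronglyMeasurable.stronglyMeasurableAtFilter (volume.finiteAt_nhds (u i))
    obtain ⟨δ, hδ, hsub⟩ := Metric.mem_nhds_iff.1 ht
    exact ⟨δ, hδ, hti.mono_set hsub⟩
  choose! δ hδ hδi using hloc
  set N : Set ℝ := ⋃ i ∈ s, Metric.ball (u i) (δ i) with hN
  have hNm : MeasurableSet N := s.measurableSet_biUnion fun i _ => Metric.isOpen_ball.measurableSet
  rw [← integrableOn_univ, ← Set.union_compl_self N]
  refine IntegrableOn.union ?_ ?_
  · rw [hN, integrableOn_finset_iUnion]
    exact hδi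
  · refine ((hint.norm.const_mul (∏ i ∈ s, ((1 + |u i|) / δ i + 1))).integrableOn).mono'
      hF.aestronglyMeasurable ?_
    filter_upwards [ae_restrict_mem hNm.compl] with x hx
    -- away from the roots each linear factor dominates `1 + |x|`
    have hfac : ∀ i ∈ s, 1 + |x| ≤ ((1 + |u i|) / δ i + 1) * |x - u i| := by
      intro i hi
      have hx' : δ i ≤ |x - u i| := by
        by_contra h
        refine hx (Set.mem_biUnion hi ?_)
        rw [Metric.mem_ball, Real.dist_eq]
        exact not_le.1 h
      have h1 : 1 + |u i| ≤ (1 + |u i|) / δ i * |x - u i| := by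
        rw [div_mul_eq_mul_div, le_div_iff₀ (hδ i hi)]
        exact mul_le_mul_of_nonneg_left hx' (by positivity)
      have h2 : |x| ≤ |x - u i| + |u i| := by
        simpa using abs_add_le (x - u i) (u i)
      linarith
    have hpow : |x| ^ j ≤ ∏ i ∈ s, ((1 + |u i|) / δ i + 1) * |x - u i| := by
      calc |x| ^ j ≤ (1 + |x|) ^ j := by gcongr; linarith
        _ ≤ (1 + |x|) ^ s.card := pow_le_pow_right₀ (by linarith [abs_nonneg x]) hj
        _ = ∏ i ∈ s, (1 + |x|) := by rw [Finset.prod_const]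
        _ ≤ _ := Finset.prod_le_prod (fun i _ => by positivity) hfac
    rw [norm_mul, norm_mul, norm_pow, Real.norm_eq_abs, Real.norm_eq_abs, Real.norm_eq_abs,
      abs_of_nonneg (Finset.prod_nonneg fun i _ => abs_nonneg (x - u i))]
    rw [Finset.prod_mul_distrib] at hpow
    calc |f x| * |x| ^ j ≤ |f x| * ((∏ i ∈ s, ((1 + |u i|) / δ i + 1)) * ∏ i ∈ s, |x - u i|) :=
          mul_le_mul_of_nonneg_left hpow (abs_nonneg _)
      _ = _ := by ring

/-- An almost sure property holds at some point of nonzero density. -/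
theorem exists_jointDensity_ne_zero {β n : ℕ} {w : ℝ → ℝ} (hw : IsWeight β n w)
    {P : (Fin n → ℝ) → Prop} (hP : ∀ᵐ u, P u) : ∃ u, P u ∧ jointDensity β n w u ≠ 0 := by
  by_contra! h
  have h0 : jointDensity β n w =ᵐ[volume] 0 := by
    filter_upwards [hP] with u hu using h u hu
  have := hw.integral_pos
  rw [integral_congr_ae h0] at this
  simp at this

/-- Freezing all points but one, at positions where `f` does not vanish, turns the joint density
into `f` times the modulus of a polynomial of degree `n - 1`. -/
theorem hasMoments_of_isWeight {n : ℕ} (hn : 0 < n) {f : ℝ → ℝ} (hf : IsWeight 1 n f)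
    (hmeas : Measurable f) (hf0 : ∀ x, 0 ≤ f x) (hcont : ∀ x, f x ≠ 0 → ContinuousAt f x) :
    HasMoments n f := by
  refine ⟨hmeas, hf0, fun j hj => ?_⟩
  let k : Fin n := ⟨0, hn⟩
  obtain ⟨u, ⟨huint, huinj⟩, hu0⟩ := exists_jointDensity_ne_zero hf
    ((ae_integrable_update hf.integrable k).and ae_injective)
  have hfu : ∀ i, f (u i) ≠ 0 := fun i =>
    Finset.prod_ne_zero_iff.1 (left_ne_zero_of_mul hu0) i (Finset.mem_univ i)
  set K : ℝ := (∏ i ∈ Finset.univ.erase k, f (u i)) *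
    (|∏ i ∈ Finset.univ.erase k, (u k - u i)⁻¹| * |vandermonde u|) with hK
  have hK0 : K ≠ 0 := by
    refine mul_ne_zero (Finset.prod_ne_zero_iff.2 fun i _ => hfu i) (mul_ne_zero ?_ ?_)
    · refine abs_ne_zero.2 (Finset.prod_ne_zero_iff.2 fun i hi => ?_)
      exact inv_ne_zero (sub_ne_zero.2 (huinj.ne (Finset.ne_of_mem_erase hi).symm))
    · exact abs_ne_zero.2 (vandermonde_ne_zero_iff.2 huinj)
  refine integrable_mul_pow_of_prod hmeas (Finset.univ.erase k) u (fun i _ => hcont _ (hfu i)) ?_ ?_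
  · refine (huint.const_mul K⁻¹).congr (Filter.Eventually.of_forall fun x => ?_)
    simp only
    rw [jointDensity_update f huinj]
    have hb : (Lagrange.basis Finset.univ u k).eval x =
        (∏ i ∈ Finset.univ.erase k, (u k - u i)⁻¹) * ∏ i ∈ Finset.univ.erase k, (x - u i) := by
      rw [Lagrange.basis, Polynomial.eval_prod, ← Finset.prod_mul_distrib]
      refine Finset.prod_congr rfl fun i _ => ?_
      simp [Lagrange.basisDivisor]
    rw [hb, abs_mul, Finset.abs_prod (s := Finset.univ.erase k) (f := fun i => x - u i), pow_one,
      inv_mul_eq_iff_eq_mul₀ hK0, hK]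
    ring
  · rw [Finset.card_erase_of_mem (Finset.mem_univ _), Finset.card_univ, Fintype.card_fin]
    omega

/-! ### Positivity of the determinant -/

/-- The determinant of an increasing tuple is positive as soon as all but one of the points lie in
the support of the weight: then interlacing points can be found in the support, from above if the
largest point lies in the support, and from below otherwise. -/
theorem altDet_pos {n : ℕ} (hn : 2 ≤ n) {f : ℝ → ℝ} (hf : HasMoments n f)
    (hU : IsOpen (Function.support f)) {x : Fin n → ℝ} (hx : StrictMono x) (k : Fin n)
    (hk : ∀ i, i ≠ k → f (x i) ≠ 0) : 0 < altDet f x := by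
  set U := Function.support f with hUdef
  have hupo : ∀ i, IsOpen (upperBox x i) := fun i => by
    have : upperBox x i = Set.Ioi (x i) ∩ ⋂ k : Fin n, ⋂ _ : i < k, Set.Iio (x k) := by
      ext y; simp [upperBox]
    rw [this]
    exact isOpen_Ioi.inter (isOpen_iInter_of_finite fun _ => isOpen_iInter_of_finite fun _ =>
      isOpen_Iio)
  have hloo : ∀ i, IsOpen (lowerBox x i) := fun i => by
    have : lowerBox x i = Set.Iio (x i) ∩ ⋂ k : Fin n, ⋂ _ : k < i, Set.Ioi (x k) := by
      ext y; simp [lowerBox]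
    rw [this]
    exact isOpen_Iio.inter (isOpen_iInter_of_finite fun _ => isOpen_iInter_of_finite fun _ =>
      isOpen_Ioi)
  -- points of the support slightly to the right, or to the left, of a given one
  have hright : ∀ (a : ℝ) (s : Fin n → Prop), a ∈ U → (∀ l, s l → a < x l) →
      ∃ y, a < y ∧ y ∈ U ∧ ∀ l, s l → y < x l := by
    intro a s ha hs
    have h1 : ∀ᶠ y in nhds a, y ∈ U := hU.mem_nhds ha
    have h2 : ∀ᶠ y in nhds a, ∀ l, s l → y < x l :=
      Filter.eventually_all.2 fun l => by
        by_cases hl : s l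
        · filter_upwards [Iio_mem_nhds (hs l hl)] with y hy _ using hy
        · simp [hl]
    have h3 : ∀ᶠ y in nhdsWithin a (Set.Ioi a), a < y ∧ y ∈ U ∧ ∀ l, s l → y < x l := by
      filter_upwards [self_mem_nhdsWithin, nhdsWithin_le_nhds h1, nhdsWithin_le_nhds h2]
        with y a1 a2 a3 using ⟨a1, a2, a3⟩
    exact h3.exists
  have hleft : ∀ (a : ℝ) (s : Fin n → Prop), a ∈ U → (∀ l, s l → x l < a) →
      ∃ y, y < a ∧ y ∈ U ∧ ∀ l, s l → x l < y := by
    intro a s ha hs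
    have h1 : ∀ᶠ y in nhds a, y ∈ U := hU.mem_nhds ha
    have h2 : ∀ᶠ y in nhds a, ∀ l, s l → x l < y :=
      Filter.eventually_all.2 fun l => by
        by_cases hl : s l
        · filter_upwards [Ioi_mem_nhds (hs l hl)] with y hy _ using hy
        · simp [hl]
    have h3 : ∀ᶠ y in nhdsWithin a (Set.Iio a), y < a ∧ y ∈ U ∧ ∀ l, s l → x l < y := by
      filter_upwards [self_mem_nhdsWithin, nhdsWithin_le_nhds h1, nhdsWithin_le_nhds h2]
        with y a1 a2 a3 using ⟨a1, a2, a3⟩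
    exact h3.exists
  by_cases hlast : k.val = n - 1
  · -- only the last point may lie off the support; its companion is taken just above the
    -- previous point
    refine add_pos_of_nonneg_of_pos (upperDet_nonneg hf hx) ?_
    rw [← setIntegral_lowerBox hf hx]
    refine setIntegral_pi_pos hf (measurableSet_lowerBox x) (fun y => strictMono_of_mem_lowerBox)
      fun i => ((hloo i).inter hU).measure_ne_zero _ ?_
    by_cases hik : i = k
    · have hi : i.val = n - 1 := by rw [hik, hlast]
      let p : Fin n := ⟨i.val - 1, by omega⟩
      have hp : p < i := by rw [Fin.lt_def]; simp only [p]; omega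
      obtain ⟨y, h1, h2, h3⟩ := hright (x p) (fun l => l = i) (hk p (hik ▸ hp.ne))
        (fun l hl => hl ▸ hx hp)
      refine ⟨y, ⟨h3 i rfl, fun l hl => lt_of_le_of_lt (hx.monotone ?_) h1⟩, h2⟩
      rw [Fin.le_def]; rw [Fin.lt_def] at hl; simp only [p]; omega
    · obtain ⟨y, h1, h2, h3⟩ := hleft (x i) (fun l => l < i) (hk i hik) (fun l hl => hx hl)
      exact ⟨y, ⟨h1, h3⟩, h2⟩
  · refine add_pos_of_pos_of_nonneg ?_ (lowerDet_nonneg hf hx)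
    rw [← setIntegral_upperBox hf hx]
    refine setIntegral_pi_pos hf (measurableSet_upperBox x) (fun y => strictMono_of_mem_upperBox)
      fun i => ((hupo i).inter hU).measure_ne_zero _ ?_
    by_cases hik : i = k
    · have hi : i.val ≠ n - 1 := by rw [hik]; exact hlast
      let p : Fin n := ⟨i.val + 1, by omega⟩
      have hp : i < p := by rw [Fin.lt_def]; simp only [p]; omega
      obtain ⟨y, h1, h2, h3⟩ := hleft (x p) (fun l => l = i) (hk p (hik ▸ hp.ne'))
        (fun l hl => hl ▸ hx hp)
      refine ⟨y, ⟨h3 i rfl, fun l hl => lt_of_lt_of_le h1 (hx.monotone ?_)⟩, h2⟩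
      rw [Fin.le_def]; rw [Fin.lt_def] at hl; simp only [p]; omega
    · obtain ⟨y, h1, h2, h3⟩ := hright (x i) (fun l => i < l) (hk i hik) (fun l hl => hx hl)
      exact ⟨y, ⟨h1, h3⟩, h2⟩

theorem altDet_ne_zero {n : ℕ} (hn : 2 ≤ n) {f : ℝ → ℝ} (hf : HasMoments n f)
    (hU : IsOpen (Function.support f)) {x : Fin n → ℝ} (hx : Function.Injective x) (k : Fin n)
    (hk : ∀ i, i ≠ k → f (x i) ≠ 0) : altDet f x ≠ 0 := by
  have h := altDet_pos hn hf hU (strictMono_comp_sort hx) ((Tuple.sort x).symm k) fun i hi =>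
    hk _ fun h => hi (by rw [← h, Equiv.symm_apply_apply])
  rw [altDet_comp_perm] at h
  exact right_ne_zero_of_mul h.ne'

open Filter Topology

/-! ### The determinant as a function of one point -/

theorem hasDerivAt_lowerMoment {n : ℕ} {f : ℝ → ℝ} (hf : HasMoments n f) {j : ℕ} (hj : j < n)
    {x : ℝ} (hx : ContinuousAt f x) : HasDerivAt (lowerMoment f j) (f x * x ^ j) x := by
  have hint := hf.integrable j hj
  have h : lowerMoment f j = fun x => lowerMoment f j 0 + ∫ y in (0 : ℝ)..x, f y * y ^ j := by
    ext x
    rw [lowerMoment, lowerMoment, ← intervalIntegral.integral_Iic_sub_Iic hint.integrableOn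
      hint.integrableOn]
    ring
  rw [h]
  refine HasDerivAt.const_add _ (intervalIntegral.integral_hasDerivAt_right
    hint.intervalIntegrable ?_ (hx.mul (continuous_pow j).continuousAt))
  exact (hf.measurable.mul (measurable_id.pow_const j)).stronglyMeasurable.stronglyMeasurableAtFilter

theorem tendsto_lowerMoment_atTop {n : ℕ} {f : ℝ → ℝ} (hf : HasMoments n f) {j : ℕ} (hj : j < n) :
    Tendsto (lowerMoment f j) atTop (𝓝 (totalMoment f j)) :=
  (aecover_Iic tendsto_id).integral_tendsto_of_countably_generated (hf.integrable j hj)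

theorem tendsto_lowerMoment_atBot {n : ℕ} {f : ℝ → ℝ} (hf : HasMoments n f) {j : ℕ} (hj : j < n) :
    Tendsto (lowerMoment f j) atBot (𝓝 0) := by
  have h : Tendsto (fun x => ∫ y in Set.Ioi x, f y * y ^ j) atBot (𝓝 (totalMoment f j)) :=
    (aecover_Ioi tendsto_id).integral_tendsto_of_countably_generated (hf.integrable j hj)
  have h2 := h.const_sub (totalMoment f j)
  rw [sub_self] at h2
  refine h2.congr fun x => ?_
  rw [setIntegral_Ioi_eq hf hj]; ring

/-- The matrix of the lower moments bordered by a column of ones and a row of total moments. The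
corner entry is chosen so that a row `(F_j(x))_j, 1`, as a function of `x`, tends to two limits at
`±∞` which differ by the sign `(-1) ^ (n + 1)` modulo the last row. -/
def borderedMatrix {n : ℕ} (f : ℝ → ℝ) (x : Fin n → ℝ) : Matrix (Fin n ⊕ Unit) (Fin n ⊕ Unit) ℝ :=
  Matrix.fromBlocks (Matrix.of fun i j : Fin n => lowerMoment f j (x i)) (Matrix.of fun _ _ => 1)
    (Matrix.of fun _ j => totalMoment f j) (Matrix.of fun _ _ => 1 + (-1) ^ n)

/-- The two parts of `altDet` combine into a single determinant. -/
theorem det_borderedMatrix {n : ℕ} (f : ℝ → ℝ) (x : Fin n → ℝ) :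
    (borderedMatrix f x).det = (-1) ^ n * altDet f x := by
  set F : Matrix (Fin n) (Fin n) ℝ := Matrix.of fun i j : Fin n => lowerMoment f j (x i) with hF
  set o : Matrix (Fin n) Unit ℝ := Matrix.of fun _ _ => 1 with ho
  set t : Matrix Unit (Fin n) ℝ := Matrix.of fun _ j => totalMoment f j with ht
  let M : (Fin n ⊕ Unit → ℝ) → Matrix (Fin n ⊕ Unit) (Fin n ⊕ Unit) ℝ := fun r =>
    (Matrix.fromBlocks F o 0 0).updateRow (Sum.inr ()) r
  let r₁ : Fin n ⊕ Unit → ℝ := Sum.elim (fun j => totalMoment f j) fun _ => 1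
  let r₂ : Fin n ⊕ Unit → ℝ := Sum.elim (fun _ => 0) fun _ => (-1) ^ n
  -- the last row is split as `(T_j, 1) + (0, (-1) ^ n)`; the first part yields `upperDet` as a Schur
  -- complement, the second one `lowerDet`
  have h0 : borderedMatrix f x = M (r₁ + r₂) := by
    ext (i | i) (j | j) <;> simp [M, r₁, r₂, borderedMatrix, hF, ho, Matrix.updateRow_apply]
  have h1 : M r₁ = Matrix.fromBlocks F o t 1 := by
    ext (i | i) (j | j) <;> simp [M, r₁, ht, Matrix.updateRow_apply]
  have h2 : M r₂ = Matrix.fromBlocks F o 0 (Matrix.of fun _ _ => (-1) ^ n) := by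
    ext (i | i) (j | j) <;> simp [M, r₂, Matrix.updateRow_apply]
  have h3 : F - o * t = -(Matrix.of fun i j : Fin n => totalMoment f j - lowerMoment f j (x i)) := by
    ext i j; simp [hF, ho, ht, Matrix.mul_apply]
  rw [h0, Matrix.det_updateRow_add]
  change (M _).det + (M _).det = _
  rw [h1, h2, Matrix.det_fromBlocks_one₂₂, Matrix.det_fromBlocks_zero₂₁, h3, Matrix.det_neg,
    altDet, upperDet, lowerDet]
  simp only [Fintype.card_fin, Matrix.det_unique, Matrix.of_apply]
  ring

/-- As a function of one of the points, `altDet` is an antiderivative of `f` times a polynomial of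
degree less than `n` whose limits at `±∞` agree up to the sign `(-1) ^ (n + 1)`; the latter is the
linear relation between the coefficients. -/
theorem exists_altDet_update_eq {n : ℕ} (f : ℝ → ℝ) (u : Fin n → ℝ) (k : Fin n) :
    ∃ (α : Fin n → ℝ) (κ : ℝ), (∀ x, altDet f (Function.update u k x) =
      ∑ j, α j * lowerMoment f j x + κ) ∧
      ∑ j, α j * totalMoment f j + (1 + (-1) ^ n) * κ = 0 := by
  set B := borderedMatrix f u with hB
  -- the determinant as a linear function of the row `k` (Cramer's rule)
  set L : (Fin n ⊕ Unit → ℝ) →ₗ[ℝ] ℝ := (LinearMap.proj (R := ℝ) (φ := fun _ => ℝ) (Sum.inl k)).comp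
    (Matrix.cramer B.transpose) with hL
  have hLdet : ∀ r, L r = (B.updateRow (Sum.inl k) r).det := fun r =>
    Matrix.cramer_transpose_apply B r (Sum.inl k)
  have hLsum : ∀ r, L r = ∑ j : Fin n, L (Pi.single (Sum.inl j) 1) * r (Sum.inl j) +
      L (Pi.single (Sum.inr ()) 1) * r (Sum.inr ()) := by
    intro r
    rw [LinearMap.pi_apply_eq_sum_univ L r, Fintype.sum_sum_type]
    simp only [smul_eq_mul, Finset.univ_unique, Finset.sum_singleton, PUnit.default_eq_unit]
    have : ∀ i : Fin n ⊕ Unit, (fun j => if i = j then (1 : ℝ) else 0) = Pi.single i 1 := by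
      intro i; ext j; simp [Pi.single_apply, eq_comm]
    simp only [this, mul_comm]
  have hupd : ∀ x, borderedMatrix f (Function.update u k x) =
      B.updateRow (Sum.inl k) (Sum.elim (fun j => lowerMoment f j x) fun _ => 1) := by
    intro x
    ext (i | i) (j | j)
    · by_cases hik : i = k
      · subst hik; simp [hB, borderedMatrix]
      · simp [hB, borderedMatrix, Matrix.updateRow_apply, hik]
    · by_cases hik : i = k
      · subst hik; simp [hB, borderedMatrix]
      · simp [hB, borderedMatrix, Matrix.updateRow_apply, hik]
    · simp [hB, borderedMatrix, Matrix.updateRow_apply]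
    · simp [hB, borderedMatrix, Matrix.updateRow_apply]
  have hsq : ((-1 : ℝ) ^ n) * (-1) ^ n = 1 := by rw [← pow_add, ← two_mul, pow_mul]; simp
  refine ⟨fun j => (-1) ^ n * L (Pi.single (Sum.inl j) 1),
    (-1) ^ n * L (Pi.single (Sum.inr ()) 1), fun x => ?_, ?_⟩
  · have h := det_borderedMatrix f (Function.update u k x)
    rw [hupd, ← hLdet, hLsum] at h
    simp only [Sum.elim_inl, Sum.elim_inr, mul_one] at h
    calc altDet f (Function.update u k x)
        = ((-1 : ℝ) ^ n * (-1) ^ n) * altDet f (Function.update u k x) := by rw [hsq, one_mul]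
      _ = (-1) ^ n * ((-1) ^ n * altDet f (Function.update u k x)) := by ring
      _ = _ := by rw [← h, mul_add, Finset.mul_sum]; simp only [mul_assoc]
  · -- two equal rows
    have h := hLsum (B (Sum.inr ()))
    rw [hLdet, Matrix.det_updateRow_eq_zero (by simp)] at h
    simp only [hB, borderedMatrix, Matrix.fromBlocks_apply₂₁, Matrix.fromBlocks_apply₂₂,
      Matrix.of_apply] at h
    calc _ = (-1) ^ n * (∑ j : Fin n, L (Pi.single (Sum.inl j) 1) * totalMoment f j +
          L (Pi.single (Sum.inr ()) 1) * (1 + (-1) ^ n)) := by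
          rw [mul_add, Finset.mul_sum]; simp only [mul_assoc]; ring
      _ = 0 := by rw [← h, mul_zero]

/-- Conversely, let the functions `φ k` be linear combinations of the lower moments and a constant
which satisfy the boundary relation. Then the determinant of the `φ k (x i)` is a constant multiple
of `altDet`, if the total mass of `f` is not zero: multiplying the bordered matrix by the matrix of coefficients makes it block
triangular. -/
theorem exists_det_eq_mul_altDet {n : ℕ} (hn : 0 < n) (f : ℝ → ℝ) (φ : Fin n → ℝ → ℝ)
    (α : Fin n → Fin n → ℝ) (κ : Fin n → ℝ)
    (hφ : ∀ k x, φ k x = ∑ j, α k j * lowerMoment f j x + κ k)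
    (hκ : ∀ k, ∑ j, α k j * totalMoment f j + (1 + (-1) ^ n) * κ k = 0) :
    ∃ c : ℝ, ∀ x : Fin n → ℝ,
      (Matrix.of fun i k : Fin n => φ k (x i)).det * totalMoment f 0 = c * altDet f x := by
  set C : Matrix (Fin n ⊕ Unit) (Fin n ⊕ Unit) ℝ := Matrix.fromBlocks
    (Matrix.of fun j k => α k j) (Matrix.of fun j _ => if j = ⟨0, hn⟩ then 1 else 0)
    (Matrix.of fun _ k => κ k) 0 with hC
  refine ⟨(-1) ^ n * C.det, fun x => ?_⟩
  have h1 : borderedMatrix f x * C = Matrix.fromBlocks (Matrix.of fun i k : Fin n => φ k (x i))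
      (Matrix.of fun i _ => lowerMoment f 0 (x i)) 0 (Matrix.of fun _ _ => totalMoment f 0) := by
    rw [borderedMatrix, hC, Matrix.fromBlocks_multiply]
    ext (i | i) (j | j)
    · simp [Matrix.mul_apply, hφ, mul_comm]
    · simp [Matrix.mul_apply]
    · simp only [Matrix.fromBlocks_apply₂₁, Matrix.add_apply, Matrix.mul_apply, Matrix.of_apply,
        Finset.univ_unique, Finset.sum_const, Finset.card_singleton, one_smul, Matrix.zero_apply]
      rw [← hκ j]
      simp only [mul_comm]
    · simp [Matrix.mul_apply]
  have h2 := congrArg Matrix.det h1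
  rw [Matrix.det_mul, det_borderedMatrix, Matrix.det_fromBlocks_zero₂₁, Matrix.det_unique
    (Matrix.of fun _ _ => totalMoment f 0)] at h2
  simp only [Matrix.of_apply] at h2
  rw [← h2]; ring

/-! ### The Cauchy weights -/

/-- `1 / √(1 + t ^ 2)`, the cosine of `arctan t`. -/
def cauchyRoot (t : ℝ) : ℝ := Real.cos (Real.arctan t)

theorem cauchyRoot_pos (t : ℝ) : 0 < cauchyRoot t := Real.cos_arctan_pos t

theorem cauchyRoot_sq (t : ℝ) : cauchyRoot t ^ 2 * (1 + t ^ 2) = 1 := by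
  rw [cauchyRoot, Real.cos_sq_arctan]
  exact one_div_mul_cancel (by positivity)

theorem sin_arctan_eq (t : ℝ) : Real.sin (Real.arctan t) = t * cauchyRoot t := by
  rw [cauchyRoot, Real.sin_arctan, Real.cos_arctan]; ring

theorem cauchyRoot_pow (m : ℕ) (t : ℝ) : cauchyRoot t ^ m = (1 + t ^ 2) ^ (-(m : ℝ) / 2) := by
  have h : (0 : ℝ) ≤ 1 + t ^ 2 := by positivity
  rw [cauchyRoot, Real.cos_arctan, one_div, Real.sqrt_eq_rpow, ← Real.rpow_neg h,
    ← Real.rpow_natCast, ← Real.rpow_mul h]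
  congr 1; ring

theorem hasDerivAt_cauchyRoot (t : ℝ) : HasDerivAt cauchyRoot (-t * cauchyRoot t ^ 3) t := by
  have h := (Real.hasDerivAt_arctan t).cos
  refine h.congr_deriv ?_
  have h2 : 1 / (1 + t ^ 2) = cauchyRoot t ^ 2 := by
    rw [one_div]; exact (eq_inv_of_mul_eq_one_left (cauchyRoot_sq t)).symm
  rw [sin_arctan_eq, h2]; ring

theorem hasDerivAt_cauchyRoot_affine_pow (a b : ℝ) (m : ℕ) (x : ℝ) :
    HasDerivAt (fun x => cauchyRoot (a * x + b) ^ m)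
      (-(m * a * (a * x + b) * cauchyRoot (a * x + b) ^ (m + 2))) x := by
  have h1 : HasDerivAt (fun x => a * x + b) a x := by
    simpa using ((hasDerivAt_id x).const_mul a).add_const b
  have h2 := ((hasDerivAt_cauchyRoot (a * x + b)).comp x h1).pow m
  refine h2.congr_deriv ?_
  change m * cauchyRoot (a * x + b) ^ (m - 1) * (-(a * x + b) * cauchyRoot (a * x + b) ^ 3 * a) = _
  obtain _ | m := m
  · simp
  · push_cast; ring

theorem continuous_cauchyRoot : Continuous cauchyRoot :=
  Real.continuous_cos.comp Real.continuous_arctan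

theorem tendsto_cauchyRoot_atTop : Tendsto cauchyRoot atTop (𝓝 0) := by
  have h := (Real.continuous_cos.tendsto (Real.pi / 2)).comp
    (Real.tendsto_arctan_atTop.mono_right nhdsWithin_le_nhds)
  rwa [Real.cos_pi_div_two] at h

theorem tendsto_cauchyRoot_atBot : Tendsto cauchyRoot atBot (𝓝 0) := by
  have h := (Real.continuous_cos.tendsto (-(Real.pi / 2))).comp
    (Real.tendsto_arctan_atBot.mono_right nhdsWithin_le_nhds)
  rwa [Real.cos_neg, Real.cos_pi_div_two] at h

theorem tendsto_mul_cauchyRoot_atTop : Tendsto (fun t => t * cauchyRoot t) atTop (𝓝 1) := by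
  have h := (Real.continuous_sin.tendsto (Real.pi / 2)).comp
    (Real.tendsto_arctan_atTop.mono_right nhdsWithin_le_nhds)
  rw [Real.sin_pi_div_two] at h
  exact h.congr fun t => sin_arctan_eq t

theorem tendsto_mul_cauchyRoot_atBot : Tendsto (fun t => t * cauchyRoot t) atBot (𝓝 (-1)) := by
  have h := (Real.continuous_sin.tendsto (-(Real.pi / 2))).comp
    (Real.tendsto_arctan_atBot.mono_right nhdsWithin_le_nhds)
  rw [Real.sin_neg, Real.sin_pi_div_two] at h
  exact h.congr fun t => sin_arctan_eq t

theorem vandermonde_affine {n : ℕ} (a b : ℝ) : ∃ A : ℝ, (a ≠ 0 → A ≠ 0) ∧ ∀ x : Fin n → ℝ,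
    vandermonde (fun i => a * x i + b) = A * vandermonde x := by
  refine ⟨∏ j : Fin n, ∏ _k ∈ Finset.Ioi j, a, fun ha => ?_, fun x => ?_⟩
  · exact Finset.prod_ne_zero_iff.2 fun j _ => Finset.prod_ne_zero_iff.2 fun _ _ => ha
  · simp only [vandermonde, ← Finset.prod_mul_distrib]
    exact Finset.prod_congr rfl fun j _ => Finset.prod_congr rfl fun k _ => by ring

theorem prod_prod_Ioi_mul {n : ℕ} (c : Fin n → ℝ) :
    ∏ j, ∏ k ∈ Finset.Ioi j, (c j * c k) = ∏ i, c i ^ (n - 1) := by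
  have h : ∏ j : Fin n, ∏ k ∈ Finset.Ioi j, c k = ∏ k : Fin n, ∏ _j ∈ Finset.Iio k, c k :=
    Finset.prod_comm' (by intro j k; simp)
  simp only [Finset.prod_mul_distrib]
  rw [h, ← Finset.prod_mul_distrib]
  refine Finset.prod_congr rfl fun i _ => ?_
  rw [Finset.prod_const, Finset.prod_const, ← pow_add, Fin.card_Ioi, Fin.card_Iio]
  congr 1
  omega

/-- The Vandermonde product of the points `t_i = tan θ_i` is controlled by powers of
`1 + t_i ^ 2`, because `(t_k - t_j) * cos θ_j * cos θ_k = sin (θ_k - θ_j)`. -/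
theorem prod_cauchyRoot_mul_vandermonde_le {n : ℕ} (t : Fin n → ℝ) :
    (∏ i, cauchyRoot (t i) ^ (n - 1)) * |vandermonde t| ≤ 1 := by
  rw [← prod_prod_Ioi_mul, vandermonde, Finset.abs_prod, ← Finset.prod_mul_distrib]
  refine Finset.prod_le_one (fun j _ => ?_) fun j _ => ?_
  · exact mul_nonneg (Finset.prod_nonneg fun k _ =>
      (mul_pos (cauchyRoot_pos _) (cauchyRoot_pos _)).le) (abs_nonneg _)
  · rw [Finset.abs_prod, ← Finset.prod_mul_distrib]
    refine Finset.prod_le_one (fun k _ => mul_nonneg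
      (mul_pos (cauchyRoot_pos _) (cauchyRoot_pos _)).le (abs_nonneg _)) fun k _ => ?_
    rw [← abs_of_pos (mul_pos (cauchyRoot_pos (t j)) (cauchyRoot_pos (t k))), ← abs_mul]
    have h : cauchyRoot (t j) * cauchyRoot (t k) * (t k - t j) =
        Real.sin (Real.arctan (t k) - Real.arctan (t j)) := by
      rw [Real.sin_sub, sin_arctan_eq, sin_arctan_eq, cauchyRoot, cauchyRoot]; ring
    rw [h]
    exact Real.abs_sin_le_one _

theorem integrable_cauchyRoot_sq {a : ℝ} (ha : a ≠ 0) (b : ℝ) :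
    Integrable fun x => cauchyRoot (a * x + b) ^ 2 := by
  have h : Integrable fun t => cauchyRoot t ^ 2 :=
    integrable_inv_one_add_sq.congr (Filter.Eventually.of_forall fun t =>
      (eq_inv_of_mul_eq_one_left (cauchyRoot_sq t)).symm)
  exact (h.comp_add_right b).comp_mul_left' ha

theorem exists_strictMono_fin (n : ℕ) : ∃ x : Fin n → ℝ, StrictMono x :=
  ⟨fun i => ((i : ℕ) : ℝ), fun _ _ hij => Nat.cast_lt.2 hij⟩

/-- The exponent is chosen so that the joint density is at most a multiple of `∏ (1 + t_i ^ 2)⁻¹`, with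
`t_i = a x_i + b`. -/
theorem isWeight_cauchyRoot {n β : ℕ} {a : ℝ} (ha : a ≠ 0) (b : ℝ) :
    IsWeight β n fun x => cauchyRoot (a * x + b) ^ ((n - 1) * β + 2) := by
  obtain ⟨A, hA0, hA⟩ := vandermonde_affine (n := n) a b
  replace hA0 := hA0 ha
  set v : ℝ → ℝ := fun x => cauchyRoot (a * x + b) ^ ((n - 1) * β + 2) with hv
  have hvpos : ∀ x, 0 < v x := fun x => pow_pos (cauchyRoot_pos _) _
  have hvc : Continuous v :=
    (continuous_cauchyRoot.comp ((continuous_const.mul continuous_id).add continuous_const)).pow _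
  have hjc : Continuous (jointDensity β n v) := by
    unfold jointDensity
    exact (continuous_finsetProd _ fun i _ => hvc.comp (continuous_apply i)).mul
      (continuous_vandermonde.abs.pow β)
  have hjn : ∀ x, 0 ≤ jointDensity β n v x := fun x =>
    mul_nonneg (Finset.prod_nonneg fun i _ => (hvpos _).le) (by positivity)
  have hint : Integrable (jointDensity β n v) := by
    have h1 : Integrable fun x : Fin n → ℝ => |A|⁻¹ ^ β * ∏ i, cauchyRoot (a * x i + b) ^ 2 :=
      (Integrable.fintype_prod (f := fun _ x => cauchyRoot (a * x + b) ^ 2)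
        fun _ => integrable_cauchyRoot_sq ha b).const_mul _
    refine h1.mono' hjc.aestronglyMeasurable (Filter.Eventually.of_forall fun x => ?_)
    rw [Real.norm_eq_abs, abs_of_nonneg (hjn x)]
    have h2 := prod_cauchyRoot_mul_vandermonde_le fun i => a * x i + b
    rw [hA, abs_mul] at h2
    have h3 : jointDensity β n v x = |A|⁻¹ ^ β *
        ((∏ i, cauchyRoot (a * x i + b) ^ (n - 1)) * (|A| * |vandermonde x|)) ^ β *
        ∏ i, cauchyRoot (a * x i + b) ^ 2 := by
      have hA1 : |A|⁻¹ ^ β * |A| ^ β = 1 := by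
        rw [← mul_pow, inv_mul_cancel₀ (abs_ne_zero.2 hA0), one_pow]
      simp only [jointDensity, hv, pow_add, pow_mul, Finset.prod_mul_distrib, Finset.prod_pow,
        mul_pow]
      linear_combination (-((∏ i, cauchyRoot (a * x i + b)) ^ (n - 1)) ^ β *
        (∏ i, cauchyRoot (a * x i + b)) ^ 2 * |vandermonde x| ^ β) * hA1
    rw [h3]
    refine mul_le_mul_of_nonneg_right ?_ (Finset.prod_nonneg fun i _ => by positivity)
    refine mul_le_of_le_one_right (by positivity) (pow_le_one₀ ?_ h2)
    exact mul_nonneg (Finset.prod_nonneg fun i _ => (pow_pos (cauchyRoot_pos _) _).le)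
      (by positivity)
  refine ⟨Filter.Eventually.of_forall hjn, hint, ?_⟩
  rw [integral_pos_iff_support_of_nonneg hjn hint]
  obtain ⟨x, hx⟩ := exists_strictMono_fin n
  refine (hjc.isOpen_support).measure_pos _ ⟨x, ?_⟩
  exact mul_ne_zero (Finset.prod_ne_zero_iff.2 fun i _ => (hvpos _).ne')
    (pow_ne_zero _ (abs_ne_zero.2 (vandermonde_pos hx).ne'))

theorem hasMoments_cauchyRoot {n : ℕ} (hn : 0 < n) {a : ℝ} (ha : a ≠ 0) (b : ℝ) :
    HasMoments n fun x => cauchyRoot (a * x + b) ^ (n + 1) := by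
  have hvc : Continuous fun x => cauchyRoot (a * x + b) ^ (n + 1) :=
    (continuous_cauchyRoot.comp ((continuous_const.mul continuous_id).add continuous_const)).pow _
  refine hasMoments_of_isWeight hn ?_ hvc.measurable (fun x => (pow_pos (cauchyRoot_pos _) _).le)
    fun x _ => hvc.continuousAt
  have h := isWeight_cauchyRoot (n := n) (β := 1) ha b
  rwa [show (n - 1) * 1 + 2 = n + 1 by omega] at h

theorem tendsto_cauchyRoot_pow_mul_pow {n k : ℕ} (hk : k < n) : ∃ l : ℝ,
    Tendsto (fun t => cauchyRoot t ^ (n - 1) * t ^ k) atTop (𝓝 l) ∧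
    Tendsto (fun t => cauchyRoot t ^ (n - 1) * t ^ k) atBot (𝓝 ((-1) ^ (n + 1) * l)) := by
  have h : (fun t => cauchyRoot t ^ (n - 1) * t ^ k) =
      fun t => (t * cauchyRoot t) ^ k * cauchyRoot t ^ (n - 1 - k) := by
    ext t
    rw [mul_pow, mul_assoc, ← pow_add, show k + (n - 1 - k) = n - 1 by omega, mul_comm]
  refine ⟨1 ^ k * 0 ^ (n - 1 - k), ?_, ?_⟩
  · rw [h]
    exact (tendsto_mul_cauchyRoot_atTop.pow k).mul (tendsto_cauchyRoot_atTop.pow _)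
  · have e : (-1 : ℝ) ^ (n + 1) * (1 ^ k * 0 ^ (n - 1 - k)) = (-1) ^ k * 0 ^ (n - 1 - k) := by
      by_cases hkn : n - 1 - k = 0
      · have : n + 1 = k + 2 := by omega
        rw [this, pow_add]; simp
      · simp [hkn]
    rw [h, e]
    exact (tendsto_mul_cauchyRoot_atBot.pow k).mul (tendsto_cauchyRoot_atBot.pow _)

theorem tendsto_affine {a : ℝ} (b : ℝ) (ha : 0 < a) :
    Tendsto (fun x => a * x + b) atTop atTop ∧ Tendsto (fun x => a * x + b) atBot atBot :=
  ⟨tendsto_atTop_add_const_right _ _ (tendsto_id.const_mul_atTop ha),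
    tendsto_atBot_add_const_right _ _ (tendsto_id.const_mul_atBot ha)⟩

theorem sum_mul_lowerMoment_tendsto {n : ℕ} {f : ℝ → ℝ} (hf : HasMoments n f) (α : Fin n → ℝ)
    (κ : ℝ) : Tendsto (fun x => ∑ j, α j * lowerMoment f j x + κ) atTop
        (𝓝 (∑ j, α j * totalMoment f j + κ)) ∧
      Tendsto (fun x => ∑ j, α j * lowerMoment f j x + κ) atBot (𝓝 κ) := by
  constructor
  · exact (tendsto_finsetSum _ fun j _ =>
      (tendsto_lowerMoment_atTop hf j.isLt).const_mul _).add_const _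
  · have h := (tendsto_finsetSum Finset.univ fun (j : Fin n) _ =>
      (tendsto_lowerMoment_atBot hf j.isLt).const_mul (α j)).add_const κ
    simpa using h

theorem hasDerivAt_sum_mul_lowerMoment {n : ℕ} {f : ℝ → ℝ} (hf : HasMoments n f) (α : Fin n → ℝ)
    (κ : ℝ) {x : ℝ} (hx : ContinuousAt f x) :
    HasDerivAt (fun x => ∑ j, α j * lowerMoment f j x + κ) (f x * ∑ j, α j * x ^ (j : ℕ)) x := by
  have h := (HasDerivAt.fun_sum (u := Finset.univ) fun (j : Fin n) _ =>
      (hasDerivAt_lowerMoment hf j.isLt hx).const_mul (α j)).add_const κ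
  refine h.congr_deriv ?_
  rw [Finset.mul_sum]
  exact Finset.sum_congr rfl fun j _ => by ring

/-- For the Cauchy weight `(1 + t ^ 2) ^ (-(n + 1) / 2)`, `t = a x + b`, each function
`(1 + t ^ 2) ^ (-(n - 1) / 2) * t ^ k` with `k < n` is an antiderivative of the weight times a
polynomial of degree less than `n`: the leading coefficient `(k - (n - 1)) a` of its formal degree
`k + 1` vanishes for `k = n - 1`. The limits of these functions at `±∞` differ by the sign
`(-1) ^ (n + 1)`. -/
theorem exists_cauchyRoot_eq_sum_lowerMoment {n k : ℕ} (hk : k < n) {a : ℝ} (ha : 0 < a) (b : ℝ) :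
    ∃ (α : Fin n → ℝ) (κ : ℝ),
      (∀ x, cauchyRoot (a * x + b) ^ (n - 1) * (a * x + b) ^ k =
        ∑ j : Fin n, α j * lowerMoment (fun x => cauchyRoot (a * x + b) ^ (n + 1)) j x + κ) ∧
      ∑ j : Fin n, α j * totalMoment (fun x => cauchyRoot (a * x + b) ^ (n + 1)) j +
        (1 + (-1) ^ n) * κ = 0 := by
  have hn : 0 < n := by omega
  set f : ℝ → ℝ := fun x => cauchyRoot (a * x + b) ^ (n + 1) with hf
  have hm : HasMoments n f := hasMoments_cauchyRoot hn ha.ne' b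
  have hfc : Continuous f :=
    (continuous_cauchyRoot.comp ((continuous_const.mul continuous_id).add continuous_const)).pow _
  set φ : ℝ → ℝ := fun x => cauchyRoot (a * x + b) ^ (n - 1) * (a * x + b) ^ k with hφ
  let T : Polynomial ℝ := Polynomial.C a * Polynomial.X + Polynomial.C b
  let q : Polynomial ℝ := Polynomial.C a *
    (Polynomial.C ((k : ℝ) - (n - 1 : ℕ)) * T ^ (k + 1) + Polynomial.C (k : ℝ) * T ^ (k - 1))
  have hT : ∀ m, (T ^ m).natDegree ≤ m := fun m => by
    refine (Polynomial.natDegree_pow_le).trans ?_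
    exact (Nat.mul_le_mul_left m Polynomial.natDegree_linear_le).trans (mul_one m).le
  have hq : q.natDegree < n := by
    refine lt_of_le_of_lt (Polynomial.natDegree_C_mul_le _ _) ?_
    refine lt_of_le_of_lt (Polynomial.natDegree_add_le _ _) (max_lt ?_ ?_)
    · by_cases hkn : k = n - 1
      · simp [hkn, hn]
      · exact lt_of_le_of_lt ((Polynomial.natDegree_C_mul_le _ _).trans (hT _)) (by omega)
    · exact lt_of_le_of_lt ((Polynomial.natDegree_C_mul_le _ _).trans (hT _)) (by omega)
  have hφd : ∀ x, HasDerivAt φ (f x * q.eval x) x := by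
    intro x
    have h1 : HasDerivAt (fun x => a * x + b) a x := by
      simpa using ((hasDerivAt_id x).const_mul a).add_const b
    have h2 := (hasDerivAt_cauchyRoot_affine_pow a b (n - 1) x).mul (h1.pow k)
    refine h2.congr_deriv ?_
    have hqe : q.eval x = a * (((k : ℝ) - (n - 1 : ℕ)) * (a * x + b) ^ (k + 1) +
        k * (a * x + b) ^ (k - 1)) := by simp [q, T]
    rw [hqe, hf]
    simp only [Pi.pow_apply]
    have e1 := cauchyRoot_sq (a * x + b)
    set t := a * x + b
    set c := cauchyRoot t
    have e2 : c ^ (n - 1 + 2) = c ^ (n + 1) := by rw [show n - 1 + 2 = n + 1 by omega]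
    have e3 : c ^ (n - 1) = c ^ (n + 1) * (1 + t ^ 2) := by
      rw [← e2, pow_add, mul_assoc, e1, mul_one]
    have e4 : (k : ℝ) * t ^ (k + 1) = k * (t ^ (k - 1) * t ^ 2) := by
      obtain _ | k := k
      · simp
      · simp only [Nat.add_sub_cancel]; ring
    rw [e2, e3]
    linear_combination (-c ^ (n + 1) * a) * e4
  set α : Fin n → ℝ := fun j => q.coeff j with hα
  have hqα : ∀ x, q.eval x = ∑ j : Fin n, α j * x ^ (j : ℕ) := fun x => by
    rw [Polynomial.eval_eq_sum_range' hq, Finset.sum_range]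
  set S : ℝ → ℝ := fun x => ∑ j : Fin n, α j * lowerMoment f j x with hS
  have hSd : ∀ x, HasDerivAt S (f x * q.eval x) x := fun x => by
    simpa [hqα] using hasDerivAt_sum_mul_lowerMoment hm α 0 (hfc.continuousAt (x := x))
  have hconst : ∀ x, φ x = S x + (φ 0 - S 0) := by
    intro x
    have hd : ∀ y, HasDerivAt (fun y => φ y - S y) 0 y := fun y => by
      exact ((hφd y).sub (hSd y)).congr_deriv (sub_self _)
    have := is_const_of_deriv_eq_zero (fun y => (hd y).differentiableAt) (fun y => (hd y).deriv) x 0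
    linarith
  refine ⟨α, φ 0 - S 0, hconst, ?_⟩
  obtain ⟨l, hl1, hl2⟩ := tendsto_cauchyRoot_pow_mul_pow hk
  obtain ⟨ht1, ht2⟩ := sum_mul_lowerMoment_tendsto hm α (φ 0 - S 0)
  -- the boundary relation expresses that the limits differ by the sign
  have e1 := tendsto_nhds_unique ((hl1.comp (tendsto_affine b ha).1).congr hconst) ht1
  have e2 := tendsto_nhds_unique ((hl2.comp (tendsto_affine b ha).2).congr hconst) ht2
  have hsq : ((-1 : ℝ) ^ n) * (-1) ^ n = 1 := by rw [← pow_add, ← two_mul, pow_mul]; simp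
  rw [pow_succ] at e2
  linear_combination -e1 - (-1) ^ n * e2 - l * hsq

/-- For the Cauchy weight the density of the alternate points is that of a unitary ensemble. The
functions `(1 + t ^ 2) ^ (-(n - 1) / 2) * t ^ k` have a Vandermonde determinant. -/
theorem exists_altDet_cauchyRoot {n : ℕ} (hn : 0 < n) {a : ℝ} (ha : 0 < a) (b : ℝ) :
    ∃ C : ℝ, 0 < C ∧ ∀ x : Fin n → ℝ,
      (∏ i, cauchyRoot (a * x i + b) ^ (n + 1)) * vandermonde x *
        altDet (fun x => cauchyRoot (a * x + b) ^ (n + 1)) x =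
      C * jointDensity 2 n (fun x => cauchyRoot (a * x + b) ^ (2 * n)) x := by
  set f : ℝ → ℝ := fun x => cauchyRoot (a * x + b) ^ (n + 1) with hf
  have hm : HasMoments n f := hasMoments_cauchyRoot hn ha.ne' b
  have hfpos : ∀ x, 0 < f x := fun x => pow_pos (cauchyRoot_pos _) _
  choose α κ hφ hκ using fun k : Fin n => exists_cauchyRoot_eq_sum_lowerMoment k.isLt ha b
  obtain ⟨c, hc⟩ := exists_det_eq_mul_altDet hn f
    (fun k x => cauchyRoot (a * x + b) ^ (n - 1) * (a * x + b) ^ (k : ℕ)) α κ hφ hκ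
  obtain ⟨A, hA0, hA⟩ := vandermonde_affine (n := n) a b
  replace hA0 := hA0 ha.ne'
  have hdet : ∀ x : Fin n → ℝ, (Matrix.of fun i k : Fin n =>
      cauchyRoot (a * x i + b) ^ (n - 1) * (a * x i + b) ^ (k : ℕ)).det =
      (∏ i, cauchyRoot (a * x i + b) ^ (n - 1)) * (A * vandermonde x) := by
    intro x
    rw [← hA, vandermonde_eq_det, ← Matrix.det_mul_column]
    rfl
  have hT : 0 < totalMoment f 0 := by
    have h1 : Integrable fun y => f y * y ^ 0 := hm.integrable 0 hn
    rw [totalMoment, integral_pos_iff_support_of_nonneg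
      (fun y => by simpa using (hfpos y).le) h1]
    have : Function.support (fun y => f y * y ^ 0) = Set.univ := by
      ext y; simp [(hfpos y).ne']
    rw [this]; simp
  have hkey : ∀ x : Fin n → ℝ, (∏ i, cauchyRoot (a * x i + b) ^ (n - 1)) * (A * vandermonde x) *
      totalMoment f 0 = c * altDet f x := fun x => by rw [← hdet, hc]
  have hc0 : c ≠ 0 := by
    rintro rfl
    obtain ⟨x, hx⟩ := exists_strictMono_fin n
    have h := hkey x
    rw [zero_mul] at h
    refine mul_ne_zero (mul_ne_zero (Finset.prod_ne_zero_iff.2 fun i _ =>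
      (pow_pos (cauchyRoot_pos _) _).ne') (mul_ne_zero hA0 (vandermonde_pos hx).ne')) hT.ne' h
  have hprod : ∀ x : Fin n → ℝ, (∏ i, cauchyRoot (a * x i + b) ^ (2 * n)) =
      (∏ i, cauchyRoot (a * x i + b) ^ (n + 1)) * ∏ i, cauchyRoot (a * x i + b) ^ (n - 1) := by
    intro x
    rw [← Finset.prod_mul_distrib]
    refine Finset.prod_congr rfl fun i _ => ?_
    rw [← pow_add]; congr 1; omega
  have hid : ∀ x : Fin n → ℝ,
      (∏ i, cauchyRoot (a * x i + b) ^ (n + 1)) * vandermonde x * altDet f x =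
      A * totalMoment f 0 / c *
        jointDensity 2 n (fun x => cauchyRoot (a * x + b) ^ (2 * n)) x := by
    intro x
    rw [jointDensity, hprod, sq_abs, div_mul_eq_mul_div, eq_div_iff hc0]
    linear_combination (-(∏ i, cauchyRoot (a * x i + b) ^ (n + 1)) * vandermonde x) * hkey x
  refine ⟨A * totalMoment f 0 / c, ?_, hid⟩
  -- the sign of the constant is read off at any increasing tuple, where both sides are nonnegative
  refine lt_of_le_of_ne ?_ (div_ne_zero (mul_ne_zero hA0 hT.ne') hc0).symm
  obtain ⟨x, hx⟩ := exists_strictMono_fin n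
  have hj : 0 < jointDensity 2 n (fun x => cauchyRoot (a * x + b) ^ (2 * n)) x :=
    mul_pos (Finset.prod_pos fun i _ => pow_pos (cauchyRoot_pos _) _)
      (pow_pos (abs_pos.2 (vandermonde_pos hx).ne') 2)
  have h0 : 0 ≤ (∏ i, cauchyRoot (a * x i + b) ^ (n + 1)) * vandermonde x * altDet f x :=
    mul_nonneg (mul_nonneg (Finset.prod_nonneg fun i _ => (pow_pos (cauchyRoot_pos _) _).le)
      (vandermonde_pos hx).le) (altDet_nonneg hm hx)
  rw [hid] at h0
  exact nonneg_of_mul_nonneg_left h0 hj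

/-! ### Extracting the multiplier -/

/-- The functions which are an antiderivative of `f` times a polynomial of degree less than `n`, and
whose limits at `-∞` and `+∞` agree up to the sign `(-1) ^ (n + 1)`. The second condition is
expressed through the coefficients, the limits being `κ` and `∑ α_j T_j + κ`. -/
def IsTwistedPrimitive (n : ℕ) (f φ : ℝ → ℝ) : Prop :=
  ∃ (α : Fin n → ℝ) (κ : ℝ), (∀ x, φ x = ∑ j, α j * lowerMoment f j x + κ) ∧
    ∑ j, α j * totalMoment f j + (1 + (-1) ^ n) * κ = 0

theorem IsTwistedPrimitive.sum_mul {n : ℕ} {f : ℝ → ℝ} {ι : Type*} (s : Finset ι)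
    {φ : ι → ℝ → ℝ} (c : ι → ℝ) (hφ : ∀ k, IsTwistedPrimitive n f (φ k)) :
    IsTwistedPrimitive n f fun x => ∑ k ∈ s, c k * φ k x := by
  choose α κ h1 h2 using hφ
  refine ⟨fun j => ∑ k ∈ s, c k * α k j, ∑ k ∈ s, c k * κ k, fun x => ?_, ?_⟩
  · simp only [h1, Finset.sum_mul, mul_add, Finset.sum_add_distrib, Finset.mul_sum, mul_assoc]
    rw [Finset.sum_comm]
  · have : ∀ k, c k * (∑ j, α k j * totalMoment f j + (1 + (-1) ^ n) * κ k) = 0 := fun k => by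
      rw [h2, mul_zero]
    rw [← Finset.sum_eq_zero fun k (_ : k ∈ s) => this k]
    simp only [Finset.sum_mul, mul_add, Finset.sum_add_distrib, Finset.mul_sum, mul_assoc]
    rw [Finset.sum_comm]
    congr 1
    exact Finset.sum_congr rfl fun k _ => by ring

theorem IsTwistedPrimitive.continuous {n : ℕ} {f φ : ℝ → ℝ} (hf : HasMoments n f)
    (hφ : IsTwistedPrimitive n f φ) : Continuous φ := by
  obtain ⟨α, κ, h, -⟩ := hφ
  rw [funext h]
  exact (continuous_finsetSum _ fun j _ =>
    continuous_const.mul (continuous_lowerMoment hf j.isLt)).add continuous_const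

theorem IsTwistedPrimitive.exists_tendsto {n : ℕ} {f φ : ℝ → ℝ} (hf : HasMoments n f)
    (hφ : IsTwistedPrimitive n f φ) :
    ∃ A, Tendsto φ atTop (𝓝 A) ∧ Tendsto φ atBot (𝓝 ((-1) ^ (n + 1) * A)) := by
  obtain ⟨α, κ, h, h2⟩ := hφ
  obtain ⟨ht1, ht2⟩ := sum_mul_lowerMoment_tendsto hf α κ
  rw [funext h]
  refine ⟨_, ht1, ?_⟩
  convert! ht2 using 2
  have hsq : ((-1 : ℝ) ^ n) * (-1) ^ n = 1 := by rw [← pow_add, ← two_mul, pow_mul]; simp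
  rw [pow_succ]
  linear_combination (-(-1) ^ n) * h2 + κ * hsq

theorem IsTwistedPrimitive.exists_hasDerivAt {n : ℕ} {f φ : ℝ → ℝ} (hn : 0 < n)
    (hf : HasMoments n f) (hφ : IsTwistedPrimitive n f φ) :
    ∃ q : Polynomial ℝ, q.natDegree < n ∧
      ∀ x, ContinuousAt f x → HasDerivAt φ (f x * q.eval x) x := by
  obtain ⟨α, κ, h, -⟩ := hφ
  refine ⟨∑ j : Fin n, Polynomial.C (α j) * Polynomial.X ^ (j : ℕ), ?_, fun x hx => ?_⟩
  · refine lt_of_le_of_lt (Polynomial.natDegree_sum_le_of_forall_le (n := n - 1) _ _ fun j _ => ?_)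
      (by omega)
    exact (Polynomial.natDegree_C_mul_X_pow_le _ _).trans (by omega)
  · rw [funext h]
    refine (hasDerivAt_sum_mul_lowerMoment hf α κ hx).congr_deriv ?_
    simp [Polynomial.eval_finsetSum]

/-- The densities agree only if, for one function `h`, all products `h * p` with `p` a polynomial of
degree less than `n` extend from the support of `f` to twisted primitives. Here `h` is the quotient
of the weights `g` and `f`. It is recovered by freezing all points but one: the determinant as a
function of the remaining point is `h` times a Lagrange basis polynomial. -/
theorem exists_multiplier {n : ℕ} (hn : 2 ≤ n) {f g : ℝ → ℝ} (hf : IsWeight 1 n f)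
    (hm : HasMoments n f) (hU : IsOpen (Function.support f)) {C : ℝ}
    (hid : ∀ᵐ x : Fin n → ℝ,
      (∏ i, f (x i)) * vandermonde x * altDet f x = C * jointDensity 2 n g x) :
    ∃ (h : ℝ → ℝ) (Φ : Polynomial ℝ → ℝ → ℝ), (∀ p, IsTwistedPrimitive n f (Φ p)) ∧
      (∀ p : Polynomial ℝ, p.natDegree < n → ∀ x, f x ≠ 0 → Φ p x = h x * p.eval x) ∧
      ∀ x, ∃ p : Polynomial ℝ, p.natDegree < n ∧ Φ p x ≠ 0 := by
  obtain ⟨u, ⟨⟨hupd, hinj⟩, hu⟩, hu0⟩ :=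
    exists_jointDensity_ne_zero hf (((ae_update hid).and ae_injective).and hid)
  have hfu : ∀ i, f (u i) ≠ 0 := fun i =>
    Finset.prod_ne_zero_iff.1 (left_ne_zero_of_mul hu0) i (Finset.mem_univ i)
  have hΔ : vandermonde u ≠ 0 := vandermonde_ne_zero_iff.2 hinj
  have hD : altDet f u ≠ 0 := altDet_ne_zero hn hm hU hinj ⟨0, by omega⟩ fun i _ => hfu i
  have hgu : ∀ i, g (u i) ≠ 0 := by
    have h1 : (∏ i, f (u i)) * vandermonde u * altDet f u ≠ 0 :=
      mul_ne_zero (mul_ne_zero (Finset.prod_ne_zero_iff.2 fun i _ => hfu i) hΔ) hD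
    rw [hu] at h1
    exact fun i => Finset.prod_ne_zero_iff.1 (left_ne_zero_of_mul (right_ne_zero_of_mul h1)) i
      (Finset.mem_univ i)
  set ell : Fin n → ℝ → ℝ := fun k x => (Lagrange.basis Finset.univ u k).eval x with hell
  have hellc : ∀ k, Continuous (ell k) := fun k => Polynomial.continuous _
  have hDc : ∀ k, Continuous fun x => altDet f (Function.update u k x) := fun k =>
    (continuous_altDet hm).comp (continuous_const.update k continuous_id)
  have hsumell : ∀ x, ∑ k, ell k x = 1 := by
    intro x
    have h1 := Lagrange.sum_basis (s := Finset.univ) (v := u) hinj.injOn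
      ⟨⟨0, by omega⟩, Finset.mem_univ _⟩
    have h2 := congrArg (Polynomial.eval x) h1
    rwa [Polynomial.eval_finsetSum, Polynomial.eval_one] at h2
  -- the quotient of the weights at the frozen points
  set r : Fin n → ℝ := fun k => g (u k) / f (u k) with hr
  have hr0 : ∀ k, r k ≠ 0 := fun k => div_ne_zero (hgu k) (hfu k)
  -- the identity with the point `k` moved to `x`, divided by the identity at `u`
  have hbasic : ∀ᵐ x : ℝ, ∀ k, f x * (altDet f (Function.update u k x) * r k) =
      g x * ell k x * altDet f u := by
    refine ae_all_iff.2 fun k => ?_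
    have hne : ∀ᵐ x : ℝ, x ∉ ((Lagrange.basis Finset.univ u k).roots.toFinset : Set ℝ) :=
      compl_mem_ae_iff.2 ((Finset.finite_toSet _).measure_zero volume)
    have hLne : Lagrange.basis Finset.univ u k ≠ 0 :=
      Lagrange.basis_ne_zero hinj.injOn (Finset.mem_univ k)
    filter_upwards [hupd k, hne] with x hx hxr
    have hl0 : ell k x ≠ 0 := by
      intro h0
      exact hxr (by simp [hLne, Polynomial.IsRoot.def]; exact h0)
    rw [jointDensity_update g hinj, vandermonde_update hinj,
      ← Finset.mul_prod_erase _ _ (Finset.mem_univ k), Function.update_self, ← abs_mul,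
      sq_abs, Finset.prod_congr rfl fun i hi => by
        rw [Function.update_of_ne (Finset.ne_of_mem_erase hi)]] at hx
    have hu' := hu
    rw [jointDensity, sq_abs, ← Finset.mul_prod_erase _ _ (Finset.mem_univ k),
      ← Finset.mul_prod_erase _ (fun i => g (u i)) (Finset.mem_univ k)] at hu'
    change _ * (ell k x * vandermonde u) * _ = _ * (_ * (ell k x * vandermonde u) ^ 2) at hx
    have hP : (∏ i ∈ Finset.univ.erase k, f (u i)) ≠ 0 :=
      Finset.prod_ne_zero_iff.2 fun i _ => hfu i
    set P := ∏ i ∈ Finset.univ.erase k, f (u i)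
    set G := ∏ i ∈ Finset.univ.erase k, g (u i)
    have hx2 : f x * P * altDet f (Function.update u k x) =
        C * (g x * G * (ell k x * vandermonde u)) := by
      apply mul_right_cancel₀ (mul_ne_zero hl0 hΔ)
      linear_combination hx
    have hu2 : f (u k) * P * altDet f u = C * (g (u k) * G * vandermonde u) := by
      apply mul_right_cancel₀ hΔ
      linear_combination hu'
    have hfk := hfu k
    apply mul_left_cancel₀ (mul_ne_zero hP hfk)
    have hrk : f (u k) * r k = g (u k) := by rw [hr]; field_simp
    linear_combination (P * f x * altDet f (Function.update u k x)) * hrk + g (u k) * hx2 -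
      (g x * ell k x) * hu2
  -- as the Lagrange basis sums to `1`, this agrees with `g / f` almost everywhere on the support, and
  -- it is continuous, so that almost everywhere can be improved to everywhere
  set h : ℝ → ℝ := fun x => ∑ k, r k / altDet f u * altDet f (Function.update u k x) with hh
  have hhc : Continuous h := continuous_finsetSum _ fun k _ => continuous_const.mul (hDc k)
  have hmain : ∀ k x, f x ≠ 0 →
      altDet f (Function.update u k x) * r k = h x * ell k x * altDet f u := by
    intro k
    have hae : (fun x => altDet f (Function.update u k x) * r k)
        =ᵐ[volume.restrict (Function.support f)] fun x => h x * ell k x * altDet f u := by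
      filter_upwards [ae_restrict_of_ae hbasic, ae_restrict_mem hU.measurableSet] with x hx hxf
      have hxf' : f x ≠ 0 := hxf
      have hx' : ∀ k, altDet f (Function.update u k x) * r k =
          g x / f x * ell k x * altDet f u := by
        intro k
        apply mul_left_cancel₀ hxf'
        rw [hx k]; field_simp
      have hhx : h x = g x / f x := by
        calc h x = ∑ k, (altDet f (Function.update u k x) * r k) / altDet f u :=
              Finset.sum_congr rfl fun k _ => by ring
          _ = ∑ k, g x / f x * ell k x := Finset.sum_congr rfl fun k _ => by
              rw [hx' k]; field_simp
          _ = g x / f x := by rw [← Finset.mul_sum, hsumell, mul_one]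
      rw [hhx, hx' k]
    have := Measure.eqOn_open_of_ae_eq hae hU ((hDc k).mul continuous_const).continuousOn
      ((hhc.mul (hellc k)).mul continuous_const).continuousOn
    exact fun x hx => this hx
  refine ⟨h, fun p x => ∑ k, (p.eval (u k) * r k / altDet f u) *
    altDet f (Function.update u k x), fun p => ?_, fun p hp x hx => ?_, fun x => ?_⟩
  · exact IsTwistedPrimitive.sum_mul Finset.univ _ fun k => exists_altDet_update_eq f u k
  · have h1 := Lagrange.eq_interpolate (s := Finset.univ) (v := u) (f := p) hinj.injOn
      (by simpa using Polynomial.degree_le_natDegree.trans_lt (Nat.cast_lt.2 hp))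
    have h2 := congrArg (Polynomial.eval x) h1
    simp only [Lagrange.interpolate_apply, Polynomial.eval_finsetSum, Polynomial.eval_mul,
      Polynomial.eval_C] at h2
    rw [h2, Finset.mul_sum]
    refine Finset.sum_congr rfl fun k _ => ?_
    calc _ = p.eval (u k) / altDet f u * (altDet f (Function.update u k x) * r k) := by ring
      _ = _ := by rw [hmain k x hx]; field_simp; rfl
  · -- the basis polynomial of `k` gives a multiple of the determinant with the point `k` moved to `x`,
    -- which is nonzero if `x` is distinct from the other points
    obtain ⟨k, hk⟩ : ∃ k, ∀ i, i ≠ k → u i ≠ x := by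
      by_cases hx : ∃ k, u k = x
      · obtain ⟨k, rfl⟩ := hx
        exact ⟨k, fun i hi => hinj.ne hi⟩
      · push Not at hx
        exact ⟨⟨0, by omega⟩, fun i _ => hx i⟩
    refine ⟨Lagrange.basis Finset.univ u k, ?_, ?_⟩
    · rw [Lagrange.natDegree_basis hinj.injOn (Finset.mem_univ k)]
      simp only [Finset.card_univ, Fintype.card_fin]
      omega
    · beta_reduce
      rw [Finset.sum_eq_single k]
      · rw [Lagrange.eval_basis_self hinj.injOn (Finset.mem_univ k), one_mul]
        refine mul_ne_zero (div_ne_zero (hr0 k) hD) (altDet_ne_zero hn hm hU ?_ k fun i hi => ?_)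
        · intro i j hij
          by_cases hik : i = k <;> by_cases hjk : j = k
          · rw [hik, hjk]
          · rw [hik, Function.update_self, Function.update_of_ne hjk] at hij
            exact absurd hij.symm (hk j hjk)
          · rw [hjk, Function.update_self, Function.update_of_ne hik] at hij
            exact absurd hij (hk i hik)
          · rw [Function.update_of_ne hik, Function.update_of_ne hjk] at hij
            exact hinj hij
        · rw [Function.update_of_ne hi]; exact hfu i
      · intro l _ hl
        rw [Lagrange.eval_basis_of_ne hl.symm (Finset.mem_univ l)]; ring
      · intro hk'; exact absurd (Finset.mem_univ k) hk'

/-! ### The support of the weight is the whole line -/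

/-- On the support of `f`, the function `h * p` is differentiable, with derivative `f` times a
polynomial of degree less than `n`. -/
theorem exists_hasDerivAt_multiplier {n : ℕ} (hn : 2 ≤ n) {f : ℝ → ℝ} (hm : HasMoments n f)
    (hU : IsOpen (Function.support f)) (hc : ∀ x, f x ≠ 0 → ContinuousAt f x) {h : ℝ → ℝ}
    {Φ : Polynomial ℝ → ℝ → ℝ} (hΦ : ∀ p, IsTwistedPrimitive n f (Φ p))
    (hval : ∀ p : Polynomial ℝ, p.natDegree < n → ∀ x, f x ≠ 0 → Φ p x = h x * p.eval x)
    (p : Polynomial ℝ) (hp : p.natDegree < n) :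
    ∃ q : Polynomial ℝ, q.natDegree < n ∧
      ∀ x, f x ≠ 0 → HasDerivAt (fun y => h y * p.eval y) (f x * q.eval x) x := by
  obtain ⟨q, hq, hqd⟩ := (hΦ p).exists_hasDerivAt (by omega) hm
  refine ⟨q, hq, fun x hx => (hqd x (hc x hx)).congr_of_eventuallyEq ?_⟩
  filter_upwards [hU.mem_nhds hx] with y hy using (hval p hp y hy).symm

/-- Comparing the derivatives of `h` and of `h * X` shows that `h` is `f` times a polynomial. -/
theorem exists_multiplier_eq_mul {n : ℕ} (hn : 2 ≤ n) {f : ℝ → ℝ} (hm : HasMoments n f)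
    (hU : IsOpen (Function.support f)) (hc : ∀ x, f x ≠ 0 → ContinuousAt f x) {h : ℝ → ℝ}
    {Φ : Polynomial ℝ → ℝ → ℝ} (hΦ : ∀ p, IsTwistedPrimitive n f (Φ p))
    (hval : ∀ p : Polynomial ℝ, p.natDegree < n → ∀ x, f x ≠ 0 → Φ p x = h x * p.eval x) :
    ∃ v q₀ : Polynomial ℝ, (∀ x, f x ≠ 0 → h x = f x * v.eval x) ∧
      ∀ x, f x ≠ 0 → HasDerivAt h (f x * q₀.eval x) x := by
  obtain ⟨q₀, -, h₀⟩ := exists_hasDerivAt_multiplier hn hm hU hc hΦ hval 1 (by simp; omega)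
  obtain ⟨q₁, -, h₁⟩ := exists_hasDerivAt_multiplier hn hm hU hc hΦ hval Polynomial.X
    (by simp; omega)
  simp only [Polynomial.eval_one, mul_one, Polynomial.eval_X] at h₀ h₁
  refine ⟨q₁ - Polynomial.X * q₀, q₀, fun x hx => ?_, h₀⟩
  have := (h₁ x hx).unique ((h₀ x hx).mul (hasDerivAt_id x))
  simp only [mul_one] at this
  simp only [Polynomial.eval_sub, Polynomial.eval_mul, Polynomial.eval_X]
  linear_combination -this

/-- The weight has no zero in the interval: at a boundary point of the support within the interval,
`h` and with it all the functions `h * p` would tend to `0`. -/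
theorem support_eq_of_multiplier {n : ℕ} (hn : 2 ≤ n) {f : ℝ → ℝ} (hm : HasMoments n f) {I : Set ℝ}
    (hI : I.OrdConnected) (hcont : ∀ x ∈ I, ContinuousAt f x)
    (hzero : ∀ x, x ∉ I → f x = 0) (hU0 : (Function.support f).Nonempty) {h : ℝ → ℝ}
    (hU : IsOpen (Function.support f))
    {Φ : Polynomial ℝ → ℝ → ℝ} (hΦ : ∀ p, IsTwistedPrimitive n f (Φ p))
    (hval : ∀ p : Polynomial ℝ, p.natDegree < n → ∀ x, f x ≠ 0 → Φ p x = h x * p.eval x)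
    (hne : ∀ x, ∃ p : Polynomial ℝ, p.natDegree < n ∧ Φ p x ≠ 0) :
    Function.support f = I := by
  set U := Function.support f with hUdef
  have hUI : U ⊆ I := fun x hx => by
    by_contra hxI
    exact hx (hzero x hxI)
  obtain ⟨v, -, hv, -⟩ := exists_multiplier_eq_mul hn hm hU (fun x hx => hcont x (hUI hx)) hΦ hval
  refine hUI.antisymm (hI.isPreconnected.subset_of_closure_inter_subset hU ?_ ?_)
  · obtain ⟨x, hx⟩ := hU0
    exact ⟨x, hUI hx, hx⟩
  · rintro x ⟨hxc, hxI⟩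
    by_contra hxU
    have hfx : f x = 0 := not_not.1 hxU
    have hNB : (𝓝[U] x).NeBot := mem_closure_iff_nhdsWithin_neBot.1 hxc
    have hf0 : Tendsto f (𝓝[U] x) (𝓝 0) := by
      have := (hcont x hxI).tendsto.mono_left (nhdsWithin_le_nhds (s := U))
      rwa [hfx] at this
    obtain ⟨p, hp, hpx⟩ := hne x
    have h1 : Tendsto (Φ p) (𝓝[U] x) (𝓝 (Φ p x)) :=
      ((hΦ p).continuous hm).continuousAt.tendsto.mono_left nhdsWithin_le_nhds
    have h2 : Tendsto (fun y => f y * v.eval y * p.eval y) (𝓝[U] x)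
        (𝓝 (0 * v.eval x * p.eval x)) :=
      (hf0.mul (v.continuous.continuousAt.tendsto.mono_left nhdsWithin_le_nhds)).mul
        (p.continuous.continuousAt.tendsto.mono_left nhdsWithin_le_nhds)
    refine hpx (tendsto_nhds_unique h1 ?_)
    rw [zero_mul, zero_mul] at h2
    refine h2.congr' ?_
    filter_upwards [self_mem_nhdsWithin] with y hy
    rw [hval p hp y hy, hv y hy]

/-- If the limits of all `h * p` at a finite point `l` and at another end agree up to a factor, then
all these limits vanish. The limit of `h * (X - l) ^ (n - 1)` at `l` is zero, hence so is its limit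
at the other end, where every polynomial of degree less than `n` is dominated by
`(X - l) ^ (n - 1)`. -/
theorem tendsto_zero_of_twisted_ends {n : ℕ} (hn : 2 ≤ n) {h : ℝ → ℝ} {a b : Filter ℝ} {l s : ℝ}
    (hs : s ≠ 0) (ha : a ≤ 𝓝 l) [a.NeBot] [b.NeBot]
    (hlim : ∀ p : Polynomial ℝ, p.natDegree < n → ∃ A, Tendsto (fun x => h x * p.eval x) a (𝓝 A) ∧
      Tendsto (fun x => h x * p.eval x) b (𝓝 (s * A)))
    (hb : ∀ p : Polynomial ℝ, p.natDegree < n →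
      (fun x => p.eval x) =O[b] fun x => (x - l) ^ (n - 1))
    (p : Polynomial ℝ) (hp : p.natDegree < n) : Tendsto (fun x => h x * p.eval x) a (𝓝 0) := by
  have hp0 : ((Polynomial.X - Polynomial.C l) ^ (n - 1)).natDegree < n := by
    rw [Polynomial.natDegree_pow, Polynomial.natDegree_X_sub_C]; omega
  obtain ⟨A₀, hA₀, hB₀⟩ := hlim _ hp0
  obtain ⟨A₁, hA₁, -⟩ := hlim 1 (by simp; omega)
  obtain ⟨A, hA, hB⟩ := hlim p hp
  simp only [Polynomial.eval_pow, Polynomial.eval_sub, Polynomial.eval_X, Polynomial.eval_C,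
    Polynomial.eval_one, mul_one] at hA₀ hB₀ hA₁
  have h0 : A₀ = 0 := by
    have hx : Tendsto (fun x => (x - l) ^ (n - 1)) a (𝓝 0) := by
      have : Tendsto (fun x => (x - l) ^ (n - 1)) (𝓝 l) (𝓝 ((l - l) ^ (n - 1))) :=
        ((continuous_id.sub continuous_const).pow _).tendsto l
      rw [sub_self, zero_pow (by omega)] at this
      exact this.mono_left ha
    have := hA₁.mul hx
    rw [mul_zero] at this
    exact tendsto_nhds_unique hA₀ this
  rw [h0, mul_zero] at hB₀
  have h1 : Tendsto (fun x => h x * p.eval x) b (𝓝 0) :=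
    ((Asymptotics.isBigO_refl h b).mul (hb p hp)).trans_tendsto hB₀
  have h2 := tendsto_nhds_unique hB h1
  rw [(mul_eq_zero.1 h2).resolve_left hs] at hA
  exact hA

theorem isBigO_pow_sub_of_ne {n : ℕ} {l r : ℝ} (hlr : r ≠ l) {b : Filter ℝ} (hb : b ≤ 𝓝 r)
    (p : Polynomial ℝ) : (fun x => p.eval x) =O[b] fun x => (x - l) ^ (n - 1) := by
  have hc : ContinuousAt (fun x => (x - l) ^ (n - 1)) r :=
    ((continuous_id.sub continuous_const).pow _).continuousAt
  have hr : (r - l) ^ (n - 1) ≠ 0 := pow_ne_zero _ (sub_ne_zero.2 hlr)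
  refine (Asymptotics.isBigO_of_div_tendsto_nhds ?_ (p.eval r / (r - l) ^ (n - 1)) ?_).mono hb
  · filter_upwards [hc.eventually_ne hr] with x hx h0 using absurd h0 hx
  · exact (p.continuous.continuousAt.div hc hr).tendsto

theorem isBigO_pow_sub_atTop {n : ℕ} (l : ℝ) (p : Polynomial ℝ) (hp : p.natDegree < n) :
    (fun x => p.eval x) =O[atTop] fun x => (x - l) ^ (n - 1) := by
  have h := Polynomial.isBigO_atTop_of_degree_le p ((Polynomial.X - Polynomial.C l) ^ (n - 1)) (by
    rw [Polynomial.degree_pow, Polynomial.degree_X_sub_C, nsmul_eq_mul, mul_one]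
    exact Polynomial.degree_le_of_natDegree_le (by omega))
  simpa using h

theorem isBigO_pow_sub_atBot {n : ℕ} (l : ℝ) (p : Polynomial ℝ) (hp : p.natDegree < n) :
    (fun x => p.eval x) =O[atBot] fun x => (x - l) ^ (n - 1) := by
  have h := (isBigO_pow_sub_atTop (n := n) (-l) (p.comp (-Polynomial.X)) (by
    rw [Polynomial.natDegree_comp, Polynomial.natDegree_neg, Polynomial.natDegree_X, mul_one]
    exact hp)).comp_tendsto tendsto_neg_atBot_atTop
  have h2 : (fun x => (x - l) ^ (n - 1)) = fun x => (-1) ^ (n - 1) * (-x - -l) ^ (n - 1) := by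
    ext x; rw [← mul_pow]; ring
  rw [h2]
  refine Asymptotics.IsBigO.const_mul_right (by simp) ?_
  simpa [Function.comp_def] using h

/-- A twisted primitive is constant below the support. -/
theorem IsTwistedPrimitive.eq_of_support_subset_Ioi {n : ℕ} {f φ : ℝ → ℝ}
    (hφ : IsTwistedPrimitive n f φ) {l x : ℝ} (hl : ∀ y ≤ l, f y = 0) (hx : x ≤ l) :
    φ x = φ l := by
  obtain ⟨α, κ, h, -⟩ := hφ
  have : ∀ z ≤ l, ∀ j, lowerMoment f j z = 0 := fun z hz j =>
    setIntegral_eq_zero_of_forall_eq_zero fun y hy => by rw [hl y (le_trans hy hz), zero_mul]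
  simp [h, this x hx, this l le_rfl]

/-- A twisted primitive is constant above the support. -/
theorem IsTwistedPrimitive.eq_of_support_subset_Iio {n : ℕ} {f φ : ℝ → ℝ} (hf : HasMoments n f)
    (hφ : IsTwistedPrimitive n f φ) {r x : ℝ} (hr : ∀ y, r ≤ y → f y = 0) (hx : r ≤ x) :
    φ x = φ r := by
  obtain ⟨α, κ, h, -⟩ := hφ
  have : ∀ z, r ≤ z → ∀ j : Fin n, lowerMoment f j z = totalMoment f j := fun z hz j => by
    have h1 := setIntegral_Ioi_eq hf j.isLt z
    rw [setIntegral_eq_zero_of_forall_eq_zero fun y hy => by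
      rw [hr y (hz.trans (le_of_lt hy)), zero_mul]] at h1
    linarith
  simp [h, this x hx, this r le_rfl]

theorem exists_lower_end {I : Set ℝ} (hIopen : IsOpen I) (hI : I.OrdConnected)
    (hne : I.Nonempty) : (∀ᶠ x in atBot, x ∈ I) ∨
      ∃ l, (∀ y ≤ l, y ∉ I) ∧ ∀ᶠ x in 𝓝[>] l, x ∈ I := by
  obtain ⟨x₀, hx₀⟩ := hne
  by_cases hb : BddBelow I
  · right
    have hl : ∀ y ≤ sInf I, y ∉ I := by
      intro y hy hyI
      obtain ⟨z, hzy, hz⟩ := ((eventually_mem_set.2 (nhdsWithin_le_nhds (hIopen.mem_nhds hyI))).and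
        (self_mem_nhdsWithin (s := Set.Iio y))).exists
      exact absurd (csInf_le hb hzy) (not_le.2 (lt_of_lt_of_le hz hy))
    refine ⟨sInf I, hl, ?_⟩
    have hlt : sInf I < x₀ := not_le.1 fun h => hl x₀ h hx₀
    filter_upwards [Ioo_mem_nhdsGT hlt] with x hx
    obtain ⟨i, hi, hix⟩ := exists_lt_of_csInf_lt ⟨x₀, hx₀⟩ hx.1
    exact hI.out hi hx₀ ⟨hix.le, hx.2.le⟩
  · left
    filter_upwards [eventually_le_atBot x₀] with x hx
    obtain ⟨i, hi, hix⟩ := not_bddBelow_iff.1 hb x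
    exact hI.out hi hx₀ ⟨hix.le, hx⟩

theorem exists_upper_end {I : Set ℝ} (hIopen : IsOpen I) (hI : I.OrdConnected)
    (hne : I.Nonempty) : (∀ᶠ x in atTop, x ∈ I) ∨
      ∃ r, (∀ y, r ≤ y → y ∉ I) ∧ ∀ᶠ x in 𝓝[<] r, x ∈ I := by
  obtain ⟨x₀, hx₀⟩ := hne
  by_cases hb : BddAbove I
  · right
    have hl : ∀ y, sSup I ≤ y → y ∉ I := by
      intro y hy hyI
      obtain ⟨z, hzy, hz⟩ := ((eventually_mem_set.2 (nhdsWithin_le_nhds (hIopen.mem_nhds hyI))).and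
        (self_mem_nhdsWithin (s := Set.Ioi y))).exists
      exact absurd (le_csSup hb hzy) (not_le.2 (lt_of_le_of_lt hy hz))
    refine ⟨sSup I, hl, ?_⟩
    have hlt : x₀ < sSup I := not_le.1 fun h => hl x₀ h hx₀
    filter_upwards [Ioo_mem_nhdsLT hlt] with x hx
    obtain ⟨i, hi, hix⟩ := exists_lt_of_lt_csSup ⟨x₀, hx₀⟩ hx.2
    exact hI.out hx₀ hi ⟨hx.1.le, hix.le⟩
  · left
    filter_upwards [eventually_ge_atTop x₀] with x hx
    obtain ⟨i, hi, hix⟩ := not_bddAbove_iff.1 hb x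
    exact hI.out hx₀ hi ⟨hx, hix.le⟩

/-- The support is not bounded on either side: at a finite end point of the support all the
functions `h * p` would vanish. -/
theorem eq_univ_of_multiplier {n : ℕ} (hn : 2 ≤ n) {f : ℝ → ℝ} (hm : HasMoments n f) {I : Set ℝ}
    (hIopen : IsOpen I) (hI : I.OrdConnected) (hI0 : I.Nonempty) (hsupp : Function.support f = I)
    {h : ℝ → ℝ} {Φ : Polynomial ℝ → ℝ → ℝ} (hΦ : ∀ p, IsTwistedPrimitive n f (Φ p))
    (hval : ∀ p : Polynomial ℝ, p.natDegree < n → ∀ x, f x ≠ 0 → Φ p x = h x * p.eval x)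
    (hne : ∀ x, ∃ p : Polynomial ℝ, p.natDegree < n ∧ Φ p x ≠ 0) :
    I = Set.univ := by
  have hmem : ∀ x, x ∈ I ↔ f x ≠ 0 := fun x => by rw [← hsupp]; rfl
  have hfzero : ∀ x, x ∉ I → f x = 0 := fun x hx => not_not.1 fun h => hx ((hmem x).2 h)
  have hΦc : ∀ p, Continuous (Φ p) := fun p => (hΦ p).continuous hm
  have hcongr : ∀ {a : Filter ℝ} {p : Polynomial ℝ} {A : ℝ}, (∀ᶠ x in a, x ∈ I) →
      p.natDegree < n → Tendsto (Φ p) a (𝓝 A) → Tendsto (fun x => h x * p.eval x) a (𝓝 A) := by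
    intro a p A ha hp hA
    refine hA.congr' ?_
    filter_upwards [ha] with x hx using hval p hp x ((hmem x).1 hx)
  have hsign : ((-1 : ℝ) ^ (n + 1)) ≠ 0 := by simp
  have hsq : ((-1 : ℝ) ^ (n + 1)) * (-1) ^ (n + 1) = 1 := by
    rw [← pow_add, ← two_mul, pow_mul]; simp
  -- the limits at the two ends, wherever these are
  have hbot : ∀ l, (∀ y ≤ l, y ∉ I) → ∀ p, ∃ A, Φ p l = (-1) ^ (n + 1) * A ∧
      Tendsto (Φ p) atTop (𝓝 A) := by
    intro l hl p
    obtain ⟨A, h1, h2⟩ := (hΦ p).exists_tendsto hm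
    refine ⟨A, tendsto_nhds_unique (tendsto_const_nhds.congr' ?_) h2, h1⟩
    filter_upwards [eventually_le_atBot l] with x hx
    exact ((hΦ p).eq_of_support_subset_Ioi (fun y hy => hfzero y (hl y hy)) hx).symm
  have htop : ∀ r, (∀ y, r ≤ y → y ∉ I) → ∀ p,
      Tendsto (Φ p) atTop (𝓝 (Φ p r)) := by
    intro r hr p
    refine tendsto_const_nhds.congr' ?_
    filter_upwards [eventually_ge_atTop r] with x hx
    exact ((hΦ p).eq_of_support_subset_Iio hm (fun y hy => hfzero y (hr y hy)) hx).symm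
  have hfinish : ∀ (a : Filter ℝ) (l : ℝ) [a.NeBot], a ≤ 𝓝 l → (∀ᶠ x in a, x ∈ I) →
      (∀ p : Polynomial ℝ, p.natDegree < n → Tendsto (fun x => h x * p.eval x) a (𝓝 0)) →
      False := by
    intro a l _ ha haI h0
    obtain ⟨p, hp, hpl⟩ := hne l
    exact hpl (tendsto_nhds_unique
      (hcongr haI hp ((hΦc p).continuousAt.tendsto.mono_left ha)) (h0 p hp))
  obtain ⟨x₀, hx₀⟩ := hI0
  rcases exists_lower_end hIopen hI ⟨x₀, hx₀⟩ with hlow | ⟨l, hl, hlI⟩ <;>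
    rcases exists_upper_end hIopen hI ⟨x₀, hx₀⟩ with hupp | ⟨r, hr, hrI⟩
  · refine Set.eq_univ_of_forall fun x => ?_
    obtain ⟨i, hi, hix⟩ := (hlow.and (eventually_le_atBot x)).exists
    obtain ⟨j, hj, hjx⟩ := (hupp.and (eventually_ge_atTop x)).exists
    exact hI.out hi hj ⟨hix, hjx⟩
  · exfalso
    refine hfinish (𝓝[<] r) r nhdsWithin_le_nhds hrI fun p hp =>
      tendsto_zero_of_twisted_ends (b := atBot) hn hsign nhdsWithin_le_nhds (fun p hp => ?_)
        (fun p hp => isBigO_pow_sub_atBot r p hp) p hp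
    obtain ⟨A, h1, h2⟩ := (hΦ p).exists_tendsto hm
    have h3 := tendsto_nhds_unique h1 (htop r hr p)
    refine ⟨A, hcongr hrI hp ?_, hcongr hlow hp h2⟩
    rw [h3]
    exact (hΦc p).continuousAt.tendsto.mono_left nhdsWithin_le_nhds
  · exfalso
    refine hfinish (𝓝[>] l) l nhdsWithin_le_nhds hlI fun p hp =>
      tendsto_zero_of_twisted_ends (b := atTop) hn hsign nhdsWithin_le_nhds (fun p hp => ?_)
        (fun p hp => isBigO_pow_sub_atTop l p hp) p hp
    obtain ⟨A, h1, h2⟩ := hbot l hl p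
    refine ⟨Φ p l, hcongr hlI hp
      ((hΦc p).continuousAt.tendsto.mono_left nhdsWithin_le_nhds), hcongr hupp hp ?_⟩
    rwa [h1, ← mul_assoc, hsq, one_mul]
  · exfalso
    have hlr : r ≠ l := by
      rintro rfl
      rcases le_total x₀ r with hx | hx
      · exact hl x₀ hx hx₀
      · exact hr x₀ hx hx₀
    refine hfinish (𝓝[>] l) l nhdsWithin_le_nhds hlI fun p hp =>
      tendsto_zero_of_twisted_ends (b := 𝓝[<] r) hn hsign nhdsWithin_le_nhds (fun p hp => ?_)
        (fun p _ => isBigO_pow_sub_of_ne hlr nhdsWithin_le_nhds p) p hp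
    obtain ⟨A, h1, h2⟩ := hbot l hl p
    have h3 := tendsto_nhds_unique h2 (htop r hr p)
    refine ⟨Φ p l, hcongr hlI hp
      ((hΦc p).continuousAt.tendsto.mono_left nhdsWithin_le_nhds), hcongr hrI hp ?_⟩
    rw [h1, ← mul_assoc, hsq, one_mul, h3]
    exact (hΦc p).continuousAt.tendsto.mono_left nhdsWithin_le_nhds

/-! ### The differential equation for the multiplier -/

/-- If `h = f * v`, and `(h * p)' / f` is a polynomial of degree less than `n` for every polynomial
`p` of degree less than `n`, then `v` is a polynomial `γ x ^ 2 + δ x + ε` and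
`h' / f = -(n - 1) γ x + β`. -/
theorem exists_quadratic_of_multiplier {n : ℕ} (hn : 2 ≤ n) {f h : ℝ → ℝ} (hf : ∀ x, f x ≠ 0)
    (hd : ∀ p : Polynomial ℝ, p.natDegree < n → ∃ q : Polynomial ℝ, q.natDegree < n ∧
      ∀ x, HasDerivAt (fun y => h y * p.eval y) (f x * q.eval x) x) :
    ∃ γ δ ε β : ℝ, (∀ x, h x = f x * (γ * x ^ 2 + δ * x + ε)) ∧
      ∀ x, HasDerivAt h (f x * (-((n - 1 : ℕ) * γ) * x + β)) x := by
  obtain ⟨m, rfl⟩ : ∃ m, n = m + 2 := ⟨n - 2, by omega⟩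
  obtain ⟨q₀, -, h₀⟩ := hd 1 (by simp)
  obtain ⟨q₁, -, h₁⟩ := hd Polynomial.X (by simp)
  simp only [Polynomial.eval_one, mul_one, Polynomial.eval_X] at h₀ h₁
  set v := q₁ - Polynomial.X * q₀ with hv
  have hhv : ∀ x, h x = f x * v.eval x := fun x => by
    have := (h₁ x).unique ((h₀ x).mul (hasDerivAt_id x))
    simp only [mul_one] at this
    simp only [hv, Polynomial.eval_sub, Polynomial.eval_mul, Polynomial.eval_X]
    linear_combination -this
  -- for monomials `p`, the polynomials `q₀ * p + v * p'` have degree less than `n`; the cases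
  -- `p = X ^ (n - 2)` and `p = X ^ (n - 1)` bound the degrees of `v` and of `q₀`
  have hq : ∀ k < m + 2, ∃ q : Polynomial ℝ, q.natDegree < m + 2 ∧
      q = q₀ * Polynomial.X ^ k + v * (Polynomial.C (k : ℝ) * Polynomial.X ^ (k - 1)) := by
    intro k hk
    obtain ⟨q, hqd, hq⟩ := hd (Polynomial.X ^ k) (by simpa using hk)
    refine ⟨q, hqd, Polynomial.funext fun x => mul_left_cancel₀ (hf x) ?_⟩
    simp only [Polynomial.eval_pow, Polynomial.eval_X] at hq
    have := (hq x).unique ((h₀ x).mul (hasDerivAt_pow k x))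
    rw [this, hhv x]
    simp only [Polynomial.eval_add, Polynomial.eval_mul, Polynomial.eval_pow, Polynomial.eval_X,
      Polynomial.eval_C]
    ring
  obtain ⟨a, had, ha⟩ := hq m (by omega)
  obtain ⟨b, hbd, hb⟩ := hq (m + 1) (by omega)
  have hXm : v * (Polynomial.C (m : ℝ) * Polynomial.X ^ (m - 1)) * Polynomial.X =
      Polynomial.C (m : ℝ) * v * Polynomial.X ^ m := by
    obtain _ | m := m
    · simp
    · rw [Nat.add_sub_cancel, pow_succ]; ring
  have e1 : v * Polynomial.X ^ m = b - a * Polynomial.X := by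
    rw [ha, hb, add_mul, hXm, Nat.add_sub_cancel]
    push_cast
    rw [Polynomial.C_add, Polynomial.C_1]
    ring
  have e2 : q₀ * Polynomial.X ^ (m + 1) = a * Polynomial.X -
      Polynomial.C (m : ℝ) * v * Polynomial.X ^ m := by
    rw [ha, add_mul, hXm]; ring
  have hv3 : ∀ i, 3 ≤ i → v.coeff i = 0 := by
    intro i hi
    have h := congrArg (fun p => Polynomial.coeff p (i + m)) e1
    obtain ⟨j, rfl⟩ : ∃ j, i = j + 1 := ⟨i - 1, by omega⟩
    simp only [Polynomial.coeff_mul_X_pow, Polynomial.coeff_sub] at h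
    rw [h, show j + 1 + m = (j + m) + 1 by omega, Polynomial.coeff_mul_X,
      Polynomial.coeff_eq_zero_of_natDegree_lt (by omega),
      Polynomial.coeff_eq_zero_of_natDegree_lt (by omega), sub_zero]
  have hq2 : ∀ i, 2 ≤ i → q₀.coeff i = 0 := by
    intro i hi
    have h := congrArg (fun p => Polynomial.coeff p (i + (m + 1))) e2
    simp only [Polynomial.coeff_mul_X_pow, Polynomial.coeff_sub] at h
    rw [h, show i + (m + 1) = (i + m) + 1 by omega, Polynomial.coeff_mul_X,
      Polynomial.coeff_eq_zero_of_natDegree_lt (by omega), show i + m + 1 = (i + 1) + m by omega,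
      Polynomial.coeff_mul_X_pow, Polynomial.coeff_C_mul, hv3 _ (by omega), mul_zero, sub_zero]
  have htop : q₀.coeff 1 + (m + 1) * v.coeff 2 = 0 := by
    have h := congrArg (fun p => Polynomial.coeff p (m + 2)) hb
    simp only [Polynomial.coeff_add, Nat.add_sub_cancel] at h
    rw [Polynomial.coeff_eq_zero_of_natDegree_lt hbd, show m + 2 = 1 + (m + 1) by omega,
      Polynomial.coeff_mul_X_pow, show 1 + (m + 1) = 2 + m by omega, ← mul_assoc,
      Polynomial.coeff_mul_X_pow, Polynomial.coeff_mul_C] at h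
    push_cast at h
    linarith
  have hvd : v.natDegree < 3 := by
    rw [Nat.lt_succ_iff, Polynomial.natDegree_le_iff_coeff_eq_zero]
    exact fun i hi => hv3 i hi
  have hqd : q₀.natDegree < 2 := by
    rw [Nat.lt_succ_iff, Polynomial.natDegree_le_iff_coeff_eq_zero]
    exact fun i hi => hq2 i hi
  refine ⟨v.coeff 2, v.coeff 1, v.coeff 0, q₀.coeff 0, fun x => ?_, fun x => ?_⟩
  · rw [hhv, Polynomial.eval_eq_sum_range' hvd]
    simp only [Finset.sum_range_succ, Finset.sum_range_zero]
    ring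
  · refine (h₀ x).congr_deriv ?_
    rw [Polynomial.eval_eq_sum_range' hqd]
    simp only [Finset.sum_range_succ, Finset.sum_range_zero]
    rw [show m + 2 - 1 = m + 1 by omega]
    push_cast
    linear_combination (f x * x) * htop

/-- A multiple of an exponential cannot be a multiplier: the limits of `h * x` at `±∞` force `h` to
tend to `0` at both ends. -/
theorem false_of_exponential_multiplier {h : ℝ → ℝ} {c A B : ℝ} (h0 : h 0 ≠ 0)
    (hd : ∀ x, HasDerivAt h (c * h x) x) (hA : Tendsto (fun x => h x * x) atTop (𝓝 A))
    (hB : Tendsto (fun x => h x * x) atBot (𝓝 B)) : False := by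
  have hexp : ∀ x, h x = h 0 * Real.exp (c * x) := by
    intro x
    have hder : ∀ y, HasDerivAt (fun y => h y * Real.exp (-(c * y))) 0 y := fun y => by
      have h1 : HasDerivAt (fun y => -(c * y)) (-c) y := by
        exact ((hasDerivAt_id y).const_mul c).neg.congr_deriv (by rw [mul_one])
      refine ((hd y).mul h1.exp).congr_deriv ?_
      ring
    have h2 : h x * Real.exp (-(c * x)) = h 0 * Real.exp (-(c * 0)) :=
      is_const_of_deriv_eq_zero (fun y => (hder y).differentiableAt) (fun y => (hder y).deriv) x 0
    rw [mul_zero, neg_zero, Real.exp_zero, mul_one] at h2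
    rw [← h2, mul_assoc, ← Real.exp_add]
    simp
  have hzero : ∀ {a : Filter ℝ} {L : ℝ}, Tendsto (fun x => x⁻¹) a (𝓝 0) → (∀ᶠ x in a, x ≠ 0) →
      Tendsto (fun x => h x * x) a (𝓝 L) → Tendsto h a (𝓝 0) := by
    intro a L h1 h2 h3
    have := h3.mul h1
    rw [mul_zero] at this
    refine this.congr' ?_
    filter_upwards [h2] with x hx
    field_simp
  have hfin : ∀ {a : Filter ℝ} [a.NeBot], (∀ᶠ x in a, 0 ≤ c * x) → Tendsto h a (𝓝 0) → False := by
    intro a _ h1 h2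
    have h3 : |h 0| ≤ 0 := by
      refine ge_of_tendsto (by simpa using h2.abs) ?_
      filter_upwards [h1] with x hx
      rw [hexp x, abs_mul, abs_of_pos (Real.exp_pos _)]
      exact le_mul_of_one_le_right (abs_nonneg _) (Real.one_le_exp hx)
    exact h0 (abs_nonpos_iff.1 h3)
  rcases le_total 0 c with hc | hc
  · refine hfin (a := atTop) ?_ (hzero tendsto_inv_atTop_zero (eventually_ne_atTop 0) hA)
    filter_upwards [eventually_ge_atTop 0] with x hx using mul_nonneg hc hx
  · refine hfin (a := atBot) ?_ (hzero tendsto_inv_atBot_zero (eventually_ne_atBot 0) hB)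
    filter_upwards [eventually_le_atBot 0] with x hx using mul_nonneg_of_nonpos_of_nonpos hc hx

/-- A quadratic polynomial without real roots is constant or a multiple of `1 + (a x + b) ^ 2`. -/
theorem quadratic_eq_of_no_root {γ δ ε : ℝ} (hroot : ∀ x : ℝ, γ * x ^ 2 + δ * x + ε ≠ 0) :
    (γ = 0 ∧ δ = 0) ∨ ∃ a b : ℝ, 0 < a ∧ γ ≠ 0 ∧
      ∀ x, γ * x ^ 2 + δ * x + ε = γ / a ^ 2 * (1 + (a * x + b) ^ 2) := by
  by_cases hγ : γ = 0
  · left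
    refine ⟨hγ, ?_⟩
    by_contra hδ
    refine hroot (-ε / δ) ?_
    rw [hγ]; field_simp; ring
  · right
    have hdisc : 0 < (4 * γ * ε - δ ^ 2) / (4 * γ ^ 2) := by
      refine div_pos ?_ (by positivity)
      by_contra hneg
      have hs : Real.sqrt (δ ^ 2 - 4 * γ * ε) ^ 2 = δ ^ 2 - 4 * γ * ε :=
        Real.sq_sqrt (by linarith)
      set s := Real.sqrt (δ ^ 2 - 4 * γ * ε)
      refine hroot ((-δ + s) / (2 * γ)) ?_
      field_simp
      linear_combination hs
    set w := Real.sqrt ((4 * γ * ε - δ ^ 2) / (4 * γ ^ 2)) with hw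
    have hw0 : 0 < w := Real.sqrt_pos.2 hdisc
    have hw2 : w ^ 2 = (4 * γ * ε - δ ^ 2) / (4 * γ ^ 2) := Real.sq_sqrt hdisc.le
    refine ⟨w⁻¹, δ / (2 * γ) * w⁻¹, inv_pos.2 hw0, hγ, fun x => ?_⟩
    have e : γ / w⁻¹ ^ 2 * (1 + (w⁻¹ * x + δ / (2 * γ) * w⁻¹) ^ 2) =
        γ * w ^ 2 + γ * (x + δ / (2 * γ)) ^ 2 := by
      field_simp
    rw [e, hw2]
    field_simp
    ring

/-- The weight of a multiplier is a Cauchy weight. With `h = f * v`, `v = γ / a ^ 2 * (1 + t ^ 2)`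
and `t = a x + b`, the differential equation gives
`h = K * (1 + t ^ 2) ^ (-(n - 1) / 2) * exp (μ * arctan t)`, and comparing the limits of
`h * t ^ (n - 1)` at `±∞` gives `μ = 0`. -/
theorem eq_cauchyRoot_of_multiplier {n : ℕ} (hn : 2 ≤ n) {f h : ℝ → ℝ} (hf : ∀ x, f x ≠ 0)
    (hh : ∀ x, h x ≠ 0)
    (hd : ∀ p : Polynomial ℝ, p.natDegree < n → ∃ q : Polynomial ℝ, q.natDegree < n ∧
      ∀ x, HasDerivAt (fun y => h y * p.eval y) (f x * q.eval x) x)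
    (hlim : ∀ p : Polynomial ℝ, p.natDegree < n → ∃ A,
      Tendsto (fun x => h x * p.eval x) atTop (𝓝 A) ∧
      Tendsto (fun x => h x * p.eval x) atBot (𝓝 ((-1) ^ (n + 1) * A))) :
    ∃ a b c : ℝ, 0 < a ∧ ∀ x, f x = c * cauchyRoot (a * x + b) ^ (n + 1) := by
  obtain ⟨γ, δ, ε, β, hv, hh'⟩ := exists_quadratic_of_multiplier hn hf hd
  rcases quadratic_eq_of_no_root (γ := γ) (δ := δ) (ε := ε) fun x h0 =>
    hh x (by rw [hv, h0, mul_zero]) with ⟨rfl, rfl⟩ | ⟨a, b, ha, hγ, hquad⟩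
  · exfalso
    obtain ⟨A, hA, hB⟩ := hlim Polynomial.X (by simp; omega)
    simp only [Polynomial.eval_X] at hA hB
    have hε : ε ≠ 0 := fun h0 => hh 0 (by rw [hv, h0]; ring)
    refine false_of_exponential_multiplier (c := β / ε) (hh 0) (fun x => ?_) hA hB
    refine (hh' x).congr_deriv ?_
    rw [hv x]; field_simp; ring
  · have ha0 := ha.ne'
    set μ : ℝ := ((n - 1 : ℕ) * γ * b / a + β) * a / γ with hμ
    set E : ℝ → ℝ := fun x => cauchyRoot (a * x + b) ^ (n - 1) *
      Real.exp (μ * Real.arctan (a * x + b)) with hE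
    have hE0 : ∀ x, E x ≠ 0 := fun x =>
      (mul_pos (pow_pos (cauchyRoot_pos _) _) (Real.exp_pos _)).ne'
    have hE' : ∀ x, HasDerivAt E
        (E x * (cauchyRoot (a * x + b) ^ 2 * (a * (μ - (n - 1 : ℕ) * (a * x + b))))) x := by
      intro x
      have h1 : HasDerivAt (fun x => a * x + b) a x := by
        simpa using ((hasDerivAt_id x).const_mul a).add_const b
      have h2 := (h1.arctan.const_mul μ).exp
      refine ((hasDerivAt_cauchyRoot_affine_pow a b (n - 1) x).mul h2).congr_deriv ?_
      have e1 : 1 / (1 + (a * x + b) ^ 2) = cauchyRoot (a * x + b) ^ 2 := by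
        rw [one_div]; exact (eq_inv_of_mul_eq_one_left (cauchyRoot_sq _)).symm
      rw [e1, hE, pow_add]
      ring
    have hconst : ∀ x, h x = h 0 / E 0 * E x := by
      intro x
      have hder : ∀ y, HasDerivAt (fun y => h y / E y) 0 y := fun y => by
        refine ((hh' y).div (hE' y) (hE0 y)).congr_deriv ?_
        rw [div_eq_zero_iff]
        left
        rw [hv y, hquad y]
        have e1 := cauchyRoot_sq (a * y + b)
        have e2 : -((n - 1 : ℕ) * γ) * y + β = γ / a * (μ - (n - 1 : ℕ) * (a * y + b)) := by
          rw [hμ]; field_simp; ring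
        rw [e2]
        set t := a * y + b
        field_simp
        linear_combination (-f y * E y * γ * (μ - (n - 1 : ℕ) * t)) * e1
      have h2 : h x / E x = h 0 / E 0 :=
        is_const_of_deriv_eq_zero (fun y => (hder y).differentiableAt) (fun y => (hder y).deriv) x 0
      rw [← h2, div_mul_cancel₀ _ (hE0 x)]
    set K := h 0 / E 0 with hK
    have hK0 : K ≠ 0 := div_ne_zero (hh 0) (hE0 0)
    -- comparison of the limits at the two ends
    have hμ0 : μ = 0 := by
      let T : Polynomial ℝ := (Polynomial.C a * Polynomial.X + Polynomial.C b) ^ (n - 1)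
      have hT : T.natDegree < n := by
        refine lt_of_le_of_lt Polynomial.natDegree_pow_le ?_
        refine lt_of_le_of_lt (Nat.mul_le_mul_left _ Polynomial.natDegree_linear_le) ?_
        omega
      obtain ⟨A, hA, hB⟩ := hlim T hT
      have hform : ∀ x, h x * T.eval x = K * (((a * x + b) * cauchyRoot (a * x + b)) ^ (n - 1) *
          Real.exp (μ * Real.arctan (a * x + b))) := by
        intro x
        have hTe : T.eval x = (a * x + b) ^ (n - 1) := by simp [T]
        rw [hconst x, hTe, hE, mul_pow]; ring
      obtain ⟨htop, hbot⟩ := tendsto_affine b ha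
      have l1 : Tendsto (fun t => K * ((t * cauchyRoot t) ^ (n - 1) * Real.exp (μ * Real.arctan t)))
          atTop (𝓝 (K * (1 ^ (n - 1) * Real.exp (μ * (Real.pi / 2))))) :=
        ((tendsto_mul_cauchyRoot_atTop.pow _).mul ((Real.continuous_exp.tendsto _).comp
          ((Real.tendsto_arctan_atTop.mono_right nhdsWithin_le_nhds).const_mul μ))).const_mul K
      have l2 : Tendsto (fun t => K * ((t * cauchyRoot t) ^ (n - 1) * Real.exp (μ * Real.arctan t)))
          atBot (𝓝 (K * ((-1) ^ (n - 1) * Real.exp (μ * (-(Real.pi / 2)))))) :=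
        ((tendsto_mul_cauchyRoot_atBot.pow _).mul ((Real.continuous_exp.tendsto _).comp
          ((Real.tendsto_arctan_atBot.mono_right nhdsWithin_le_nhds).const_mul μ))).const_mul K
      have e1 := tendsto_nhds_unique (hA.congr hform) (l1.comp htop)
      have e2 := tendsto_nhds_unique (hB.congr hform) (l2.comp hbot)
      have e3 : ((-1 : ℝ) ^ (n + 1)) = (-1) ^ (n - 1) := by
        rw [show n + 1 = (n - 1) + 2 by omega, pow_add]; simp
      rw [e1, e3, one_pow, one_mul] at e2
      have e4 : Real.exp (μ * (Real.pi / 2)) = Real.exp (μ * (-(Real.pi / 2))) := by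
        apply mul_left_cancel₀ (mul_ne_zero hK0 (pow_ne_zero (n - 1) (neg_ne_zero.2 one_ne_zero)))
        linear_combination e2
      have e5 := Real.exp_injective e4
      have e6 : μ * Real.pi = 0 := by linear_combination e5
      exact (mul_eq_zero.1 e6).resolve_right Real.pi_ne_zero
    refine ⟨a, b, K * a ^ 2 / γ, ha, fun x => ?_⟩
    have e1 := cauchyRoot_sq (a * x + b)
    have e2 := hconst x
    rw [hv x, hquad x, hE, hμ0] at e2
    simp only [zero_mul, Real.exp_zero, mul_one] at e2
    have e3 : cauchyRoot (a * x + b) ^ (n + 1) =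
        cauchyRoot (a * x + b) ^ (n - 1) * cauchyRoot (a * x + b) ^ 2 := by
      rw [← pow_add]; congr 1; omega
    rw [e3]
    set t := a * x + b
    have e4 : f x * (γ / a ^ 2) = K * cauchyRoot t ^ (n - 1) * cauchyRoot t ^ 2 := by
      calc f x * (γ / a ^ 2) = f x * (γ / a ^ 2 * (1 + t ^ 2)) * cauchyRoot t ^ 2 := by
            linear_combination (-f x * (γ / a ^ 2)) * e1
        _ = _ := by rw [e2]
    field_simp at e4 ⊢
    linear_combination e4

/-! ### The weight is determined by the ensemble up to a constant -/

theorem jointDensity_const_mul {β n : ℕ} (c : ℝ) (w : ℝ → ℝ) (x : Fin n → ℝ) :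
    jointDensity β n (fun x => c * w x) x = c ^ n * jointDensity β n w x := by
  simp [jointDensity, Finset.prod_mul_distrib, mul_assoc]

theorem jointDensity_congr_ae {β n : ℕ} {w w' : ℝ → ℝ} (h : w =ᵐ[volume] w') :
    jointDensity β n w =ᵐ[volume] jointDensity β n w' := by
  have h1 : ∀ i : Fin n, ∀ᵐ x : Fin n → ℝ, w (x i) = w' (x i) := fun i =>
    (Measure.quasiMeasurePreserving_eval (fun _ : Fin n => (volume : Measure ℝ)) i).ae h
  filter_upwards [ae_all_iff.2 h1] with x hx
  simp only [jointDensity, hx]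

theorem IsWeight.of_ae_eq_mul {β n : ℕ} {w w' : ℝ → ℝ} (hw : IsWeight β n w) {K : ℝ} (hK : 0 < K)
    (h : ∀ᵐ x, jointDensity β n w' x = K * jointDensity β n w x) : IsWeight β n w' := by
  refine ⟨?_, (hw.integrable.const_mul K).congr (h.mono fun x hx => hx.symm), ?_⟩
  · filter_upwards [h, hw.nonneg] with x hx h0
    rw [hx]; positivity
  · rw [integral_congr_ae h, integral_const_mul]
    exact mul_pos hK hw.integral_pos

theorem IsWeight.pos_of_ae_eq_mul {β n : ℕ} {w w' : ℝ → ℝ} (hw : IsWeight β n w)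
    (hw' : IsWeight β n w') {K : ℝ}
    (h : ∀ᵐ x, jointDensity β n w' x = K * jointDensity β n w x) : 0 < K := by
  have := hw'.integral_pos
  rw [integral_congr_ae h, integral_const_mul] at this
  exact pos_of_mul_pos_left this hw.integral_pos.le

theorem ensemble_eq_of_ae_eq_mul {β n : ℕ} {w w' : ℝ → ℝ} {K : ℝ} (hK : 0 < K)
    (h : ∀ᵐ x, jointDensity β n w' x = K * jointDensity β n w x) :
    ensemble β n w' = ensemble β n w := by
  have h1 : (fun x => ENNReal.ofReal (jointDensity β n w' x)) =ᵐ[volume]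
      (ENNReal.ofReal K) • fun x => ENNReal.ofReal (jointDensity β n w x) := by
    filter_upwards [h] with x hx
    rw [hx, ENNReal.ofReal_mul hK.le]; rfl
  have hK0 : ENNReal.ofReal K ≠ 0 := by simpa using hK
  have hKt : ENNReal.ofReal K ≠ ⊤ := ENNReal.ofReal_ne_top
  rw [ensemble, ensemble, withDensity_congr_ae h1, withDensity_smul' _ _ hKt,
    lintegral_congr_ae h1]
  simp only [Pi.smul_apply, smul_eq_mul]
  rw [lintegral_const_mul' _ _ hKt, smul_smul, ENNReal.mul_inv (Or.inl hK0) (Or.inl hKt),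
    mul_right_comm, ENNReal.inv_mul_cancel hK0 hKt, one_mul]

/-- A weight is determined by the joint density up to a constant: all points but one are frozen. -/
theorem ae_eq_const_mul_of_jointDensity {β n : ℕ} (hn : 0 < n) {w w' : ℝ → ℝ}
    (hw' : IsWeight β n w') {K : ℝ}
    (h : ∀ᵐ x, jointDensity β n w' x = K * jointDensity β n w x) :
    ∃ d : ℝ, ∀ᵐ x, w' x = d * w x := by
  obtain ⟨u, hu, hu0⟩ := exists_jointDensity_ne_zero hw' (ae_update (h.and ae_injective))
  let k : Fin n := ⟨0, hn⟩
  have hA : ∏ i ∈ Finset.univ.erase k, w' (u i) ≠ 0 := Finset.prod_ne_zero_iff.2 fun i _ =>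
    Finset.prod_ne_zero_iff.1 (left_ne_zero_of_mul hu0) i (Finset.mem_univ i)
  have hprod : ∀ (v : ℝ → ℝ) (x : ℝ), ∏ i, v (Function.update u k x i) =
      v x * ∏ i ∈ Finset.univ.erase k, v (u i) := fun v x => by
    rw [← Finset.mul_prod_erase _ _ (Finset.mem_univ k), Function.update_self]
    congr 1
    refine Finset.prod_congr rfl fun i hi => ?_
    rw [Function.update_of_ne (Finset.ne_of_mem_erase hi)]
  refine ⟨K * (∏ i ∈ Finset.univ.erase k, w (u i)) / ∏ i ∈ Finset.univ.erase k, w' (u i), ?_⟩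
  filter_upwards [hu k] with x hx
  obtain ⟨h1, h2⟩ := hx
  have hΔ : |vandermonde (Function.update u k x)| ^ β ≠ 0 :=
    pow_ne_zero _ (abs_ne_zero.2 (vandermonde_ne_zero_iff.2 h2))
  rw [jointDensity, jointDensity, ← mul_assoc] at h1
  have h3 := mul_right_cancel₀ hΔ h1
  rw [hprod, hprod] at h3
  rw [div_mul_eq_mul_div, eq_div_iff hA, h3]; ring

/-! ### The Cauchy weight is the only solution -/

/-- The case of a nonnegative weight. -/
theorem eq_cauchyRoot_of_altLaw_eq_of_nonneg {n : ℕ} (hn : 2 ≤ n) {I : Set ℝ} (hIopen : IsOpen I)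
    (hI : I.OrdConnected) {f g : ℝ → ℝ} (hcont : ContinuousOn f I) (hzero : ∀ x, x ∉ I → f x = 0)
    (hf0 : ∀ x, 0 ≤ f x) (hf : IsWeight 1 n f) (hg : IsWeight 2 n g)
    (hlaw : altLaw (superpose (OE n f) (OE n f)) = orderedLaw (UE n g)) :
    I = Set.univ ∧ ∃ a b c : ℝ, 0 < a ∧ ∀ x, f x = c * cauchyRoot (a * x + b) ^ (n + 1) := by
  have hca : ∀ x ∈ I, ContinuousAt f x := fun x hx => hcont.continuousAt (hIopen.mem_nhds hx)
  have hsub : Function.support f ⊆ I := fun x hx => by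
    by_contra h
    exact hx (hzero x h)
  have hc : ∀ x, f x ≠ 0 → ContinuousAt f x := fun x hx => hca x (hsub hx)
  have hU : IsOpen (Function.support f) := isOpen_iff_mem_nhds.2 fun x hx =>
    (hc x hx).eventually_ne hx
  have hmeas : Measurable f := by
    classical
    have h1 : f = I.piecewise f 0 := by
      funext x
      by_cases hx : x ∈ I
      · simp [hx]
      · simp [hx, hzero x hx]
    rw [h1]
    exact hcont.measurable_piecewise continuousOn_const hIopen.measurableSet
  have hm : HasMoments n f := hasMoments_of_isWeight (by omega) hf hmeas hf0 hc
  obtain ⟨C, -, hid⟩ := (altLaw_eq_orderedLaw_iff hf hm hg).1 hlaw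
  have hU0 : (Function.support f).Nonempty := by
    obtain ⟨u, -, hu0⟩ := exists_jointDensity_ne_zero hf (P := fun _ => True) (by simp)
    exact ⟨u ⟨0, by omega⟩,
      Finset.prod_ne_zero_iff.1 (left_ne_zero_of_mul hu0) _ (Finset.mem_univ _)⟩
  obtain ⟨h, Φ, hΦ, hval, hne⟩ := exists_multiplier hn hf hm hU hid
  have hsupp := support_eq_of_multiplier hn hm hI hca hzero hU0 hU hΦ hval hne
  have huniv := eq_univ_of_multiplier hn hm hIopen hI (hsupp ▸ hU0) hsupp hΦ hval hne
  have hfne : ∀ x, f x ≠ 0 := fun x => by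
    have : x ∈ Function.support f := by rw [hsupp, huniv]; trivial
    exact this
  refine ⟨huniv, eq_cauchyRoot_of_multiplier hn hfne (h := h) (fun x h0 => ?_) (fun p hp => ?_)
    fun p hp => ?_⟩
  · obtain ⟨p, hp, hx⟩ := hne x
    rw [hval p hp x (hfne x), h0, zero_mul] at hx
    exact hx rfl
  · obtain ⟨q, hq, hd⟩ := exists_hasDerivAt_multiplier hn hm hU hc hΦ hval p hp
    exact ⟨q, hq, fun x => hd x (hfne x)⟩
  · have : Φ p = fun x => h x * p.eval x := funext fun x => hval p hp x (hfne x)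
    rw [← this]
    exact (hΦ p).exists_tendsto hm

theorem eq_cauchyRoot_of_altLaw_eq {n : ℕ} (hn : 2 ≤ n) {I : Set ℝ} (hIopen : IsOpen I)
    (hI : I.OrdConnected) {f g : ℝ → ℝ} (hcont : ContinuousOn f I) (hzero : ∀ x, x ∉ I → f x = 0)
    (hf : IsWeight 1 n f) (hg : IsWeight 2 n g)
    (hlaw : altLaw (superpose (OE n f) (OE n f)) = orderedLaw (UE n g)) :
    ∃ a b c : ℝ, 0 < a ∧ ∀ x, f x = c * cauchyRoot (a * x + b) ^ (n + 1) := by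
  -- the joint density is nonnegative, so `f` may be replaced by its absolute value
  have habs : ∀ᵐ x, jointDensity 1 n (fun x => |f x|) x = 1 * jointDensity 1 n f x := by
    filter_upwards [hf.nonneg] with x hx
    rw [one_mul, ← abs_of_nonneg hx]
    simp [jointDensity, abs_mul, Finset.abs_prod]
  have hOE : OE n (fun x => |f x|) = OE n f := ensemble_eq_of_ae_eq_mul one_pos habs
  obtain ⟨rfl, a, b, c, ha, hfa⟩ := eq_cauchyRoot_of_altLaw_eq_of_nonneg hn hIopen hI
    (f := fun x => |f x|) (g := g) hcont.abs (fun x hx => by simp [hzero x hx])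
    (fun x => abs_nonneg _) (hf.of_ae_eq_mul one_pos habs) hg (by rw [hOE]; exact hlaw)
  refine ⟨a, b, ?_⟩
  have hf0 : ∀ x, f x ≠ 0 := by
    have hc : c ≠ 0 := by
      rintro rfl
      obtain ⟨u, -, hu0⟩ := exists_jointDensity_ne_zero hf (P := fun _ => True) (by simp)
      refine Finset.prod_ne_zero_iff.1 (left_ne_zero_of_mul hu0) ⟨0, by omega⟩
        (Finset.mem_univ _) ?_
      simpa using hfa (u ⟨0, by omega⟩)
    intro x h0
    have h1 := hfa x
    rw [h0, abs_zero] at h1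
    exact mul_ne_zero hc (pow_ne_zero _ (cauchyRoot_pos _).ne') h1.symm
  -- a continuous function without zeros has constant sign
  have hsign : (∀ x, 0 < f x) ∨ ∀ x, f x < 0 := by
    by_contra! hcon
    obtain ⟨⟨x, hx⟩, ⟨y, hy⟩⟩ := hcon
    obtain ⟨z, -, hz⟩ := isPreconnected_univ.intermediate_value (Set.mem_univ x) (Set.mem_univ y)
      hcont ⟨hx, hy⟩
    exact hf0 z hz
  rcases hsign with h | h
  · exact ⟨c, ha, fun x => by rw [← hfa x, abs_of_pos (h x)]⟩
  · exact ⟨-c, ha, fun x => by rw [neg_mul, ← hfa x, abs_of_neg (h x), neg_neg]⟩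

/-- For the Cauchy weight, `UE_n(g)` is the alternating part of the superposition exactly when its
joint density is a positive multiple of that of the square of the Cauchy weight. -/
theorem altLaw_cauchyRoot_eq_iff {n : ℕ} (hn : 0 < n) {a : ℝ} (ha : 0 < a) (b : ℝ) {g : ℝ → ℝ}
    (hg : IsWeight 2 n g) :
    altLaw (superpose (OE n fun x => cauchyRoot (a * x + b) ^ (n + 1))
        (OE n fun x => cauchyRoot (a * x + b) ^ (n + 1))) = orderedLaw (UE n g) ↔
      ∃ K : ℝ, 0 < K ∧ ∀ᵐ x, jointDensity 2 n g x =
        K * jointDensity 2 n (fun x => cauchyRoot (a * x + b) ^ (2 * n)) x := by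
  obtain ⟨C₀, hC₀, h₀⟩ := exists_altDet_cauchyRoot hn ha b
  have hf : IsWeight 1 n fun x => cauchyRoot (a * x + b) ^ (n + 1) := by
    have h := isWeight_cauchyRoot (n := n) (β := 1) ha.ne' b
    rwa [show (n - 1) * 1 + 2 = n + 1 by omega] at h
  rw [altLaw_eq_orderedLaw_iff hf (hasMoments_cauchyRoot hn ha.ne' b) hg]
  constructor
  · rintro ⟨C, hC, h⟩
    refine ⟨C₀ / C, div_pos hC₀ hC, h.mono fun x hx => ?_⟩
    rw [h₀ x] at hx
    rw [div_mul_eq_mul_div, hx, mul_div_cancel_left₀ _ hC.ne']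
  · rintro ⟨K, hK, h⟩
    refine ⟨C₀ / K, div_pos hC₀ hK, h.mono fun x hx => ?_⟩
    rw [h₀ x, hx, ← mul_assoc, div_mul_cancel₀ _ hK.ne']

theorem isWeight_and_altLaw_eq_iff_cauchyRoot {n : ℕ} (hn : 2 ≤ n) {I : Set ℝ} (hIopen : IsOpen I)
    (hI : I.OrdConnected) {f g : ℝ → ℝ} (hcont : ContinuousOn f I)
    (hzero : ∀ x, x ∉ I → f x = 0) :
    (IsWeight 1 n f ∧ IsWeight 2 n g ∧
      altLaw (superpose (OE n f) (OE n f)) = orderedLaw (UE n g)) ↔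
    ∃ a b c d : ℝ, 0 < a ∧ 0 < c ^ n ∧ 0 < d ^ n ∧
      (∀ x, f x = c * cauchyRoot (a * x + b) ^ (n + 1)) ∧
      ∀ᵐ x : ℝ, g x = d * cauchyRoot (a * x + b) ^ (2 * n) := by
  have hn0 : 0 < n := by omega
  have hf₀ : ∀ {a : ℝ} (_ : 0 < a) (b : ℝ),
      IsWeight 1 n fun x => cauchyRoot (a * x + b) ^ (n + 1) := fun {a} ha b => by
    have h := isWeight_cauchyRoot (n := n) (β := 1) ha.ne' b
    rwa [show (n - 1) * 1 + 2 = n + 1 by omega] at h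
  have hg₀ : ∀ {a : ℝ} (_ : 0 < a) (b : ℝ),
      IsWeight 2 n fun x => cauchyRoot (a * x + b) ^ (2 * n) := fun {a} ha b => by
    have h := isWeight_cauchyRoot (n := n) (β := 2) ha.ne' b
    rwa [show (n - 1) * 2 + 2 = 2 * n by omega] at h
  constructor
  · rintro ⟨hf, hg, hlaw⟩
    obtain ⟨a, b, c, ha, hfc⟩ := eq_cauchyRoot_of_altLaw_eq hn hIopen hI hcont hzero hf hg hlaw
    have hfd : ∀ᵐ x : Fin n → ℝ, jointDensity 1 n f x =
        c ^ n * jointDensity 1 n (fun x => cauchyRoot (a * x + b) ^ (n + 1)) x := by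
      rw [funext hfc]
      exact .of_forall fun x => jointDensity_const_mul _ _ x
    have hc := (hf₀ ha b).pos_of_ae_eq_mul hf hfd
    have hOE : OE n f = OE n fun x => cauchyRoot (a * x + b) ^ (n + 1) :=
      ensemble_eq_of_ae_eq_mul hc hfd
    rw [hOE] at hlaw
    obtain ⟨K, -, hK⟩ := (altLaw_cauchyRoot_eq_iff hn0 ha b hg).1 hlaw
    obtain ⟨d, hd⟩ := ae_eq_const_mul_of_jointDensity hn0 hg hK
    refine ⟨a, b, c, d, ha, hc, (hg₀ ha b).pos_of_ae_eq_mul hg ?_, hfc, hd⟩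
    filter_upwards [jointDensity_congr_ae (β := 2) (n := n) hd] with x hx
    rw [hx, jointDensity_const_mul]
  · rintro ⟨a, b, c, d, ha, hc, hd, hfc, hgd⟩
    have hfd : ∀ᵐ x : Fin n → ℝ, jointDensity 1 n f x =
        c ^ n * jointDensity 1 n (fun x => cauchyRoot (a * x + b) ^ (n + 1)) x := by
      rw [funext hfc]
      exact .of_forall fun x => jointDensity_const_mul _ _ x
    have hgd' : ∀ᵐ x : Fin n → ℝ, jointDensity 2 n g x =
        d ^ n * jointDensity 2 n (fun x => cauchyRoot (a * x + b) ^ (2 * n)) x := by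
      filter_upwards [jointDensity_congr_ae (β := 2) (n := n) hgd] with x hx
      rw [hx, jointDensity_const_mul]
    have hg := (hg₀ ha b).of_ae_eq_mul hd hgd'
    have hOE : OE n f = OE n fun x => cauchyRoot (a * x + b) ^ (n + 1) :=
      ensemble_eq_of_ae_eq_mul hc hfd
    refine ⟨(hf₀ ha b).of_ae_eq_mul hc hfd, hg, ?_⟩
    rw [hOE]
    exact (altLaw_cauchyRoot_eq_iff hn0 ha b hg).2 ⟨_, hd, hgd'⟩

end EigenvalueEnsemble

end

theorem mainTheorem4 (n : ℕ) (hn : 2 ≤ n) (I : Set ℝ) (hIopen : IsOpen I)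
    (hIconn : I.OrdConnected) (f g : ℝ → ℝ) (hdiff : DifferentiableOn ℝ f I)
    (hzero : ∀ x, x ∉ I → f x = 0) :
    (EigenvalueEnsemble.IsWeight 1 n f ∧ EigenvalueEnsemble.IsWeight 2 n g ∧
      EigenvalueEnsemble.altLaw (EigenvalueEnsemble.superpose
          (EigenvalueEnsemble.OE n f) (EigenvalueEnsemble.OE n f)) =
        EigenvalueEnsemble.orderedLaw (EigenvalueEnsemble.UE n g)) ↔
    ∃ a b c d : ℝ, a ≠ 0 ∧ 0 < c ^ n ∧ 0 < d ^ n ∧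
      (∀ x, f x = c * (1 + (a * x + b) ^ 2) ^ (-((n : ℝ) + 1) / 2)) ∧
      (∀ᵐ x : ℝ, g x = d * (1 + (a * x + b) ^ 2) ^ (-(n : ℝ))) := by
  rw [EigenvalueEnsemble.isWeight_and_altLaw_eq_iff_cauchyRoot hn hIopen hIconn hdiff.continuousOn
    hzero]
  have h1 : ∀ t : ℝ, EigenvalueEnsemble.cauchyRoot t ^ (n + 1) =
      (1 + t ^ 2) ^ (-((n : ℝ) + 1) / 2) := fun t => by
    rw [EigenvalueEnsemble.cauchyRoot_pow, Nat.cast_add, Nat.cast_one]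
  have h2 : ∀ t : ℝ, EigenvalueEnsemble.cauchyRoot t ^ (2 * n) = (1 + t ^ 2) ^ (-(n : ℝ)) :=
    fun t => by
      rw [EigenvalueEnsemble.cauchyRoot_pow, Nat.cast_mul, Nat.cast_ofNat]
      congr 1; ring
  simp only [h1, h2]
  constructor
  · rintro ⟨a, b, c, d, ha, h⟩
    exact ⟨a, b, c, d, ha.ne', h⟩
  · rintro ⟨a, b, c, d, ha, h⟩
    rcases ha.lt_or_gt with ha | ha
    · -- the weights depend on `(a * x + b) ^ 2` only, so `(a, b)` may be replaced by `(-a, -b)`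
      refine ⟨-a, -b, c, d, neg_pos.2 ha, ?_⟩
      have : ∀ x : ℝ, (-a * x + -b) ^ 2 = (a * x + b) ^ 2 := fun x => by ring
      simpa only [this] using h
    · exact ⟨a, b, c, d, ha, h⟩
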